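/- Let $\Omega\subset\mathbb R^2$ be a bounded domain (open and connected) with Lipschitz boundary, and let $\Gamma_D,\Gamma_N\subset\partial\Omega$ be disjoint relatively open sets with $\partial\Omega=\overline{\Gamma}_D\cup\overline{\Gamma}_N$ and $\Gamma_D\neq\emptyset$. Let $\boldsymbol f\in L^2(\Omega)^2$, $\boldsymbol g\in L^2(\Gamma_N)^2$, $\mu,\lambda>0$, $p>1$, $0<\underline\rho<1$, $\beta>0$, and let $V^0$ satisfy $\underline\rho\,|\Omega|\le V^0\le|\Omega|$. Put $$\varepsilon(\boldsymbol u)=\tfrac12(\nabla\boldsymbol u+(\nabla\boldsymbol u)^{\rm T}),\qquad \mathcal C_0\varepsilon=2\mu\,\varepsilon+\lambda\,\mathrm{tr}(\varepsilon)\,I,\qquad W(s)=\tfrac14(s-\underline\rho)^2(s-1)^2,$$ $$c_W=\int_{\underline\rho}^1\sqrt{2W(s)}\,ds,\qquad \widetilde\beta=\beta/c_W,\qquad \boldsymbol V^D=\{\boldsymbol v\in H^1(\Omega)^2:\ \boldsymbol v|_{\Gamma_D}=\boldsymbol 0\},$$ where boundary values are understood in the sense of traces and "$:$" is the Frobenius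 product, and $$\widetilde{\mathcal A}=\Big\{\rho\in H^1(\Omega):\ \rho\in[\underline\rho,1]\text{ a.e. in }\Omega,\ \int_\Omega\rho\,dx=V^0\Big\}.$$ For every $\rho\in\widetilde{\mathcal A}$ there is a unique $\boldsymbol u=\boldsymbol u(\rho)\in\boldsymbol V^D$ (up to equality a.e.) such that $$\int_\Omega\rho^p\,\mathcal C_0\varepsilon(\boldsymbol u):\varepsilon(\boldsymbol v)\,dx=\int_\Omega\boldsymbol f\cdot\boldsymbol v\,dx+\int_{\Gamma_N}\boldsymbol g\cdot\boldsymbol v\,ds\qquad\text{for all }\boldsymbol v\in\boldsymbol V^D,$$ and, for each fixed $\gamma>0$, the functional $$\mathcal J_\gamma(\rho)=\int_\Omega\rho^p\,\mathcal C_0\varepsilon(\boldsymbol u(\rho)):\varepsilon(\boldsymbol u(\rho))\,dx+\widetilde\beta\Big(\frac\gamma2\|\nabla\rho\|_{L^2(\Omega)}^2+\frac1\gamma\int_\Omega W(\rho)\,dx\Big)$$ has at least one minimizer over $\widetilde{\mathcal A}$. -/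

import Mathlib

open MeasureTheory Filter Topology

namespace MinCompliance

noncomputable section

/-- The Euclidean plane. -/
abbrev Plane : Type := EuclideanSpace ℝ (Fin 2)

/-! ### Domains -/

/-- `Ω` has a Lipschitz boundary: near each boundary point, in suitable Cartesian coordinates,
`Ω` is the set of points lying strictly above the graph of a Lipschitz function. -/
def HasLipschitzBoundary (Ω : Set Plane) : Prop :=
  ∀ x₀ ∈ frontier Ω, ∃ (e : Plane ≃ₗᵢ[ℝ] Plane) (ψ : ℝ → ℝ) (K : NNReal) (r : ℝ),
    LipschitzWith K ψ ∧ 0 < r ∧ ∀ y ∈ Metric.ball x₀ r, (y ∈ Ω ↔ ψ (e y 0) < e y 1)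

/-- A bounded Lipschitz domain of the plane. -/
structure IsBoundedLipschitzDomain (Ω : Set Plane) : Prop where
  isOpen : IsOpen Ω
  isConnected : IsConnected Ω
  isBounded : Bornology.IsBounded Ω
  lipschitz : HasLipschitzBoundary Ω

/-- The boundary of `Ω` consists of two disjoint relatively open sets `ΓD`, `ΓN`
with `∂Ω = closure ΓD ∪ closure ΓN`. -/
structure IsBoundarySplitting (Ω ΓD ΓN : Set Plane) : Prop where
  relOpenD : ∃ U : Set Plane, IsOpen U ∧ ΓD = frontier Ω ∩ U
  relOpenN : ∃ U : Set Plane, IsOpen U ∧ ΓN = frontier Ω ∩ U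
  disjoint : Disjoint ΓD ΓN
  cover : frontier Ω = closure ΓD ∪ closure ΓN

/-- Lebesgue measure on `Ω`. -/
abbrev areaOn (Ω : Set Plane) : Measure Plane := volume.restrict Ω

/-- Arc length (one-dimensional Hausdorff measure) on `Γ`. -/
abbrev lengthOn (Γ : Set Plane) : Measure Plane := (Measure.hausdorffMeasure 1).restrict Γ

/-! ### The Sobolev space `H¹(Ω)` -/

/-- The classical partial derivative `∂φ/∂xᵢ` at `x`. -/
def partialDeriv (i : Fin 2) (φ : Plane → ℝ) (x : Plane) : ℝ :=
  fderiv ℝ φ x (EuclideanSpace.single i 1)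

/-- `w` is a weak `i`-th partial derivative of `v` in `Ω`
(used for `v, w` square integrable on `Ω`). -/
def IsWeakPartial (Ω : Set Plane) (i : Fin 2) (v w : Plane → ℝ) : Prop :=
  ∀ φ : Plane → ℝ, ContDiff ℝ ((⊤ : ℕ∞) : WithTop ℕ∞) φ → HasCompactSupport φ →
    tsupport φ ⊆ Ω →
    ∫ x in Ω, v x * partialDeriv i φ x = - ∫ x in Ω, w x * φ x

/-- `v ∈ H¹(Ω)`: `v` and its weak first partial derivatives are in `L²(Ω)`. -/
def MemH1 (Ω : Set Plane) (v : Plane → ℝ) : Prop :=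
  MemLp v 2 (areaOn Ω) ∧ ∀ i : Fin 2, ∃ w, MemLp w 2 (areaOn Ω) ∧ IsWeakPartial Ω i v w

open Classical in
/-- The weak `i`-th partial derivative of `v` in `L²(Ω)` (unique almost everywhere in an open
`Ω`; the value `0` is used where there is none). -/
def weakPartial (Ω : Set Plane) (i : Fin 2) (v : Plane → ℝ) : Plane → ℝ :=
  if h : ∃ w, MemLp w 2 (areaOn Ω) ∧ IsWeakPartial Ω i v w then h.choose else 0

/-- `v ∈ H¹(Ω)` has boundary trace `τ ∈ L²(∂Ω)`: some sequence of functions smooth up to the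
boundary converges to `v` in `H¹(Ω)` while its boundary values converge to `τ` in `L²(∂Ω)`. -/
def HasTrace (Ω : Set Plane) (v τ : Plane → ℝ) : Prop :=
  MemH1 Ω v ∧ MemLp τ 2 (lengthOn (frontier Ω)) ∧
  ∃ φ : ℕ → Plane → ℝ, (∀ n, ContDiff ℝ ((⊤ : ℕ∞) : WithTop ℕ∞) (φ n)) ∧
    Tendsto (fun n => eLpNorm (fun x => φ n x - v x) 2 (areaOn Ω)) atTop (𝓝 0) ∧
    (∀ i, Tendsto (fun n =>
      eLpNorm (fun x => partialDeriv i (φ n) x - weakPartial Ω i v x) 2 (areaOn Ω))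
      atTop (𝓝 0)) ∧
    Tendsto (fun n => eLpNorm (fun x => φ n x - τ x) 2 (lengthOn (frontier Ω))) atTop (𝓝 0)

/-- `v ∈ V^D = {v ∈ H¹(Ω)² : v = 0 on ΓD}`, and `T` is the boundary trace of `v`. -/
def MemVDWithTrace (Ω ΓD : Set Plane) (v T : Plane → Plane) : Prop :=
  (∀ i, HasTrace Ω (fun x => v x i) (fun x => T x i)) ∧ ∀ᵐ x ∂(lengthOn ΓD), T x = 0

/-- `v ∈ V^D`. -/
def MemVD (Ω ΓD : Set Plane) (v : Plane → Plane) : Prop :=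
  ∃ T, MemVDWithTrace Ω ΓD v T

/-! ### Linear elasticity with the SIMP law -/

/-- The weak Jacobian `(∇u)ᵢⱼ = ∂uᵢ/∂xⱼ`. -/
def weakJacobian (Ω : Set Plane) (u : Plane → Plane) (x : Plane) : Matrix (Fin 2) (Fin 2) ℝ :=
  Matrix.of fun i j => weakPartial Ω j (fun y => u y i) x

/-- The strain `ε(u) = (∇u + (∇u)ᵀ) / 2`. -/
def strain (Ω : Set Plane) (u : Plane → Plane) (x : Plane) : Matrix (Fin 2) (Fin 2) ℝ :=
  (1 / 2 : ℝ) • (weakJacobian Ω u x + (weakJacobian Ω u x).transpose)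

/-- The isotropic elastic tensor `C₀ ε = 2 μ ε + λ tr(ε) I`. -/
def elasticTensor (mu lam : ℝ) (ε : Matrix (Fin 2) (Fin 2) ℝ) : Matrix (Fin 2) (Fin 2) ℝ :=
  (2 * mu) • ε + (lam * ε.trace) • (1 : Matrix (Fin 2) (Fin 2) ℝ)

/-- The Frobenius product `A : B`. -/
def frobenius (A B : Matrix (Fin 2) (Fin 2) ℝ) : ℝ := ∑ i, ∑ j, A i j * B i j

/-- `∫_Ω ρ^p C₀ ε(u) : ε(v) dx`. -/
def elasticForm (Ω : Set Plane) (mu lam p : ℝ) (ρ : Plane → ℝ) (u v : Plane → Plane) : ℝ :=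
  ∫ x in Ω, (ρ x) ^ p * frobenius (elasticTensor mu lam (strain Ω u x)) (strain Ω v x)

/-- `u ∈ V^D` solves the state equation with density `ρ`, body force `f` and traction `g`:
`∫_Ω ρ^p C₀ ε(u) : ε(v) dx = ∫_Ω f · v dx + ∫_{ΓN} g · v ds` for all `v ∈ V^D`. -/
def IsState (Ω ΓD ΓN : Set Plane) (f g : Plane → Plane) (mu lam p : ℝ)
    (ρ : Plane → ℝ) (u : Plane → Plane) : Prop :=
  MemVD Ω ΓD u ∧ ∀ v T, MemVDWithTrace Ω ΓD v T →
    elasticForm Ω mu lam p ρ u v =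
      (∫ x in Ω, inner ℝ (f x) (v x)) + ∫ x, inner ℝ (g x) (T x) ∂(lengthOn ΓN)

/-! ### The phase-field problem -/

/-- The double-well potential `W(s) = (s - ρ_min)² (s - 1)² / 4`. -/
def doubleWell (rhoMin s : ℝ) : ℝ := (1 / 4) * (s - rhoMin) ^ 2 * (s - 1) ^ 2

/-- `c_W = ∫_{ρ_min}^1 √(2 W(s)) ds`. -/
def wellConstant (rhoMin : ℝ) : ℝ := ∫ s in rhoMin..1, √(2 * doubleWell rhoMin s)

/-- The Modica-Mortola functional
`F_γ(ρ) = γ/2 ‖∇ρ‖²_{L²(Ω)} + 1/γ ∫_Ω W(ρ) dx` of a density `ρ ∈ H¹(Ω)`. -/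
def modicaMortola (Ω : Set Plane) (rhoMin γ : ℝ) (ρ : Plane → ℝ) : ℝ :=
  γ / 2 * (∫ x in Ω, ∑ i, (weakPartial Ω i ρ x) ^ 2)
    + 1 / γ * ∫ x in Ω, doubleWell rhoMin (ρ x)

/-- The relaxed admissible set
`{ρ ∈ H¹(Ω) : ρ ∈ [ρ_min, 1] a.e. in Ω, ∫_Ω ρ dx = V₀}`. -/
def admissible (Ω : Set Plane) (rhoMin V₀ : ℝ) : Set (Plane → ℝ) :=
  {ρ | MemH1 Ω ρ ∧ (∀ᵐ x ∂(areaOn Ω), ρ x ∈ Set.Icc rhoMin 1) ∧ ∫ x in Ω, ρ x = V₀}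

/-- The objective `∫_Ω ρ^p C₀ ε(u) : ε(u) dx + (β / c_W) F_γ(ρ)`. -/
def objective (Ω : Set Plane) (mu lam p rhoMin β γ : ℝ)
    (ρ : Plane → ℝ) (u : Plane → Plane) : ℝ :=
  elasticForm Ω mu lam p ρ u u + β / wellConstant rhoMin * modicaMortola Ω rhoMin γ ρ

end

end MinCompliance

open scoped NNReal ENNReal

namespace MinCompliance

noncomputable section

/-! ### Local Korn inequalities for smooth fields: square, whole plane, balls of any radius. -/

section

/-! ### An elementary Korn–Poincaré inequality on the unit square -/

/-! The state equation is a coercive variational problem, so existence and uniqueness follow from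
Lax–Milgram once Korn's inequality, with boundary values on `ΓD` on the right-hand side, is known on
a Lipschitz domain. The minimizer comes from the direct method.

Korn's inequality is proved for smooth fields. On the unit square, integrating the shear over
rectangles controls a field modulo a rigid motion (`square_korn_poincare`). In the whole plane, the
determinant of the gradient of a compactly supported field has integral zero, which bounds the
gradient by the strain (`korn_plane`). A cutoff and a scaling combine the two into `korn_ball`. Near
the boundary, a component `g` of the gradient is compared with its composition with a vertical
stretch by a factor `κ > 1`. Their difference is controlled by the strain, through ball estimates
averaged over balls of radius proportional to the height above the graph. The stretched function
costs only `κ^(-1/2) < 1` times the norm of `g`, up to an interior term, and is absorbed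
(`eLpNorm_layer_le`). Connectedness and compactness spread the bound over `Ω`
(`IsBoundedLipschitzDomain.controlled`). The remaining rigid motion is determined by its values on
`ΓD`, because `ΓD` has positive length and points have none (`IsBoundedLipschitzDomain.korn`).

The space `V^D` is realised as a closed subspace of a Hilbert space of jets, which record values,
first derivatives and boundary values as independent components. A trace defined by smooth
approximation is then a closure in this space, and inequalities for smooth fields pass to the limit
by continuity (`korn_jets`).

Along a minimizing sequence the gradients of the densities are bounded. Translation estimates and
ball averages upgrade weak to strong convergence (`tendsto_norm_of_tendsto_inner`), hence to
convergence almost everywhere along a subsequence. The compliance of `ρ` is the maximum over `V` of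
`2 F(V) - a_ρ(V, V)`. Inserting the fixed state of the limit density gives a lower bound which
depends on `ρ` only through `ρ ^ p` and converges, by dominated convergence, to the compliance of
the limit (`IsState.two_mul_sub_le`). No convergence of the states is needed. The gradient term is
weakly lower semicontinuous and the double well term is continuous (`objective_le_of_tendsto`). -/

theorem abs_intervalIntegral_le_integral_unit {f : ℝ → ℝ} (hf : Continuous f) {x y : ℝ}
    (hx : x ∈ Set.Icc (0 : ℝ) 1) (hy : y ∈ Set.Icc (0 : ℝ) 1) :
    |∫ s in x..y, f s| ≤ ∫ s in (0 : ℝ)..1, |f s| := by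
  have h1 := intervalIntegral.norm_integral_le_abs_integral_norm (f := f) (a := x) (b := y)
    (μ := volume)
  simp only [Real.norm_eq_abs] at h1
  refine h1.trans ?_
  have h2 : |(∫ s in x..y, |f s|)| ≤ |(∫ s in (0 : ℝ)..1, |f s|)| := by
    apply intervalIntegral.abs_integral_mono_interval
    · rw [Set.uIoc_of_le zero_le_one]
      intro s hs
      rw [Set.uIoc, Set.mem_Ioc] at hs
      exact ⟨lt_of_le_of_lt (le_min hx.1 hy.1) hs.1, hs.2.trans (max_le hx.2 hy.2)⟩
    · exact Eventually.of_forall fun s => abs_nonneg _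
    · exact hf.abs.intervalIntegrable _ _
  rwa [abs_of_nonneg (intervalIntegral.integral_nonneg zero_le_one fun s _ => abs_nonneg _)] at h2

theorem intervalIntegral_comm {F : ℝ → ℝ → ℝ} (hF : Continuous (Function.uncurry F))
    (a b c d : ℝ) :
    ∫ s in a..b, ∫ t in c..d, F s t = ∫ t in c..d, ∫ s in a..b, F s t := by
  simp_rw [intervalIntegral.intervalIntegral_eq_integral_uIoc, integral_smul]
  rw [smul_comm, integral_integral_swap]
  rw [Measure.prod_restrict, ← Measure.volume_eq_prod]
  apply (hF.continuousOn.integrableOn_compact (K := Set.uIcc a b ×ˢ Set.uIcc c d)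
    (isCompact_uIcc.prod isCompact_uIcc)).mono_set
  exact Set.prod_mono Set.uIoc_subset_uIcc Set.uIoc_subset_uIcc

/-- The minimum over a window of length `1/3` is at most the mean over that window. It is used to
choose good slices near the two ends of `[0, 1]`, which are then at least `1/3` apart. -/
theorem exists_le_three_mul_integral {B : ℝ → ℝ} (hB : Continuous B) (h0 : ∀ s, 0 ≤ B s)
    {a : ℝ} (ha : 0 ≤ a) (ha' : a ≤ 2 / 3) :
    ∃ x ∈ Set.Icc a (a + 1 / 3), B x ≤ 3 * ∫ s in (0 : ℝ)..1, B s := by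
  by_contra! hcon
  have h1 : ∫ s in a..(a + 1 / 3), B s ≤ ∫ s in (0 : ℝ)..1, B s :=
    intervalIntegral.integral_mono_interval ha (by linarith) (by linarith)
      (Eventually.of_forall h0) (hB.intervalIntegrable _ _)
  obtain ⟨x, hx, hmin⟩ := isCompact_Icc.exists_isMinOn (s := Set.Icc a (a + 1 / 3))
    ⟨a, by constructor <;> linarith⟩ hB.continuousOn
  have h2 : ∫ _ in a..(a + 1 / 3), B x ≤ ∫ s in a..(a + 1 / 3), B s :=
    intervalIntegral.integral_mono_on (by linarith) intervalIntegrable_const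
      (hB.intervalIntegrable _ _) fun s hs => hmin hs
  rw [intervalIntegral.integral_const, smul_eq_mul] at h2
  have := hcon x hx
  linarith

/-- The integrals of `|U1|` along rows and of `|V2|` along columns make `U` nearly independent of
`s` and `V` nearly independent of `t`. The integral of the shear `U2 + V1` over rectangles then
forces `U` to be nearly affine in `t` and `V` nearly affine in `s`, with opposite slopes. That is a
rigid motion. The constant 84 only has to dominate the numerical factors that accumulate. -/
theorem square_korn_poincare {U V U1 U2 V1 V2 : ℝ → ℝ → ℝ}
    (hU1 : ∀ s t, HasDerivAt (fun s => U s t) (U1 s t) s)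
    (hU2 : ∀ s t, HasDerivAt (fun t => U s t) (U2 s t) t)
    (hV1 : ∀ s t, HasDerivAt (fun s => V s t) (V1 s t) s)
    (hV2 : ∀ s t, HasDerivAt (fun t => V s t) (V2 s t) t)
    (cU1 : Continuous (Function.uncurry U1)) (cU2 : Continuous (Function.uncurry U2))
    (cV1 : Continuous (Function.uncurry V1)) (cV2 : Continuous (Function.uncurry V2)) :
    ∃ a1 a2 b : ℝ, ∀ s ∈ Set.Icc (0 : ℝ) 1, ∀ t ∈ Set.Icc (0 : ℝ) 1,
      |U s t - (a1 + b * t)| ≤ 84 * ((∫ s in (0 : ℝ)..1, ∫ t in (0 : ℝ)..1, |U2 s t + V1 s t|)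
        + (∫ t in (0 : ℝ)..1, ∫ s in (0 : ℝ)..1, |U1 s t|)
        + (∫ s in (0 : ℝ)..1, ∫ t in (0 : ℝ)..1, |V2 s t|)) + 3 * ∫ s in (0 : ℝ)..1, |U1 s t| ∧
      |V s t - (a2 - b * s)| ≤ 84 * ((∫ s in (0 : ℝ)..1, ∫ t in (0 : ℝ)..1, |U2 s t + V1 s t|)
        + (∫ t in (0 : ℝ)..1, ∫ s in (0 : ℝ)..1, |U1 s t|)
        + (∫ s in (0 : ℝ)..1, ∫ t in (0 : ℝ)..1, |V2 s t|)) + 3 * ∫ t in (0 : ℝ)..1, |V2 s t| := by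
  have sec1 : ∀ {F : ℝ → ℝ → ℝ}, Continuous (Function.uncurry F) → ∀ t, Continuous fun s => F s t :=
    fun hF t => hF.comp (Continuous.prodMk continuous_id continuous_const)
  have sec2 : ∀ {F : ℝ → ℝ → ℝ}, Continuous (Function.uncurry F) → ∀ s, Continuous fun t => F s t :=
    fun hF s => hF.comp (Continuous.prodMk continuous_const continuous_id)
  set A : ℝ → ℝ := fun t => ∫ s in (0 : ℝ)..1, |U1 s t| with hA
  set B : ℝ → ℝ := fun s => ∫ t in (0 : ℝ)..1, |V2 s t| with hB
  set G : ℝ := ∫ s in (0 : ℝ)..1, ∫ t in (0 : ℝ)..1, |U2 s t + V1 s t| with hG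
  set SA : ℝ := ∫ t in (0 : ℝ)..1, A t with hSA
  set SB : ℝ := ∫ s in (0 : ℝ)..1, B s with hSB
  have cA : Continuous A := by
    refine intervalIntegral.continuous_parametric_intervalIntegral_of_continuous'
      (f := fun t s => |U1 s t|) ?_ 0 1
    exact (cU1.comp continuous_swap).abs
  have cB : Continuous B := by
    refine intervalIntegral.continuous_parametric_intervalIntegral_of_continuous'
      (f := fun s t => |V2 s t|) ?_ 0 1
    exact cV2.abs
  have A0 : ∀ t, 0 ≤ A t := fun t =>
    intervalIntegral.integral_nonneg zero_le_one fun s _ => abs_nonneg _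
  have B0 : ∀ t, 0 ≤ B t := fun t =>
    intervalIntegral.integral_nonneg zero_le_one fun s _ => abs_nonneg _
  have G0 : 0 ≤ G := intervalIntegral.integral_nonneg zero_le_one fun s _ =>
    intervalIntegral.integral_nonneg zero_le_one fun s _ => abs_nonneg _
  have SA0 : 0 ≤ SA := intervalIntegral.integral_nonneg zero_le_one fun s _ => A0 s
  have SB0 : 0 ≤ SB := intervalIntegral.integral_nonneg zero_le_one fun s _ => B0 s
  have cU : ∀ t, Continuous fun s => U s t := fun t =>
    continuous_iff_continuousAt.2 fun s => (hU1 s t).continuousAt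
  have cV : ∀ s, Continuous fun t => V s t := fun s =>
    continuous_iff_continuousAt.2 fun t => (hV2 s t).continuousAt
  have dU : ∀ t, ∀ s ∈ Set.Icc (0 : ℝ) 1, ∀ s' ∈ Set.Icc (0 : ℝ) 1, |U s' t - U s t| ≤ A t := by
    intro t s hs s' hs'
    rw [← intervalIntegral.integral_eq_sub_of_hasDerivAt (fun x _ => hU1 x t)
      ((sec1 cU1 t).intervalIntegrable _ _)]
    exact abs_intervalIntegral_le_integral_unit (sec1 cU1 t) hs hs'
  have dV : ∀ s, ∀ t ∈ Set.Icc (0 : ℝ) 1, ∀ t' ∈ Set.Icc (0 : ℝ) 1, |V s t' - V s t| ≤ B s := by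
    intro s t ht t' ht'
    rw [← intervalIntegral.integral_eq_sub_of_hasDerivAt (fun x _ => hV2 s x)
      ((sec2 cV2 s).intervalIntegrable _ _)]
    exact abs_intervalIntegral_le_integral_unit (sec2 cV2 s) ht ht'
  have cW : Continuous (Function.uncurry fun s t => U2 s t + V1 s t) := cU2.add cV1
  -- By Fubini, the sum on the left is the integral of the shear over the rectangle with opposite
  -- corners `(x, y)` and `(x', y')`.
  have key : ∀ x ∈ Set.Icc (0 : ℝ) 1, ∀ x' ∈ Set.Icc (0 : ℝ) 1, ∀ y ∈ Set.Icc (0 : ℝ) 1,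
      ∀ y' ∈ Set.Icc (0 : ℝ) 1,
      |(∫ s in x..x', (U s y' - U s y)) + ∫ t in y..y', (V x' t - V x t)| ≤ G := by
    intro x hx x' hx' y hy y' hy'
    have e1 : ∀ s, U s y' - U s y = ∫ t in y..y', U2 s t := fun s =>
      (intervalIntegral.integral_eq_sub_of_hasDerivAt (fun t _ => hU2 s t)
      ((sec2 cU2 s).intervalIntegrable _ _)).symm
    have e2 : ∀ t, V x' t - V x t = ∫ s in x..x', V1 s t := fun t =>
      (intervalIntegral.integral_eq_sub_of_hasDerivAt (fun s _ => hV1 s t)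
      ((sec1 cV1 t).intervalIntegrable _ _)).symm
    simp_rw [e1, e2]
    rw [← intervalIntegral_comm cV1, ← intervalIntegral.integral_add]
    rotate_left
    · exact (intervalIntegral.continuous_parametric_intervalIntegral_of_continuous'
        cU2 y y').intervalIntegrable _ _
    · exact (intervalIntegral.continuous_parametric_intervalIntegral_of_continuous'
        cV1 y y').intervalIntegrable _ _
    have e3 : ∀ s, (∫ t in y..y', U2 s t) + (∫ t in y..y', V1 s t) =
        ∫ t in y..y', (U2 s t + V1 s t) := fun s =>
      (intervalIntegral.integral_add ((sec2 cU2 s).intervalIntegrable _ _)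
        ((sec2 cV1 s).intervalIntegrable _ _)).symm
    simp_rw [e3]
    refine (abs_intervalIntegral_le_integral_unit
      (intervalIntegral.continuous_parametric_intervalIntegral_of_continuous' cW y y')
      hx hx').trans ?_
    refine intervalIntegral.integral_mono_on zero_le_one ?_ ?_ fun s _ => ?_
    · exact (intervalIntegral.continuous_parametric_intervalIntegral_of_continuous'
        cW y y').abs.intervalIntegrable _ _
    · exact (intervalIntegral.continuous_parametric_intervalIntegral_of_continuous'
        (f := fun s t => |U2 s t + V1 s t|) cW.abs 0 1).intervalIntegrable _ _
    · exact abs_intervalIntegral_le_integral_unit (sec2 cW s) hy hy'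
  -- Each integrand of `key` is frozen at one abscissa `x0` or one ordinate `y0`. The price is the
  -- oscillation of `U` on two rows and of `V` on two columns.
  have D : ∀ x ∈ Set.Icc (0 : ℝ) 1, ∀ x' ∈ Set.Icc (0 : ℝ) 1, ∀ y ∈ Set.Icc (0 : ℝ) 1,
      ∀ y' ∈ Set.Icc (0 : ℝ) 1, ∀ x0 ∈ Set.Icc (0 : ℝ) 1, ∀ y0 ∈ Set.Icc (0 : ℝ) 1,
      |(x' - x) * (U x0 y' - U x0 y) + (y' - y) * (V x' y0 - V x y0)|
        ≤ G + B x + B x' + A y + A y' := by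
    intro x hx x' hx' y hy y' hy' x0 hx0 y0 hy0
    have k := key x hx x' hx' y hy y' hy'
    have n1 : |(∫ s in x..x', (U s y' - U s y)) - (x' - x) * (U x0 y' - U x0 y)|
        ≤ A y + A y' := by
      have e : (∫ s in x..x', (U s y' - U s y)) - (x' - x) * (U x0 y' - U x0 y) =
          ∫ s in x..x', (U s y' - U s y - (U x0 y' - U x0 y)) := by
        rw [intervalIntegral.integral_sub (Continuous.intervalIntegrable (by fun_prop) _ _)
          intervalIntegrable_const, intervalIntegral.integral_const, smul_eq_mul]
      rw [e, ← Real.norm_eq_abs]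
      refine (intervalIntegral.norm_integral_le_of_norm_le_const (C := A y + A y')
        fun s hs => ?_).trans ?_
      · have hs' : s ∈ Set.Icc (0 : ℝ) 1 := by
          have := Set.uIoc_subset_uIcc hs
          exact Set.uIcc_subset_Icc hx hx' this
        have h1 := abs_le.1 (dU y x0 hx0 s hs')
        have h2 := abs_le.1 (dU y' x0 hx0 s hs')
        rw [Real.norm_eq_abs, abs_le]
        constructor <;> linarith
      · have : |x' - x| ≤ 1 := abs_le.2 ⟨by linarith [hx.2, hx'.1], by linarith [hx.1, hx'.2]⟩
        exact mul_le_of_le_one_right (add_nonneg (A0 _) (A0 _)) this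
    have n2 : |(∫ t in y..y', (V x' t - V x t)) - (y' - y) * (V x' y0 - V x y0)|
        ≤ B x + B x' := by
      have e : (∫ t in y..y', (V x' t - V x t)) - (y' - y) * (V x' y0 - V x y0) =
          ∫ t in y..y', (V x' t - V x t - (V x' y0 - V x y0)) := by
        rw [intervalIntegral.integral_sub (Continuous.intervalIntegrable (by fun_prop) _ _)
          intervalIntegrable_const, intervalIntegral.integral_const, smul_eq_mul]
      rw [e, ← Real.norm_eq_abs]
      refine (intervalIntegral.norm_integral_le_of_norm_le_const (C := B x + B x')
        fun s hs => ?_).trans ?_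
      · have hs' : s ∈ Set.Icc (0 : ℝ) 1 := by
          have := Set.uIoc_subset_uIcc hs
          exact Set.uIcc_subset_Icc hy hy' this
        have h1 := abs_le.1 (dV x y0 hy0 s hs')
        have h2 := abs_le.1 (dV x' y0 hy0 s hs')
        rw [Real.norm_eq_abs, abs_le]
        constructor <;> linarith
      · have : |y' - y| ≤ 1 := abs_le.2 ⟨by linarith [hy.2, hy'.1], by linarith [hy.1, hy'.2]⟩
        exact mul_le_of_le_one_right (add_nonneg (B0 _) (B0 _)) this
    rw [abs_le] at *
    constructor <;> linarith
  obtain ⟨x1, hx1, bx1⟩ := exists_le_three_mul_integral cB B0 (a := 0) le_rfl (by norm_num)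
  obtain ⟨x2, hx2, bx2⟩ := exists_le_three_mul_integral cB B0 (a := 2 / 3) (by norm_num) le_rfl
  obtain ⟨y1, hy1, ay1⟩ := exists_le_three_mul_integral cA A0 (a := 0) le_rfl (by norm_num)
  obtain ⟨y2, hy2, ay2⟩ := exists_le_three_mul_integral cA A0 (a := 2 / 3) (by norm_num) le_rfl
  rw [Set.mem_Icc] at hx1 hx2 hy1 hy2
  have hx1' : x1 ∈ Set.Icc (0 : ℝ) 1 := ⟨by linarith, by linarith⟩
  have hx2' : x2 ∈ Set.Icc (0 : ℝ) 1 := ⟨by linarith, by linarith⟩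
  have hy1' : y1 ∈ Set.Icc (0 : ℝ) 1 := ⟨by linarith, by linarith⟩
  have hy2' : y2 ∈ Set.Icc (0 : ℝ) 1 := ⟨by linarith, by linarith⟩
  have z0 : (0 : ℝ) ∈ Set.Icc (0 : ℝ) 1 := ⟨le_rfl, zero_le_one⟩
  -- The rotation `b` is read off from `V` on the two good columns.
  obtain ⟨b, hb⟩ : ∃ b : ℝ, V x2 0 - V x1 0 = -((x2 - x1) * b) :=
    ⟨-(V x2 0 - V x1 0) / (x2 - x1), by
      have : x2 - x1 ≠ 0 := by linarith
      field_simp⟩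
  have div3 : ∀ {m X Y : ℝ}, 1 / 3 ≤ m → |m * X| ≤ Y → |X| ≤ 3 * Y := by
    intro m X Y hm h
    rw [abs_mul, abs_of_nonneg (by linarith : 0 ≤ m)] at h
    nlinarith [abs_nonneg X]
  have hU : ∀ s ∈ Set.Icc (0 : ℝ) 1, ∀ t ∈ Set.Icc (0 : ℝ) 1,
      |U s t - U s y1 - (t - y1) * b| ≤ 3 * (G + 3 * SB + 3 * SB + 3 * SA + A t) := by
    intro s hs t ht
    have := D x1 hx1' x2 hx2' y1 hy1' t ht s hs 0 z0
    rw [hb] at this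
    refine div3 (m := x2 - x1) (by linarith) ?_
    have e : (x2 - x1) * (U s t - U s y1 - (t - y1) * b) = (x2 - x1) * (U s t - U s y1) +
      (t - y1) * -((x2 - x1) * b) := by ring
    rw [e]
    linarith
  -- The two good rows play the role of the two good columns in `hU`, and `hU` itself identifies the
  -- increment of `U` between them as `(y2 - y1) * b`, so that the slope of `V` is `-b`.
  have hV : ∀ s ∈ Set.Icc (0 : ℝ) 1, ∀ t ∈ Set.Icc (0 : ℝ) 1,
      |V s t - V x1 t + (s - x1) * b| ≤ 3 * (4 * G + 21 * SB + 27 * SA + B s) := by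
    intro s hs t ht
    have h1 := D x1 hx1' s hs y1 hy1' y2 hy2' 0 z0 t ht
    have h2 := hU 0 z0 y2 hy2'
    have h3 : |(s - x1) * (U 0 y2 - U 0 y1 - (y2 - y1) * b)| ≤
        3 * (G + 3 * SB + 3 * SB + 3 * SA + A y2) := by
      rw [abs_mul]
      have : |s - x1| ≤ 1 := abs_le.2 ⟨by linarith [hs.1, hx1'.2], by linarith [hs.2, hx1'.1]⟩
      nlinarith [abs_nonneg (s - x1), abs_nonneg (U 0 y2 - U 0 y1 - (y2 - y1) * b)]
    refine div3 (m := y2 - y1) (by linarith) ?_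
    rw [abs_le] at *
    constructor <;> nlinarith
  refine ⟨U 0 y1 - y1 * b, V x1 0 + x1 * b, b, fun s hs t ht => ⟨?_, ?_⟩⟩
  · have h1 := abs_le.1 (hU s hs t ht)
    have h2 := abs_le.1 (dU y1 0 z0 s hs)
    have := A0 t
    rw [abs_le]
    constructor <;> linarith
  · have h1 := abs_le.1 (hV s hs t ht)
    have h2 := abs_le.1 (dV x1 0 z0 t ht)
    have := B0 s
    rw [abs_le]
    constructor <;> linarith

end

section

/-! ### Smooth fields and their densities -/

/-- Smooth real functions on the plane. -/
abbrev IsSmooth (f : Plane → ℝ) : Prop := ContDiff ℝ ((⊤ : ℕ∞) : WithTop ℕ∞) f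

/-- The sum of the absolute values of the strain components of a smooth field. -/
def strainDensity (φ : Fin 2 → Plane → ℝ) (x : Plane) : ℝ :=
  ∑ i, ∑ j, |(partialDeriv j (φ i) x + partialDeriv i (φ j) x) / 2|

/-- The sum of the absolute values of the components of a smooth field and of its gradient. -/
def sizeDensity (φ : Fin 2 → Plane → ℝ) (x : Plane) : ℝ :=
  ∑ i, (|φ i x| + ∑ j, |partialDeriv j (φ i) x|)

/-- The infinitesimal rigid motions of the plane. -/
def rigid (a b c : ℝ) : Fin 2 → Plane → ℝ :=
  ![fun x => a + c * x 1, fun x => b - c * x 0]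

theorem IsSmooth.partialDeriv {f : Plane → ℝ} (hf : IsSmooth f) (i : Fin 2) :
    IsSmooth (partialDeriv i f) :=
  (hf.fderiv_right (m := ((⊤ : ℕ∞) : WithTop ℕ∞)) le_rfl).clm_apply contDiff_const

theorem IsSmooth.differentiable {f : Plane → ℝ} (hf : IsSmooth f) : Differentiable ℝ f :=
  ContDiff.differentiable hf (by simp)

theorem continuous_strainDensity {φ : Fin 2 → Plane → ℝ} (hφ : ∀ i, IsSmooth (φ i)) :
    Continuous (strainDensity φ) :=
  continuous_finsetSum _ fun i _ => continuous_finsetSum _ fun j _ =>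
    ((((hφ i).partialDeriv j).continuous.add ((hφ j).partialDeriv i).continuous).div_const 2).abs

theorem continuous_sizeDensity {φ : Fin 2 → Plane → ℝ} (hφ : ∀ i, IsSmooth (φ i)) :
    Continuous (sizeDensity φ) :=
  continuous_finsetSum _ fun i _ => (hφ i).continuous.abs.add <|
    continuous_finsetSum _ fun j _ => ((hφ i).partialDeriv j).continuous.abs

theorem strainDensity_nonneg (φ : Fin 2 → Plane → ℝ) (x : Plane) : 0 ≤ strainDensity φ x :=
  Finset.sum_nonneg fun _ _ => Finset.sum_nonneg fun _ _ => abs_nonneg _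

theorem sizeDensity_nonneg (φ : Fin 2 → Plane → ℝ) (x : Plane) : 0 ≤ sizeDensity φ x :=
  Finset.sum_nonneg fun _ _ => add_nonneg (abs_nonneg _) (Finset.sum_nonneg fun _ _ => abs_nonneg _)

theorem partialDeriv_add {f g : Plane → ℝ} {x : Plane} (hf : DifferentiableAt ℝ f x)
    (hg : DifferentiableAt ℝ g x) (i : Fin 2) :
    partialDeriv i (fun y => f y + g y) x = partialDeriv i f x + partialDeriv i g x := by
  simp [partialDeriv, fderiv_fun_add hf hg]

theorem partialDeriv_sub {f g : Plane → ℝ} {x : Plane} (hf : DifferentiableAt ℝ f x)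
    (hg : DifferentiableAt ℝ g x) (i : Fin 2) :
    partialDeriv i (fun y => f y - g y) x = partialDeriv i f x - partialDeriv i g x := by
  simp [partialDeriv, fderiv_fun_sub hf hg]

theorem partialDeriv_mul {f g : Plane → ℝ} {x : Plane} (hf : DifferentiableAt ℝ f x)
    (hg : DifferentiableAt ℝ g x) (i : Fin 2) :
    partialDeriv i (fun y => f y * g y) x =
      f x * partialDeriv i g x + g x * partialDeriv i f x := by
  simp [partialDeriv, fderiv_fun_mul hf hg]

theorem isSmooth_coord (i : Fin 2) : IsSmooth fun x : Plane => x i :=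
  (EuclideanSpace.proj (𝕜 := ℝ) i).contDiff

theorem partialDeriv_coord (i j : Fin 2) (x : Plane) :
    partialDeriv j (fun y : Plane => y i) x = if i = j then 1 else 0 := by
  have : (fun y : Plane => y i) = EuclideanSpace.proj (𝕜 := ℝ) i := rfl
  rw [partialDeriv, this, ContinuousLinearMap.fderiv]
  simp

theorem isSmooth_rigid (a b c : ℝ) (i : Fin 2) : IsSmooth (rigid a b c i) := by
  fin_cases i
  · exact contDiff_const.add (contDiff_const.mul (isSmooth_coord 1))
  · exact contDiff_const.sub (contDiff_const.mul (isSmooth_coord 0))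

theorem partialDeriv_const_add_mul (a c : ℝ) (i j : Fin 2) (x : Plane) :
    partialDeriv j (fun y : Plane => a + c * y i) x = if i = j then c else 0 := by
  have h : DifferentiableAt ℝ (fun y : Plane => c * y i) x :=
    (differentiableAt_const _).mul (isSmooth_coord i).differentiable.differentiableAt
  rw [partialDeriv_add (differentiableAt_const _) h,
    partialDeriv_mul (differentiableAt_const _) (isSmooth_coord i).differentiable.differentiableAt,
    partialDeriv_coord]
  simp [partialDeriv]

theorem partialDeriv_rigid (a b c : ℝ) (i j : Fin 2) (x : Plane) :
    partialDeriv j (rigid a b c i) x = !![0, c; -c, 0] i j := by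
  have h1 : rigid a b c 1 = fun x => b + -c * x 0 := by ext x; simp [rigid]; ring
  have h0 : rigid a b c 0 = fun x => a + c * x 1 := rfl
  fin_cases i
  · simp only [Fin.zero_eta, h0, partialDeriv_const_add_mul]
    fin_cases j <;> simp
  · simp only [Fin.mk_one, h1, partialDeriv_const_add_mul]
    fin_cases j <;> simp

/-- The gradient of a rigid motion is antisymmetric and disappears in the symmetrised gradient. -/
theorem strainDensity_sub_rigid {φ : Fin 2 → Plane → ℝ} (hφ : ∀ i, IsSmooth (φ i)) (a b c : ℝ) :
    strainDensity (fun i x => φ i x - rigid a b c i x) = strainDensity φ := by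
  funext x
  have h : ∀ i j, partialDeriv j (fun x => φ i x - rigid a b c i x) x =
      partialDeriv j (φ i) x - !![0, c; -c, 0] i j := fun i j => by
    rw [partialDeriv_sub (hφ i).differentiable.differentiableAt
      (isSmooth_rigid a b c i).differentiable.differentiableAt, partialDeriv_rigid]
  simp only [strainDensity, h, Fin.sum_univ_two]
  congr 3 <;> congr 1 <;> simp

theorem sizeDensity_add_le {φ χ : Fin 2 → Plane → ℝ} (hφ : ∀ i, IsSmooth (φ i))
    (hχ : ∀ i, IsSmooth (χ i)) (x : Plane) :
    sizeDensity (fun i x => φ i x + χ i x) x ≤ sizeDensity φ x + sizeDensity χ x := by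
  rw [sizeDensity, sizeDensity, sizeDensity, ← Finset.sum_add_distrib]
  refine Finset.sum_le_sum fun i _ => ?_
  have : ∑ j, |partialDeriv j (fun x => φ i x + χ i x) x| ≤
      ∑ j, |partialDeriv j (φ i) x| + ∑ j, |partialDeriv j (χ i) x| := by
    rw [← Finset.sum_add_distrib]
    refine Finset.sum_le_sum fun j _ => ?_
    rw [partialDeriv_add (hφ i).differentiable.differentiableAt
      (hχ i).differentiable.differentiableAt]
    exact abs_add_le _ _
  have := abs_add_le (φ i x) (χ i x)
  linarith

/-! ### Cartesian coordinates -/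

/-- The point of the plane with given coordinates. -/
def point (p : ℝ × ℝ) : Plane := !₂[p.1, p.2]

@[simp] theorem point_zero (p : ℝ × ℝ) : point p 0 = p.1 := rfl

@[simp] theorem point_one (p : ℝ × ℝ) : point p 1 = p.2 := rfl

/-- Cartesian coordinates as a measurable equivalence. -/
def pointEquiv : ℝ × ℝ ≃ᵐ Plane :=
  MeasurableEquiv.finTwoArrow.symm.trans (MeasurableEquiv.toLp 2 (Fin 2 → ℝ))

theorem pointEquiv_apply (p : ℝ × ℝ) : pointEquiv p = point p := by
  ext i
  fin_cases i <;> rfl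

theorem measurePreserving_pointEquiv : MeasurePreserving pointEquiv volume volume :=
  ((volume_preserving_finTwoArrow ℝ).symm _).trans (PiLp.volume_preserving_toLp (Fin 2))

theorem lintegral_plane (F : Plane → ENNReal) :
    ∫⁻ x, F x = ∫⁻ p : ℝ × ℝ, F (point p) := by
  rw [← measurePreserving_pointEquiv.lintegral_comp_emb pointEquiv.measurableEmbedding]
  simp_rw [pointEquiv_apply]

theorem continuous_point : Continuous point := by
  unfold point
  refine (PiLp.continuous_toLp 2 _).comp ?_
  refine continuous_pi fun i => ?_
  fin_cases i
  · exact continuous_fst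
  · exact continuous_snd

theorem hasDerivAt_point_fst {f : Plane → ℝ} (hf : IsSmooth f) (s t : ℝ) :
    HasDerivAt (fun s => f (point (s, t))) (partialDeriv 0 f (point (s, t))) s := by
  have h1 : HasDerivAt (fun s : ℝ => point (s, t)) (EuclideanSpace.single (0 : Fin 2) (1 : ℝ)) s := by
    have e : (fun s : ℝ => point (s, t)) = fun s : ℝ =>
        s • (EuclideanSpace.single (0 : Fin 2) (1 : ℝ) : Plane) + point (0, t) := by
      funext s; ext i; fin_cases i <;> simp [point]
    rw [e]
    simpa using ((hasDerivAt_id s).smul_const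
      (EuclideanSpace.single (0 : Fin 2) (1 : ℝ) : Plane)).add_const (point (0, t))
  exact (hf.differentiable _).hasFDerivAt.comp_hasDerivAt s h1

theorem hasDerivAt_point_snd {f : Plane → ℝ} (hf : IsSmooth f) (s t : ℝ) :
    HasDerivAt (fun t => f (point (s, t))) (partialDeriv 1 f (point (s, t))) t := by
  have h1 : HasDerivAt (fun t : ℝ => point (s, t)) (EuclideanSpace.single (1 : Fin 2) (1 : ℝ)) t := by
    have e : (fun t : ℝ => point (s, t)) = fun t : ℝ =>
        t • (EuclideanSpace.single (1 : Fin 2) (1 : ℝ) : Plane) + point (s, 0) := by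
      funext s; ext i; fin_cases i <;> simp [point]
    rw [e]
    simpa using ((hasDerivAt_id t).smul_const
      (EuclideanSpace.single (1 : Fin 2) (1 : ℝ) : Plane)).add_const (point (s, 0))
  exact (hf.differentiable _).hasFDerivAt.comp_hasDerivAt t h1

/-- The closed unit square. -/
def unitSquare : Set Plane := {x | ∀ i, x i ∈ Set.Icc (0 : ℝ) 1}

theorem lintegral_unitSquare {F : Plane → ℝ} (hF : Continuous F) :
    ∫⁻ x in unitSquare, ‖F x‖ₑ ^ 2 =
      ENNReal.ofReal (∫ s in (0 : ℝ)..1, ∫ t in (0 : ℝ)..1, F (point (s, t)) ^ 2) := by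
  have hpre : pointEquiv ⁻¹' unitSquare = Set.Icc 0 1 ×ˢ Set.Icc 0 1 := by
    ext ⟨s, t⟩
    simp [unitSquare, pointEquiv_apply, Fin.forall_fin_two]
    tauto
  rw [← measurePreserving_pointEquiv.setLIntegral_comp_preimage_emb
    pointEquiv.measurableEmbedding, hpre]
  simp_rw [pointEquiv_apply]
  have hc : Continuous fun p : ℝ × ℝ => F (point p) ^ 2 := (hF.comp continuous_point).pow 2
  have hint : IntegrableOn (fun p : ℝ × ℝ => F (point p) ^ 2) (Set.Icc 0 1 ×ˢ Set.Icc 0 1) :=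
    hc.continuousOn.integrableOn_compact (isCompact_Icc.prod isCompact_Icc)
  have e1 : ∫ s in (0 : ℝ)..1, ∫ t in (0 : ℝ)..1, F (point (s, t)) ^ 2 =
      ∫ p in Set.Icc (0 : ℝ) 1 ×ˢ Set.Icc (0 : ℝ) 1, F (point p) ^ 2 := by
    rw [Measure.volume_eq_prod, setIntegral_prod _ (by rwa [← Measure.volume_eq_prod]),
      intervalIntegral.integral_of_le zero_le_one, ← integral_Icc_eq_integral_Ioc]
    refine integral_congr_ae (Eventually.of_forall fun s => ?_)
    simp only
    rw [intervalIntegral.integral_of_le zero_le_one, ← integral_Icc_eq_integral_Ioc]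
  rw [e1, ofReal_integral_eq_lintegral_ofReal hint (Eventually.of_forall fun p => sq_nonneg _)]
  refine lintegral_congr fun p => ?_
  rw [Real.enorm_eq_ofReal_abs, ← ENNReal.ofReal_pow (abs_nonneg _), sq_abs]

/-- The variance of `f` is nonnegative. -/
theorem sq_intervalIntegral_le {f : ℝ → ℝ} (hf : Continuous f) :
    (∫ s in (0 : ℝ)..1, f s) ^ 2 ≤ ∫ s in (0 : ℝ)..1, f s ^ 2 := by
  set m := ∫ s in (0 : ℝ)..1, f s
  have h : 0 ≤ ∫ s in (0 : ℝ)..1, (f s - m) ^ 2 :=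
    intervalIntegral.integral_nonneg zero_le_one fun s _ => sq_nonneg _
  have e : ∀ s, (f s - m) ^ 2 = f s ^ 2 - (2 * m) * f s + m ^ 2 := fun s => by ring
  simp_rw [e] at h
  rw [intervalIntegral.integral_add (Continuous.intervalIntegrable (by fun_prop) _ _)
    intervalIntegrable_const, intervalIntegral.integral_sub
    (Continuous.intervalIntegrable (by fun_prop) _ _)
    (Continuous.intervalIntegrable (by fun_prop) _ _), intervalIntegral.integral_const_mul,
    intervalIntegral.integral_const] at h
  simp only [sub_zero, one_smul] at h
  change 0 ≤ _ - 2 * m * m + m ^ 2 at h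
  nlinarith

/-- Passage from the `L¹` form of the estimate on the square to the `L²` form, by Jensen's
inequality on slices and on the square. Here `252 = 3 * 84`, since each of the three double
integrals of `square_korn_poincare` is at most that of the full strain density. -/
theorem integral_sq_le_of_le {F E : ℝ → ℝ → ℝ} (hF : Continuous (Function.uncurry F))
    (hE : Continuous (Function.uncurry E))
    (h : ∀ s ∈ Set.Icc (0 : ℝ) 1, ∀ t ∈ Set.Icc (0 : ℝ) 1,
      |F s t| ≤ 252 * (∫ s in (0 : ℝ)..1, ∫ t in (0 : ℝ)..1, E s t)
        + 3 * ∫ t in (0 : ℝ)..1, E s t) :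
    ∫ s in (0 : ℝ)..1, ∫ t in (0 : ℝ)..1, F s t ^ 2 ≤
      200000 * ∫ s in (0 : ℝ)..1, ∫ t in (0 : ℝ)..1, E s t ^ 2 := by
  have sec2 : ∀ {F : ℝ → ℝ → ℝ}, Continuous (Function.uncurry F) → ∀ s, Continuous fun t => F s t :=
    fun hF s => hF.comp (Continuous.prodMk continuous_const continuous_id)
  have par : ∀ {F : ℝ → ℝ → ℝ}, Continuous (Function.uncurry F) →
      Continuous fun s => ∫ t in (0 : ℝ)..1, F s t := fun hF =>
    intervalIntegral.continuous_parametric_intervalIntegral_of_continuous' hF 0 1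
  set I := ∫ s in (0 : ℝ)..1, ∫ t in (0 : ℝ)..1, E s t with hI
  set J := ∫ s in (0 : ℝ)..1, ∫ t in (0 : ℝ)..1, E s t ^ 2 with hJ
  have hE2 : Continuous (Function.uncurry fun s t => E s t ^ 2) := hE.pow 2
  have hF2 : Continuous (Function.uncurry fun s t => F s t ^ 2) := hF.pow 2
  have hIJ : I ^ 2 ≤ J := by
    refine (sq_intervalIntegral_le (par hE)).trans ?_
    exact intervalIntegral.integral_mono_on zero_le_one
      (Continuous.intervalIntegrable ((par hE).pow 2) _ _)
      (Continuous.intervalIntegrable (par hE2) _ _) fun s _ => sq_intervalIntegral_le (sec2 hE s)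
  -- From `(a + b)² ≤ 2 a² + 2 b²`: `127008 = 2 * 252²` and `18 = 2 * 3²`.
  have hs : ∀ s ∈ Set.Icc (0 : ℝ) 1, ∫ t in (0 : ℝ)..1, F s t ^ 2 ≤
      127008 * I ^ 2 + 18 * ∫ t in (0 : ℝ)..1, E s t ^ 2 := by
    intro s hs
    have h1 : ∀ t ∈ Set.Icc (0 : ℝ) 1,
        F s t ^ 2 ≤ 127008 * I ^ 2 + 18 * (∫ t in (0 : ℝ)..1, E s t) ^ 2 := by
      intro t ht
      have h2 := h s hs t ht
      have h3 := pow_le_pow_left₀ (abs_nonneg _) h2 2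
      rw [sq_abs] at h3
      nlinarith [sq_nonneg (252 * I - 3 * ∫ t in (0 : ℝ)..1, E s t)]
    calc ∫ t in (0 : ℝ)..1, F s t ^ 2
        ≤ ∫ _ in (0 : ℝ)..1, (127008 * I ^ 2 + 18 * (∫ t in (0 : ℝ)..1, E s t) ^ 2) :=
          intervalIntegral.integral_mono_on zero_le_one
            (Continuous.intervalIntegrable (sec2 hF2 s) _ _) intervalIntegrable_const h1
      _ = 127008 * I ^ 2 + 18 * (∫ t in (0 : ℝ)..1, E s t) ^ 2 := by simp
      _ ≤ _ := by linarith [sq_intervalIntegral_le (sec2 hE s)]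
  calc ∫ s in (0 : ℝ)..1, ∫ t in (0 : ℝ)..1, F s t ^ 2
      ≤ ∫ s in (0 : ℝ)..1, (127008 * I ^ 2 + 18 * ∫ t in (0 : ℝ)..1, E s t ^ 2) :=
        intervalIntegral.integral_mono_on zero_le_one
          (Continuous.intervalIntegrable (par hF2) _ _)
          (Continuous.intervalIntegrable (continuous_const.add (continuous_const.mul (par hE2))) _ _)
          hs
    _ = 127008 * I ^ 2 + 18 * J := by
        have hc : Continuous fun s => 18 * ∫ t in (0 : ℝ)..1, E s t ^ 2 :=
          continuous_const.mul (par hE2)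
        rw [intervalIntegral.integral_add intervalIntegrable_const (hc.intervalIntegrable _ _),
          intervalIntegral.integral_const_mul]
        simp [hJ]
    _ ≤ 200000 * J := by nlinarith [sq_nonneg I]

theorem unitSquare_korn_poincare {φ : Fin 2 → Plane → ℝ} (hφ : ∀ i, IsSmooth (φ i)) :
    ∃ a b c : ℝ, ∀ i, ∫⁻ x in unitSquare, ‖φ i x - rigid a b c i x‖ₑ ^ 2 ≤
      ENNReal.ofReal 200000 * ∫⁻ x in unitSquare, ‖strainDensity φ x‖ₑ ^ 2 := by
  have hcont : ∀ {f : Plane → ℝ}, Continuous f →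
      Continuous (Function.uncurry fun s t => f (point (s, t))) := fun hf =>
    hf.comp continuous_point
  have sec1 : ∀ {F : ℝ → ℝ → ℝ}, Continuous (Function.uncurry F) → ∀ t, Continuous fun s => F s t :=
    fun hF t => hF.comp (Continuous.prodMk continuous_id continuous_const)
  have sec2 : ∀ {F : ℝ → ℝ → ℝ}, Continuous (Function.uncurry F) → ∀ s, Continuous fun t => F s t :=
    fun hF s => hF.comp (Continuous.prodMk continuous_const continuous_id)
  have par : ∀ {F : ℝ → ℝ → ℝ}, Continuous (Function.uncurry F) →
      Continuous fun s => ∫ t in (0 : ℝ)..1, F s t := fun hF =>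
    intervalIntegral.continuous_parametric_intervalIntegral_of_continuous' hF 0 1
  have hd := fun i j => hcont ((hφ i).partialDeriv j).continuous
  obtain ⟨a, b, c, h⟩ := square_korn_poincare (fun s t => hasDerivAt_point_fst (hφ 0) s t)
    (fun s t => hasDerivAt_point_snd (hφ 0) s t) (fun s t => hasDerivAt_point_fst (hφ 1) s t)
    (fun s t => hasDerivAt_point_snd (hφ 1) s t) (hd 0 0) (hd 0 1) (hd 1 0) (hd 1 1)
  obtain ⟨E, hE⟩ : ∃ E : ℝ → ℝ → ℝ, E = fun s t => strainDensity φ (point (s, t)) := ⟨_, rfl⟩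
  have cE : Continuous (Function.uncurry E) := hE ▸ hcont (continuous_strainDensity hφ)
  have cE' : Continuous (Function.uncurry fun t s => E s t) := cE.comp continuous_swap
  have eE : ∀ s t, E s t = |partialDeriv 0 (φ 0) (point (s, t))| +
      |partialDeriv 1 (φ 0) (point (s, t)) + partialDeriv 0 (φ 1) (point (s, t))| +
      |partialDeriv 1 (φ 1) (point (s, t))| := by
    intro s t
    simp only [hE, strainDensity, Fin.sum_univ_two, add_self_div_two]
    rw [add_comm (partialDeriv 0 (φ 1) _), abs_div, abs_two]
    ring
  have mono2 : ∀ {F G : ℝ → ℝ → ℝ}, Continuous (Function.uncurry F) →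
      Continuous (Function.uncurry G) → (∀ s t, F s t ≤ G s t) →
      ∫ s in (0 : ℝ)..1, ∫ t in (0 : ℝ)..1, F s t ≤ ∫ s in (0 : ℝ)..1, ∫ t in (0 : ℝ)..1, G s t :=
    fun hF hG hle => intervalIntegral.integral_mono_on zero_le_one
      (Continuous.intervalIntegrable (par hF) _ _) (Continuous.intervalIntegrable (par hG) _ _)
      fun s _ => intervalIntegral.integral_mono_on zero_le_one
        (Continuous.intervalIntegrable (sec2 hF s) _ _)
        (Continuous.intervalIntegrable (sec2 hG s) _ _) fun t _ => hle s t
  have b1 : ∀ s t, |partialDeriv 0 (φ 0) (point (s, t))| ≤ E s t := fun s t => by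
    rw [eE]; linarith [abs_nonneg (partialDeriv 1 (φ 0) (point (s, t)) +
      partialDeriv 0 (φ 1) (point (s, t))), abs_nonneg (partialDeriv 1 (φ 1) (point (s, t)))]
  have b2 : ∀ s t, |partialDeriv 1 (φ 1) (point (s, t))| ≤ E s t := fun s t => by
    rw [eE]; linarith [abs_nonneg (partialDeriv 1 (φ 0) (point (s, t)) +
      partialDeriv 0 (φ 1) (point (s, t))), abs_nonneg (partialDeriv 0 (φ 0) (point (s, t)))]
  have b3 : ∀ s t, |partialDeriv 1 (φ 0) (point (s, t)) + partialDeriv 0 (φ 1) (point (s, t))|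
      ≤ E s t := fun s t => by
    rw [eE]; linarith [abs_nonneg (partialDeriv 1 (φ 1) (point (s, t))),
      abs_nonneg (partialDeriv 0 (φ 0) (point (s, t)))]
  have hcomm := intervalIntegral_comm cE 0 1 0 1
  have g1 : ∫ t in (0 : ℝ)..1, ∫ s in (0 : ℝ)..1, |partialDeriv 0 (φ 0) (point (s, t))| ≤
      ∫ s in (0 : ℝ)..1, ∫ t in (0 : ℝ)..1, E s t := by
    rw [hcomm]
    exact mono2 (F := fun t s => |partialDeriv 0 (φ 0) (point (s, t))|)
      (((hd 0 0).comp continuous_swap).abs) cE' fun t s => b1 s t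
  have g2 := mono2 (F := fun s t => |partialDeriv 1 (φ 1) (point (s, t))|) (hd 1 1).abs cE b2
  have g3 := mono2 (F := fun s t => |partialDeriv 1 (φ 0) (point (s, t)) +
    partialDeriv 0 (φ 1) (point (s, t))|) ((hd 0 1).add (hd 1 0)).abs cE b3
  have conv : ∀ i, (∫ s in (0 : ℝ)..1, ∫ t in (0 : ℝ)..1,
      (φ i (point (s, t)) - rigid a b c i (point (s, t))) ^ 2) ≤
      200000 * ∫ s in (0 : ℝ)..1, ∫ t in (0 : ℝ)..1, E s t ^ 2 →
      ∫⁻ x in unitSquare, ‖φ i x - rigid a b c i x‖ₑ ^ 2 ≤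
      ENNReal.ofReal 200000 * ∫⁻ x in unitSquare, ‖strainDensity φ x‖ₑ ^ 2 := by
    intro i hi
    rw [lintegral_unitSquare (F := fun x => φ i x - rigid a b c i x)
      ((hφ i).continuous.sub (isSmooth_rigid a b c i).continuous),
      lintegral_unitSquare (continuous_strainDensity hφ)]
    rw [← ENNReal.ofReal_mul (by norm_num)]
    rw [hE] at hi
    exact ENNReal.ofReal_le_ofReal hi
  refine ⟨a, b, c, Fin.forall_fin_two.2 ⟨conv 0 ?_, conv 1 ?_⟩⟩
  · have cF := hcont ((hφ 0).continuous.sub (isSmooth_rigid a b c 0).continuous)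
    have cF2 : Continuous (Function.uncurry fun s t =>
      (φ 0 (point (s, t)) - rigid a b c 0 (point (s, t))) ^ 2) := cF.pow 2
    have cE2 : Continuous (Function.uncurry fun s t => E s t ^ 2) := cE.pow 2
    -- The bound on the first component contains an integral over `s` at fixed `t`, so the roles of
    -- the variables are exchanged.
    rw [intervalIntegral_comm cF2, intervalIntegral_comm cE2]
    refine integral_sq_le_of_le (E := fun t s => E s t)
      (F := fun t s => φ 0 (point (s, t)) - rigid a b c 0 (point (s, t)))
      (cF.comp continuous_swap) cE' fun t ht s hs => ?_
    refine (h s hs t ht).1.trans ?_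
    rw [← hcomm]
    have : ∫ s in (0 : ℝ)..1, |partialDeriv 0 (φ 0) (point (s, t))| ≤ ∫ s in (0 : ℝ)..1, E s t :=
      intervalIntegral.integral_mono_on zero_le_one
        (Continuous.intervalIntegrable (sec1 (hd 0 0) t).abs _ _)
        (Continuous.intervalIntegrable (sec1 cE t) _ _) fun s _ => b1 s t
    linarith
  · refine integral_sq_le_of_le (E := E)
      (F := fun s t => φ 1 (point (s, t)) - rigid a b c 1 (point (s, t)))
      (hcont ((hφ 1).continuous.sub (isSmooth_rigid a b c 1).continuous)) cE fun s hs t ht => ?_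
    refine (h s hs t ht).2.trans ?_
    have : ∫ t in (0 : ℝ)..1, |partialDeriv 1 (φ 1) (point (s, t))| ≤ ∫ t in (0 : ℝ)..1, E s t :=
      intervalIntegral.integral_mono_on zero_le_one
        (Continuous.intervalIntegrable (sec2 (hd 1 1) s).abs _ _)
        (Continuous.intervalIntegrable (sec2 cE s) _ _) fun s' _ => b2 s s'
    linarith

end

section

/-! ### Korn's inequality in the whole plane and on balls -/

theorem eLpNorm_two_sq {α E : Type*} [MeasurableSpace α] [NormedAddCommGroup E] (f : α → E)
    (μ : Measure α) : eLpNorm f 2 μ ^ 2 = ∫⁻ x, ‖f x‖ₑ ^ 2 ∂μ := by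
  have := eLpNorm_nnreal_pow_eq_lintegral (μ := μ) (f := f) (p := 2) two_ne_zero
  have e : ((2 : ℝ≥0) : ℝ) = ((2 : ℕ) : ℝ) := by norm_num
  simp only [e, ENNReal.rpow_natCast, ENNReal.coe_ofNat] at this
  exact this

theorem sq_le_sq_iff_ennreal {a b : ℝ≥0∞} : a ^ 2 ≤ b ^ 2 ↔ a ≤ b :=
  (ENNReal.pow_right_strictMono two_ne_zero).le_iff_le

theorem lintegral_enorm_sq_eq {α : Type*} [MeasurableSpace α] {μ : Measure α} {f : α → ℝ}
    (hf : Integrable (fun x => f x ^ 2) μ) :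
    ∫⁻ x, ‖f x‖ₑ ^ 2 ∂μ = ENNReal.ofReal (∫ x, f x ^ 2 ∂μ) := by
  rw [ofReal_integral_eq_lintegral_ofReal hf (Eventually.of_forall fun p => sq_nonneg _)]
  refine lintegral_congr fun p => ?_
  rw [Real.enorm_eq_ofReal_abs, ← ENNReal.ofReal_pow (abs_nonneg _), sq_abs]

theorem partialDeriv_comm {f : Plane → ℝ} (hf : IsSmooth f) (i j : Fin 2) (x : Plane) :
    partialDeriv i (partialDeriv j f) x = partialDeriv j (partialDeriv i f) x := by
  have hd : Differentiable ℝ (fderiv ℝ f) :=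
    (hf.fderiv_right (m := ((⊤ : ℕ∞) : WithTop ℕ∞)) le_rfl).differentiable (by simp)
  have h : ∀ i j, partialDeriv i (partialDeriv j f) x =
      fderiv ℝ (fderiv ℝ f) x (EuclideanSpace.single i 1) (EuclideanSpace.single j 1) := by
    intro i j
    have : partialDeriv j f = fun y => fderiv ℝ f y (EuclideanSpace.single j 1) := rfl
    rw [this, partialDeriv, fderiv_clm_apply (hd x) (differentiableAt_const _)]
    simp
  rw [h, h]
  exact second_derivative_symmetric (fun y => (hf.differentiable y).hasFDerivAt)
    (hd x).hasFDerivAt _ _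

theorem hasCompactSupport_partialDeriv {f : Plane → ℝ} (hf : HasCompactSupport f) (i : Fin 2) :
    HasCompactSupport (partialDeriv i f) :=
  hf.fderiv_apply ℝ _

theorem integral_mul_partialDeriv {f g : Plane → ℝ} (hf : IsSmooth f) (hg : IsSmooth g)
    (hfc : HasCompactSupport f) (i : Fin 2) :
    ∫ x, f x * partialDeriv i g x = -∫ x, partialDeriv i f x * g x := by
  refine integral_mul_fderiv_eq_neg_fderiv_mul_of_integrable ?_ ?_ ?_
    (fun x _ => hf.differentiable x) (fun x _ => hg.differentiable x)
  · exact Continuous.integrable_of_hasCompactSupport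
      ((hf.partialDeriv i).continuous.mul hg.continuous)
      (hasCompactSupport_partialDeriv hfc i).mul_right
  · exact Continuous.integrable_of_hasCompactSupport
      (hf.continuous.mul (hg.partialDeriv i).continuous) hfc.mul_right
  · exact Continuous.integrable_of_hasCompactSupport
      (hf.continuous.mul hg.continuous) hfc.mul_right

/-- Two integrations by parts move both derivatives onto `g`, where they commute. Compact support of
`f` alone suffices. -/
theorem integral_partialDeriv_cross {f g : Plane → ℝ} (hf : IsSmooth f) (hg : IsSmooth g)
    (hfc : HasCompactSupport f) :
    ∫ x, partialDeriv 1 f x * partialDeriv 0 g x = ∫ x, partialDeriv 0 f x * partialDeriv 1 g x := by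
  have h1 := integral_mul_partialDeriv hf (hg.partialDeriv 0) hfc 1
  have h2 := integral_mul_partialDeriv hf (hg.partialDeriv 1) hfc 0
  simp_rw [partialDeriv_comm hg 1 0] at h1
  linarith

/-- The subtracted bracket is minus the determinant of the gradient, a null Lagrangian that
integrates to zero for compactly supported fields. With gradient entries `a, b, c, d`, the algebra
leaves the remainder `(a + d)² + (b + c)²`. -/
theorem sq_add_sq_le_strainDensity (φ : Fin 2 → Plane → ℝ) (i j : Fin 2) (x : Plane) :
    partialDeriv j (φ i) x ^ 2 ≤ 2 * strainDensity φ x ^ 2 -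
      2 * (partialDeriv 1 (φ 0) x * partialDeriv 0 (φ 1) x -
        partialDeriv 0 (φ 0) x * partialDeriv 1 (φ 1) x) := by
  have hE : strainDensity φ x = |partialDeriv 0 (φ 0) x| +
      |partialDeriv 1 (φ 0) x + partialDeriv 0 (φ 1) x| + |partialDeriv 1 (φ 1) x| := by
    simp only [strainDensity, Fin.sum_univ_two, add_self_div_two]
    rw [add_comm (partialDeriv 0 (φ 1) _), abs_div, abs_two]
    ring
  rw [hE]
  generalize ha : partialDeriv 0 (φ 0) x = a
  generalize hb : partialDeriv 1 (φ 0) x = b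
  generalize hc : partialDeriv 0 (φ 1) x = c
  generalize hd : partialDeriv 1 (φ 1) x = d
  have h1 : a ^ 2 + d ^ 2 + (b + c) ^ 2 ≤ (|a| + |b + c| + |d|) ^ 2 := by
    rw [← sq_abs a, ← sq_abs d, ← sq_abs (b + c)]
    have := abs_nonneg a
    have := abs_nonneg d
    have := abs_nonneg (b + c)
    nlinarith [mul_nonneg (abs_nonneg a) (abs_nonneg d),
      mul_nonneg (abs_nonneg a) (abs_nonneg (b + c)),
      mul_nonneg (abs_nonneg d) (abs_nonneg (b + c))]
  have h2 : a ^ 2 + b ^ 2 + c ^ 2 + d ^ 2 ≤ 2 * (|a| + |b + c| + |d|) ^ 2 - 2 * (b * c - a * d) := by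
    nlinarith [sq_nonneg (a + d), sq_nonneg (b + c)]
  have h3 : partialDeriv j (φ i) x ^ 2 ≤ a ^ 2 + b ^ 2 + c ^ 2 + d ^ 2 := by
    have := sq_nonneg a
    have := sq_nonneg b
    have := sq_nonneg c
    have := sq_nonneg d
    fin_cases i <;> fin_cases j <;> simp only [Fin.zero_eta, Fin.mk_one, ha, hb, hc, hd] <;> linarith
  linarith

theorem hasCompactSupport_strainDensity {φ : Fin 2 → Plane → ℝ}
    (hc : ∀ i, HasCompactSupport (φ i)) : HasCompactSupport (strainDensity φ) := by
  have hp := fun i j => hasCompactSupport_partialDeriv (hc i) j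
  refine HasCompactSupport.intro ((((hp 0 0).union (hp 0 1)).union (hp 1 0)).union (hp 1 1)) ?_
  intro x hx
  simp only [Set.mem_union, not_or] at hx
  simp [strainDensity, image_eq_zero_of_notMem_tsupport hx.1.1.1,
    image_eq_zero_of_notMem_tsupport hx.1.1.2, image_eq_zero_of_notMem_tsupport hx.1.2,
    image_eq_zero_of_notMem_tsupport hx.2]

theorem korn_plane {φ : Fin 2 → Plane → ℝ} (hφ : ∀ i, IsSmooth (φ i))
    (hc : ∀ i, HasCompactSupport (φ i)) (i j : Fin 2) :
    eLpNorm (partialDeriv j (φ i)) 2 volume ≤ 2 * eLpNorm (strainDensity φ) 2 volume := by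
  have hp := fun i j => hasCompactSupport_partialDeriv (hc i) j
  have cp := fun i j => ((hφ i).partialDeriv j).continuous
  have i1 : Integrable (fun x => partialDeriv j (φ i) x ^ 2) := by
    simp_rw [sq]
    exact Continuous.integrable_of_hasCompactSupport ((cp i j).mul (cp i j)) (hp i j).mul_right
  have i2 : Integrable (fun x => strainDensity φ x ^ 2) := by
    simp_rw [sq]
    exact Continuous.integrable_of_hasCompactSupport
      ((continuous_strainDensity hφ).mul (continuous_strainDensity hφ))
      (hasCompactSupport_strainDensity hc).mul_right
  have i3 : Integrable (fun x => partialDeriv 1 (φ 0) x * partialDeriv 0 (φ 1) x) :=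
    Continuous.integrable_of_hasCompactSupport ((cp 0 1).mul (cp 1 0)) (hp 0 1).mul_right
  have i4 : Integrable (fun x => partialDeriv 0 (φ 0) x * partialDeriv 1 (φ 1) x) :=
    Continuous.integrable_of_hasCompactSupport ((cp 0 0).mul (cp 1 1)) (hp 0 0).mul_right
  have h : ∫ x, partialDeriv j (φ i) x ^ 2 ≤ 2 * ∫ x, strainDensity φ x ^ 2 := by
    have := integral_mono i1 ((i2.const_mul 2).sub ((i3.sub i4).const_mul 2))
      (sq_add_sq_le_strainDensity φ i j)
    refine this.trans (le_of_eq ?_)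
    have e1 := integral_sub (i2.const_mul 2) ((i3.sub i4).const_mul 2)
    have e2 := integral_sub i3 i4
    rw [integral_partialDeriv_cross (hφ 0) (hφ 1) (hc 0), sub_self] at e2
    rw [integral_const_mul, integral_const_mul] at e1
    simp only [Pi.sub_apply] at e1 e2 ⊢
    rw [e1, e2]
    ring
  rw [← sq_le_sq_iff_ennreal, mul_pow, eLpNorm_two_sq, eLpNorm_two_sq, lintegral_enorm_sq_eq i1,
    lintegral_enorm_sq_eq i2]
  calc ENNReal.ofReal (∫ x, partialDeriv j (φ i) x ^ 2)
      ≤ ENNReal.ofReal (4 * ∫ x, strainDensity φ x ^ 2) :=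
        ENNReal.ofReal_le_ofReal (by
          have : 0 ≤ ∫ x, strainDensity φ x ^ 2 := integral_nonneg fun x => sq_nonneg _
          linarith)
    _ = 2 ^ 2 * ENNReal.ofReal (∫ x, strainDensity φ x ^ 2) := by
        rw [ENNReal.ofReal_mul (by norm_num)]
        norm_num

/-- The centre of the unit square. -/
def squareCenter : Plane := point (1 / 2, 1 / 2)

theorem closedBall_subset_unitSquare : Metric.closedBall squareCenter (1 / 2) ⊆ unitSquare := by
  intro x hx i
  have h1 : ‖(x - squareCenter) i‖ ≤ 1 / 2 :=
    (PiLp.norm_apply_le (x - squareCenter) i).trans (by rwa [← dist_eq_norm])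
  have h2 : squareCenter i = 1 / 2 := by fin_cases i <;> rfl
  rw [PiLp.sub_apply, h2, Real.norm_eq_abs, abs_le] at h1
  constructor <;> linarith

theorem unitSquare_subset_ball : unitSquare ⊆ Metric.ball squareCenter (3 / 4) := by
  intro x hx
  rw [Metric.mem_ball, EuclideanSpace.dist_eq]
  rw [Real.sqrt_lt' (by norm_num), Fin.sum_univ_two, Real.dist_eq, Real.dist_eq, sq_abs, sq_abs]
  have h0 : squareCenter 0 = 1 / 2 := rfl
  have h1 : squareCenter 1 = 1 / 2 := rfl
  rw [h0, h1]
  have a := hx 0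
  have b := hx 1
  nlinarith [a.1, a.2, b.1, b.2]

theorem exists_bound_cutoff : ∃ (χ : Plane → ℝ) (M : ℝ≥0), IsSmooth χ ∧ HasCompactSupport χ ∧
    (∀ x ∈ Metric.ball squareCenter (1 / 4), χ x = 1) ∧
    tsupport χ ⊆ unitSquare ∧ (∀ x, |χ x| ≤ 1) ∧ ∀ i x, |partialDeriv i χ x| ≤ M := by
  let χ : ContDiffBump squareCenter := ⟨1 / 4, 1 / 2, by norm_num, by norm_num⟩
  have hs : IsSmooth χ := χ.contDiff
  obtain ⟨M0, h0⟩ := (hs.partialDeriv 0).continuous.bounded_above_of_compact_support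
    (hasCompactSupport_partialDeriv χ.hasCompactSupport 0)
  obtain ⟨M1, h1⟩ := (hs.partialDeriv 1).continuous.bounded_above_of_compact_support
    (hasCompactSupport_partialDeriv χ.hasCompactSupport 1)
  refine ⟨χ, (max M0 M1).toNNReal, hs, χ.hasCompactSupport,
    fun x hx => χ.one_of_mem_closedBall (Metric.ball_subset_closedBall hx), ?_, fun x => ?_, ?_⟩
  · rw [χ.tsupport_eq]
    exact closedBall_subset_unitSquare
  · rw [abs_of_nonneg χ.nonneg]
    exact χ.le_one
  · rw [Fin.forall_fin_two]
    exact ⟨fun x => (h0 x).trans ((le_max_left _ _).trans (Real.le_coe_toNNReal _)),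
      fun x => (h1 x).trans ((le_max_right _ _).trans (Real.le_coe_toNNReal _))⟩

/-- In the product rule the derivatives of the cutoff multiply only undifferentiated values of `v`,
which the estimate on the square controls. -/
theorem strainDensity_cutoff_le {χ : Plane → ℝ} {M : ℝ≥0} (hs : IsSmooth χ)
    (h1 : ∀ x, |χ x| ≤ 1) (hM : ∀ i x, |partialDeriv i χ x| ≤ M)
    {v : Fin 2 → Plane → ℝ} (hv : ∀ i, IsSmooth (v i)) (x : Plane) :
    strainDensity (fun i x => χ x * v i x) x ≤ strainDensity v x + 2 * M * (|v 0 x| + |v 1 x|) := by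
  have key : ∀ i j, |(partialDeriv j (fun x => χ x * v i x) x +
      partialDeriv i (fun x => χ x * v j x) x) / 2| ≤
      |(partialDeriv j (v i) x + partialDeriv i (v j) x) / 2| + M * (|v i x| + |v j x|) / 2 := by
    intro i j
    rw [partialDeriv_mul (hs.differentiable x) ((hv i).differentiable x),
      partialDeriv_mul (hs.differentiable x) ((hv j).differentiable x)]
    have e : (χ x * partialDeriv j (v i) x + v i x * partialDeriv j χ x +
        (χ x * partialDeriv i (v j) x + v j x * partialDeriv i χ x)) / 2 =
        χ x * ((partialDeriv j (v i) x + partialDeriv i (v j) x) / 2) +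
        (v i x * (partialDeriv j χ x / 2) + v j x * (partialDeriv i χ x / 2)) := by ring
    rw [e]
    refine (abs_add_le _ _).trans (add_le_add ?_ ((abs_add_le _ _).trans ?_))
    · rw [abs_mul]
      exact mul_le_of_le_one_left (abs_nonneg _) (h1 x)
    · rw [abs_mul, abs_mul, abs_div, abs_div, abs_two]
      have := mul_le_mul_of_nonneg_left (hM j x) (abs_nonneg (v i x))
      have := mul_le_mul_of_nonneg_left (hM i x) (abs_nonneg (v j x))
      linarith
  calc strainDensity (fun i x => χ x * v i x) x
      ≤ ∑ i, ∑ j, (|(partialDeriv j (v i) x + partialDeriv i (v j) x) / 2| +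
          M * (|v i x| + |v j x|) / 2) :=
        Finset.sum_le_sum fun i _ => Finset.sum_le_sum fun j _ => key i j
    _ = strainDensity v x + 2 * M * (|v 0 x| + |v 1 x|) := by
        simp only [strainDensity, Fin.sum_univ_two]
        ring

/-- After subtraction of the rigid motion found on the square, the field is cut off inside the
square and the inequality of the whole plane applies. The square lies between the balls of radii
`1/4` and `3/4`, whence the ratio 3 in all later ball estimates. -/
theorem korn_unit_ball : ∃ C : ℝ≥0, ∀ φ : Fin 2 → Plane → ℝ, (∀ i, IsSmooth (φ i)) →
    ∃ a b c : ℝ,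
      (∀ i, eLpNorm (fun x => φ i x - rigid a b c i x) 2
        (volume.restrict (Metric.ball squareCenter (1 / 4))) ≤
        C * eLpNorm (strainDensity φ) 2 (volume.restrict (Metric.ball squareCenter (3 / 4)))) ∧
      ∀ i j, eLpNorm (fun x => partialDeriv j (φ i) x - !![0, c; -c, 0] i j) 2
        (volume.restrict (Metric.ball squareCenter (1 / 4))) ≤
        C * eLpNorm (strainDensity φ) 2 (volume.restrict (Metric.ball squareCenter (3 / 4))) := by
  obtain ⟨χ, M, hs, hc, hone, hsupp, hle, hM⟩ := exists_bound_cutoff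
  refine ⟨2 * (1 + 2 * M * (500 + 500)) + 500, fun φ hφ => ?_⟩
  obtain ⟨a, b, c, h⟩ := unitSquare_korn_poincare hφ
  set v : Fin 2 → Plane → ℝ := fun i x => φ i x - rigid a b c i x with hv_def
  have hv : ∀ i, IsSmooth (v i) := fun i => (hφ i).sub (isSmooth_rigid a b c i)
  have hev : strainDensity v = strainDensity φ := strainDensity_sub_rigid hφ a b c
  set E := eLpNorm (strainDensity φ) 2 (volume.restrict (Metric.ball squareCenter (3 / 4)))
  set EQ := eLpNorm (strainDensity φ) 2 (volume.restrict unitSquare) with hEQ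
  have hEQE : EQ ≤ E := eLpNorm_mono_measure _ (Measure.restrict_mono unitSquare_subset_ball le_rfl)
  -- `500² = 250000` dominates the constant `200000` of the squared estimate.
  have hvQ : ∀ i, eLpNorm (v i) 2 (volume.restrict unitSquare) ≤ (500 : ℝ≥0) * EQ := by
    intro i
    rw [← sq_le_sq_iff_ennreal, mul_pow, eLpNorm_two_sq, hEQ, eLpNorm_two_sq]
    refine (h i).trans (mul_le_mul_left ?_ _)
    rw [← ENNReal.ofReal_coe_nnreal, ← ENNReal.ofReal_pow (by norm_num)]
    exact ENNReal.ofReal_le_ofReal (by norm_num)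
  have hball : Metric.ball squareCenter (1 / 4) ⊆ unitSquare :=
    (Metric.ball_subset_closedBall.trans (Metric.closedBall_subset_closedBall (by norm_num))).trans
      closedBall_subset_unitSquare
  set w : Fin 2 → Plane → ℝ := fun i x => χ x * v i x with hw_def
  have hw : ∀ i, IsSmooth (w i) := fun i => hs.mul (hv i)
  have hwc : ∀ i, HasCompactSupport (w i) := fun i => hc.mul_right
  have hzero : ∀ x, x ∉ unitSquare → strainDensity w x = 0 := by
    intro x hx
    have h0 : ∀ i j, partialDeriv j (w i) x = 0 := by
      intro i j
      have : x ∉ tsupport (fderiv ℝ (w i)) := fun hmem =>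
        hx (hsupp (tsupport_mul_subset_left (tsupport_fderiv_subset ℝ hmem)))
      simp [partialDeriv, image_eq_zero_of_notMem_tsupport this]
    simp [strainDensity, h0]
  have hmeasQ : MeasurableSet unitSquare := by
    have : unitSquare = ⋂ i, (fun x : Plane => x i) ⁻¹' Set.Icc (0 : ℝ) 1 := by
      ext; simp [unitSquare]
    rw [this]
    exact MeasurableSet.iInter fun i => (isSmooth_coord i).continuous.measurable measurableSet_Icc
  have hew : eLpNorm (strainDensity w) 2 volume ≤ (1 + 2 * M * (500 + 500) : ℝ≥0) * EQ := by
    have e1 : strainDensity w = unitSquare.indicator (strainDensity w) := by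
      funext x
      by_cases hx : x ∈ unitSquare
      · simp [hx]
      · simp [hx, hzero x hx]
    rw [e1, eLpNorm_indicator_eq_eLpNorm_restrict hmeasQ]
    have e2 : eLpNorm (strainDensity w) 2 (volume.restrict unitSquare) ≤
        eLpNorm (fun x => strainDensity φ x + (2 * M) * (|v 0 x| + |v 1 x|)) 2
          (volume.restrict unitSquare) := by
      refine eLpNorm_mono_real fun x => ?_
      rw [Real.norm_eq_abs, abs_of_nonneg (strainDensity_nonneg _ _), ← hev]
      exact strainDensity_cutoff_le hs hle hM hv x
    have cv := fun i => (hv i).continuous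
    have ce := continuous_strainDensity hφ
    have m1 : Continuous fun x => (2 * (M : ℝ)) * (|v 0 x| + |v 1 x|) :=
      continuous_const.mul ((cv 0).abs.add (cv 1).abs)
    have e3 := eLpNorm_add_le (μ := volume.restrict unitSquare) ce.aestronglyMeasurable
      m1.aestronglyMeasurable one_le_two
    have e4 : eLpNorm (fun x => (2 * (M : ℝ)) * (|v 0 x| + |v 1 x|)) 2
        (volume.restrict unitSquare) ≤ (2 * M * (500 + 500) : ℝ≥0) * EQ := by
      have e5 := eLpNorm_const_smul (2 * (M : ℝ)) (fun x => |v 0 x| + |v 1 x|) 2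
        (volume.restrict unitSquare)
      have e6 := eLpNorm_add_le (μ := volume.restrict unitSquare)
        (cv 0).abs.aestronglyMeasurable (cv 1).abs.aestronglyMeasurable one_le_two
      have e7 : ‖(2 * (M : ℝ))‖ₑ = (2 * M : ℝ≥0) := by
        rw [Real.enorm_eq_ofReal (by positivity), ← ENNReal.ofReal_coe_nnreal]
        simp
      have e8 : ∀ i, eLpNorm (fun x => |v i x|) 2 (volume.restrict unitSquare) =
          eLpNorm (v i) 2 (volume.restrict unitSquare) := fun i => eLpNorm_norm (v i)
      rw [e7] at e5
      refine e5.le.trans ?_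
      rw [ENNReal.coe_mul _ (500 + 500), mul_assoc]
      refine mul_le_mul' (by push_cast; rfl) (e6.trans ?_)
      rw [e8, e8, ENNReal.coe_add, add_mul]
      exact add_le_add (hvQ 0) (hvQ 1)
    refine e2.trans (e3.trans ?_)
    rw [ENNReal.coe_add, add_mul, ENNReal.coe_one, one_mul]
    exact add_le_add le_rfl e4
  refine ⟨a, b, c, fun i => ?_, fun i j => ?_⟩
  · refine (eLpNorm_mono_measure _ (Measure.restrict_mono hball le_rfl)).trans
      ((hvQ i).trans (mul_le_mul' ?_ hEQE))
    exact_mod_cast le_add_self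
  -- The cutoff is identically 1 on the small ball, so the derivatives of the cut-off field are
  -- those of `φ` minus the rigid motion there.
  · have e1 : eLpNorm (fun x => partialDeriv j (φ i) x - !![0, c; -c, 0] i j) 2
        (volume.restrict (Metric.ball squareCenter (1 / 4))) =
        eLpNorm (partialDeriv j (w i)) 2 (volume.restrict (Metric.ball squareCenter (1 / 4))) := by
      refine eLpNorm_congr_ae ?_
      filter_upwards [ae_restrict_mem measurableSet_ball] with x hx
      have : w i =ᶠ[𝓝 x] v i := by
        filter_upwards [Metric.isOpen_ball.mem_nhds hx] with y hy
        simp [hw_def, hone y hy]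
      rw [partialDeriv.eq_1 j (w i), this.fderiv_eq, ← partialDeriv.eq_1, hv_def]
      simp only
      rw [partialDeriv_sub ((hφ i).differentiable x) ((isSmooth_rigid a b c i).differentiable x),
        partialDeriv_rigid]
    rw [e1]
    refine (eLpNorm_mono_measure _ Measure.restrict_le_self).trans ((korn_plane hw hwc i j).trans ?_)
    calc 2 * eLpNorm (strainDensity w) 2 volume
        ≤ 2 * ((1 + 2 * M * (500 + 500) : ℝ≥0) * E) := by gcongr; exact hew.trans (by gcongr)
      _ = (2 * (1 + 2 * M * (500 + 500)) : ℝ≥0) * E := by push_cast; ring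
      _ ≤ _ := by gcongr; exact le_self_add

end

section

/-! ### Scaling -/

theorem lintegral_comp_homothety (G : Plane → ℝ≥0∞) (hG : Measurable G) (z w : Plane) {κ : ℝ}
    (hκ : 0 < κ) :
    ∫⁻ x, G (z + κ • (x - w)) = ENNReal.ofReal (κ⁻¹ ^ 2) * ∫⁻ x, G x := by
  have h1 : ∫⁻ x, G (z + κ • (x - w)) = ∫⁻ x, G (z + κ • x) :=
    lintegral_sub_right_eq_self (fun x => G (z + κ • x)) w
  have h2 : ∫⁻ x, G (z + κ • x) = ∫⁻ x, G (z + x) ∂(Measure.map (κ • ·) volume) := by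
    rw [lintegral_map (by fun_prop) (by fun_prop)]
  rw [h1, h2, Measure.map_addHaar_smul _ hκ.ne', lintegral_smul_measure, smul_eq_mul,
    lintegral_add_left_eq_self G z]
  congr 2
  rw [finrank_euclideanSpace_fin, abs_of_pos (by positivity), inv_pow]

theorem eLpNorm_comp_homothety {f : Plane → ℝ} (hf : Continuous f) (z w : Plane) {κ : ℝ}
    (hκ : 0 < κ) (s : ℝ) :
    eLpNorm (fun x => f (z + κ • (x - w))) 2 (volume.restrict (Metric.ball w s)) =
      ENNReal.ofReal κ⁻¹ * eLpNorm f 2 (volume.restrict (Metric.ball z (κ * s))) := by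
  have hinj : Function.Injective fun a : ℝ≥0∞ => a ^ 2 :=
    (ENNReal.pow_right_strictMono two_ne_zero).injective
  apply hinj
  simp only
  rw [mul_pow, eLpNorm_two_sq, eLpNorm_two_sq, ← ENNReal.ofReal_pow (by positivity),
    ← lintegral_indicator measurableSet_ball, ← lintegral_indicator measurableSet_ball,
    ← lintegral_comp_homothety _ _ z w hκ]
  · refine lintegral_congr fun x => ?_
    have : z + κ • (x - w) ∈ Metric.ball z (κ * s) ↔ x ∈ Metric.ball w s := by
      rw [Metric.mem_ball, Metric.mem_ball, dist_eq_norm, dist_eq_norm, add_sub_cancel_left,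
        norm_smul, Real.norm_of_nonneg hκ.le, mul_lt_mul_iff_right₀ hκ]
    by_cases hx : x ∈ Metric.ball w s
    · rw [Set.indicator_of_mem hx, Set.indicator_of_mem (this.2 hx)]
    · rw [Set.indicator_of_notMem hx, Set.indicator_of_notMem (fun h => hx (this.1 h))]
  · exact (hf.measurable.enorm.pow_const 2).indicator measurableSet_ball

theorem isSmooth_comp_homothety {f : Plane → ℝ} (hf : IsSmooth f) (z w : Plane) (κ : ℝ) :
    IsSmooth fun x => f (z + κ • (x - w)) :=
  hf.comp (by fun_prop)

theorem partialDeriv_comp_homothety {f : Plane → ℝ} (hf : IsSmooth f) (z w : Plane) (κ : ℝ)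
    (i : Fin 2) (x : Plane) :
    partialDeriv i (fun x => f (z + κ • (x - w))) x = κ * partialDeriv i f (z + κ • (x - w)) := by
  have h : HasFDerivAt (fun x : Plane => z + κ • (x - w)) (κ • ContinuousLinearMap.id ℝ Plane) x :=
    (((hasFDerivAt_id x).sub_const w).const_smul κ).const_add z
  have h2 := ((hf.differentiable (z + κ • (x - w))).hasFDerivAt.comp x h).fderiv
  rw [partialDeriv]
  change fderiv ℝ (f ∘ fun x : Plane => z + κ • (x - w)) x _ = _
  rw [h2]
  simp [partialDeriv]

theorem korn_ball : ∃ C : ℝ≥0, ∀ φ : Fin 2 → Plane → ℝ, (∀ i, IsSmooth (φ i)) →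
    ∀ (z : Plane) (R : ℝ), 0 < R → ∃ a b c : ℝ,
      (∀ i, eLpNorm (fun x => φ i x - rigid a b c i x) 2 (volume.restrict (Metric.ball z R)) ≤
        C * ENNReal.ofReal R *
          eLpNorm (strainDensity φ) 2 (volume.restrict (Metric.ball z (3 * R)))) ∧
      ∀ i j, eLpNorm (fun x => partialDeriv j (φ i) x - !![0, c; -c, 0] i j) 2
        (volume.restrict (Metric.ball z R)) ≤
        C * eLpNorm (strainDensity φ) 2 (volume.restrict (Metric.ball z (3 * R))) := by
  obtain ⟨C, hC⟩ := korn_unit_ball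
  refine ⟨4 * C, fun φ hφ z R hR => ?_⟩
  have hκ : 0 < 4 * R := by positivity
  set κ := 4 * R with hκ_def
  set w := squareCenter
  obtain ⟨a, b, c, h1, h2⟩ := hC (fun i x => φ i (z + κ • (x - w)))
    fun i => isSmooth_comp_homothety (hφ i) z w κ
  have hr1 : κ * (1 / 4) = R := by rw [hκ_def]; ring
  have hr3 : κ * (3 / 4) = 3 * R := by rw [hκ_def]; ring
  have hstrain : strainDensity (fun i x => φ i (z + κ • (x - w))) =
      fun x => κ * strainDensity φ (z + κ • (x - w)) := by
    funext x
    simp only [strainDensity, partialDeriv_comp_homothety (hφ _), ← mul_add, mul_div_assoc,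
      abs_mul, abs_of_pos hκ, ← Finset.mul_sum]
  have hkk : ENNReal.ofReal κ * ENNReal.ofReal κ⁻¹ = 1 := by
    rw [← ENNReal.ofReal_mul hκ.le, mul_inv_cancel₀ hκ.ne', ENNReal.ofReal_one]
  set E := eLpNorm (strainDensity φ) 2 (volume.restrict (Metric.ball z (3 * R))) with hE
  have hE' : eLpNorm (strainDensity (fun i x => φ i (z + κ • (x - w)))) 2
      (volume.restrict (Metric.ball w (3 / 4))) = E := by
    rw [hstrain]
    have := eLpNorm_const_smul κ (fun x => strainDensity φ (z + κ • (x - w))) 2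
      (volume.restrict (Metric.ball w (3 / 4)))
    refine this.trans ?_
    rw [eLpNorm_comp_homothety (continuous_strainDensity hφ) z w hκ, hr3, ← mul_assoc,
      Real.enorm_eq_ofReal hκ.le, hkk, one_mul]
  rw [hE'] at h1 h2
  -- These are the coefficients of `rigid a b c` after substituting `x = w + κ⁻¹ (y - z)`.
  refine ⟨a + c * (w 1 - κ⁻¹ * z 1), b - c * (w 0 - κ⁻¹ * z 0), c * κ⁻¹, fun i => ?_,
    fun i j => ?_⟩
  · have e1 : (fun x => φ i (z + κ • (x - w)) - rigid a b c i x) =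
        fun x => (fun y => φ i y - rigid (a + c * (w 1 - κ⁻¹ * z 1)) (b - c * (w 0 - κ⁻¹ * z 0))
          (c * κ⁻¹) i y) (z + κ • (x - w)) := by
      funext x
      have hk : κ ≠ 0 := hκ.ne'
      fin_cases i
      · simp [rigid]; field_simp; ring
      · simp [rigid]; field_simp; ring
    have h3 := h1 i
    have hcont : Continuous fun y => φ i y - rigid (a + c * (w 1 - κ⁻¹ * z 1))
        (b - c * (w 0 - κ⁻¹ * z 0)) (c * κ⁻¹) i y :=
      (hφ i).continuous.sub (isSmooth_rigid _ _ _ i).continuous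
    rw [e1, eLpNorm_comp_homothety hcont z w hκ, hr1] at h3
    have h4 := mul_le_mul_right h3 (ENNReal.ofReal κ)
    rw [← mul_assoc, hkk, one_mul] at h4
    refine h4.trans (le_of_eq ?_)
    rw [hκ_def, ENNReal.ofReal_mul (by norm_num)]
    push_cast
    norm_num
    ring
  · have e1 : (fun x => partialDeriv j (fun x => φ i (z + κ • (x - w))) x - !![0, c; -c, 0] i j) =
        κ • fun x => (fun y => partialDeriv j (φ i) y - !![0, c * κ⁻¹; -(c * κ⁻¹), 0] i j)
          (z + κ • (x - w)) := by
      funext x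
      have hk : κ ≠ 0 := hκ.ne'
      simp only [partialDeriv_comp_homothety (hφ _), Pi.smul_apply, smul_eq_mul, mul_sub]
      congr 1
      fin_cases i <;> fin_cases j <;> simp <;> field_simp
    have h3 := h2 i j
    have hcont : Continuous fun y => partialDeriv j (φ i) y - !![0, c * κ⁻¹; -(c * κ⁻¹), 0] i j :=
      ((hφ i).partialDeriv j).continuous.sub continuous_const
    rw [e1, eLpNorm_const_smul, eLpNorm_comp_homothety hcont z w hκ, hr1, ← mul_assoc,
      Real.enorm_eq_ofReal hκ.le, hkk, one_mul] at h3
    refine h3.trans ?_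
    gcongr
    exact_mod_cast le_mul_of_one_le_left (zero_le) (by norm_num : (1 : ℝ≥0) ≤ 4)

end

/-! ### Korn and trace inequalities up to a Lipschitz boundary. -/

section

/-! ### Coordinates above a Lipschitz graph -/

/-- The height of a point above the graph of `ψ` in the coordinates `e`. -/
def height (e : Plane ≃ₗᵢ[ℝ] Plane) (ψ : ℝ → ℝ) (x : Plane) : ℝ := e x 1 - ψ (e x 0)

/-- The vertical unit vector of the coordinates `e`. -/
def vertical (e : Plane ≃ₗᵢ[ℝ] Plane) : Plane := e.symm (EuclideanSpace.single 1 1)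

/-- The point at a given abscissa and at a given height above the graph of `ψ`. -/
def graphPoint (e : Plane ≃ₗᵢ[ℝ] Plane) (ψ : ℝ → ℝ) (p : ℝ × ℝ) : Plane :=
  e.symm (point (p.1, ψ p.1 + p.2))

variable {e : Plane ≃ₗᵢ[ℝ] Plane} {ψ : ℝ → ℝ} {K : ℝ≥0}

theorem norm_vertical : ‖vertical e‖ = 1 := by simp [vertical]

theorem coord_add_vertical_zero (x : Plane) (t : ℝ) : e (x + t • vertical e) 0 = e x 0 := by
  simp [vertical]

theorem height_add_vertical (x : Plane) (t : ℝ) :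
    height e ψ (x + t • vertical e) = height e ψ x + t := by
  simp [height, vertical]; ring

theorem height_graphPoint (p : ℝ × ℝ) : height e ψ (graphPoint e ψ p) = p.2 := by
  simp [height, graphPoint]

theorem coord_graphPoint (p : ℝ × ℝ) : e (graphPoint e ψ p) 0 = p.1 := by
  simp [graphPoint]

theorem graphPoint_add_vertical (s t τ : ℝ) :
    graphPoint e ψ (s, t) + τ • vertical e = graphPoint e ψ (s, t + τ) := by
  apply e.injective
  ext i
  fin_cases i <;> simp [graphPoint, vertical]
  ring

theorem graphPoint_coord_height (x : Plane) : graphPoint e ψ (e x 0, height e ψ x) = x := by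
  apply e.injective
  ext i
  fin_cases i <;> simp [graphPoint, height]

theorem abs_coord_sub_le (x y : Plane) (i : Fin 2) : |e x i - e y i| ≤ ‖x - y‖ := by
  rw [← e.norm_map (x - y), map_sub]
  exact PiLp.norm_apply_le (e x - e y) i

theorem abs_height_sub_le (hψ : LipschitzWith K ψ) (x y : Plane) :
    |height e ψ x - height e ψ y| ≤ (1 + K) * ‖x - y‖ := by
  have h1 := abs_coord_sub_le (e := e) x y 1
  have h2 := hψ.dist_le_mul (e x 0) (e y 0)
  rw [Real.dist_eq, Real.dist_eq] at h2
  have h3 := mul_le_mul_of_nonneg_left (abs_coord_sub_le (e := e) x y 0) K.2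
  have e1 : height e ψ x - height e ψ y = (e x 1 - e y 1) - (ψ (e x 0) - ψ (e y 0)) := by
    simp only [height]; ring
  rw [e1]
  refine (abs_sub _ _).trans ?_
  simp only [NNReal.val_eq_coe] at h3
  linarith

theorem continuous_coord (i : Fin 2) : Continuous fun x => e x i :=
  (isSmooth_coord i).continuous.comp e.continuous

theorem continuous_height (hψ : LipschitzWith K ψ) : Continuous (height e ψ) :=
  (continuous_coord 1).sub (hψ.continuous.comp (continuous_coord 0))

theorem continuous_graphPoint (hψ : LipschitzWith K ψ) : Continuous (graphPoint e ψ) :=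
  e.symm.continuous.comp (continuous_point.comp
    (continuous_fst.prodMk ((hψ.continuous.comp continuous_fst).add continuous_snd)))

/-- Flattening the graph is a shear: on each vertical line it is a translation, so it preserves area
for any Lipschitz `ψ`. -/
theorem lintegral_graphPoint {G : Plane → ℝ≥0∞} (hG : Measurable G) :
    ∫⁻ x, G x = ∫⁻ s, ∫⁻ t, G (graphPoint e ψ (s, t)) := by
  rw [← (e.symm.measurePreserving).lintegral_comp hG, lintegral_plane, Measure.volume_eq_prod,
    lintegral_prod _ (by
      exact (hG.comp (e.symm.continuous.comp continuous_point).measurable).aemeasurable)]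
  refine lintegral_congr fun s => ?_
  exact (lintegral_add_left_eq_self (fun t => G (e.symm (point (s, t)))) (ψ s)).symm

theorem lintegral_comp_mul_left {F : ℝ → ℝ≥0∞} (hF : Measurable F) {κ : ℝ} (hκ : 0 < κ) :
    ∫⁻ t, F (κ * t) = ENNReal.ofReal κ⁻¹ * ∫⁻ t, F t := by
  have h : ∫⁻ t, F (κ * t) = ∫⁻ t, F t ∂(Measure.map (κ * ·) volume) := by
    rw [lintegral_map hF (by fun_prop)]
  rw [h, Real.map_volume_mul_left hκ.ne', lintegral_smul_measure, smul_eq_mul,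
    abs_of_pos (by positivity)]

/-- The stretch by the factor `κ` of the heights above a graph. -/
def stretch (e : Plane ≃ₗᵢ[ℝ] Plane) (ψ : ℝ → ℝ) (κ : ℝ) (x : Plane) : Plane :=
  x + ((κ - 1) * height e ψ x) • vertical e

theorem height_stretch (κ : ℝ) (x : Plane) :
    height e ψ (stretch e ψ κ x) = κ * height e ψ x := by
  rw [stretch, height_add_vertical]; ring

theorem coord_stretch (κ : ℝ) (x : Plane) : e (stretch e ψ κ x) 0 = e x 0 :=
  coord_add_vertical_zero _ _

theorem continuous_stretch (hψ : LipschitzWith K ψ) (κ : ℝ) : Continuous (stretch e ψ κ) :=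
  continuous_id.add ((continuous_const.mul (continuous_height hψ)).smul continuous_const)

/-- In flattened coordinates the stretch multiplies the height by `κ`, so its Jacobian is `κ`. -/
theorem lintegral_comp_stretch (hψ : LipschitzWith K ψ) {G : Plane → ℝ≥0∞} (hG : Measurable G)
    {κ : ℝ} (hκ : 0 < κ) :
    ∫⁻ x, G (stretch e ψ κ x) = ENNReal.ofReal κ⁻¹ * ∫⁻ x, G x := by
  rw [lintegral_graphPoint (e := e) (ψ := ψ) (G := fun x => G (stretch e ψ κ x))
    (hG.comp (continuous_stretch hψ κ).measurable), lintegral_graphPoint (e := e) (ψ := ψ) hG, ← lintegral_const_mul _ (by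
      exact (hG.comp (continuous_graphPoint hψ).measurable).lintegral_prod_right')]
  refine lintegral_congr fun s => ?_
  rw [← lintegral_comp_mul_left (F := fun t => G (graphPoint e ψ (s, t))) (hG.comp
    ((continuous_graphPoint hψ).comp (Continuous.prodMk continuous_const continuous_id)).measurable)
    hκ]
  refine lintegral_congr fun t => ?_
  rw [stretch, height_graphPoint, graphPoint_add_vertical]
  congr 3
  ring

/-! ### Averaging over balls of radius proportional to the height -/

/-- The averaging kernel `1[‖x - z‖ < θ h(z)] / h(z)²`. -/
def avgKernel (e : Plane ≃ₗᵢ[ℝ] Plane) (ψ : ℝ → ℝ) (θ : ℝ) (x z : Plane) : ℝ≥0∞ :=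
  {p : Plane × Plane | ‖p.1 - p.2‖ < θ * height e ψ p.2 ∧ 0 < height e ψ p.2}.indicator
    (fun p => ENNReal.ofReal ((height e ψ p.2)⁻¹ ^ 2)) (x, z)

theorem measurable_avgKernel (hψ : LipschitzWith K ψ) (θ : ℝ) :
    Measurable (Function.uncurry (avgKernel e ψ θ)) := by
  have h1 : Measurable fun p : Plane × Plane => height e ψ p.2 :=
    ((continuous_height hψ).comp continuous_snd).measurable
  have h2 : Measurable fun p : Plane × Plane => ‖p.1 - p.2‖ := by fun_prop
  refine Measurable.indicator (h1.inv.pow_const 2).ennreal_ofReal ?_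
  exact (measurableSet_lt h2 (h1.const_mul θ)).inter (measurableSet_lt measurable_const h1)

theorem lintegral_mul_avgKernel {G : Plane → ℝ≥0∞} (hG : Measurable G) {θ : ℝ} {z : Plane}
    (hz : 0 < height e ψ z) :
    ∫⁻ x, G x * avgKernel e ψ θ x z = ENNReal.ofReal ((height e ψ z)⁻¹ ^ 2) *
      ∫⁻ x in Metric.ball z (θ * height e ψ z), G x := by
  rw [← lintegral_const_mul _ hG, ← lintegral_indicator measurableSet_ball]
  refine lintegral_congr fun x => ?_
  by_cases hx : x ∈ Metric.ball z (θ * height e ψ z)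
  · rw [Set.indicator_of_mem hx, avgKernel, Set.indicator_of_mem, mul_comm]
    exact ⟨by rwa [Metric.mem_ball, dist_eq_norm] at hx, hz⟩
  · rw [Set.indicator_of_notMem hx, avgKernel, Set.indicator_of_notMem, mul_zero]
    exact fun h => hx (by rw [Metric.mem_ball, dist_eq_norm]; exact h.1)

theorem avgKernel_eq_zero {θ : ℝ} {x z : Plane} (hz : ¬ 0 < height e ψ z) :
    avgKernel e ψ θ x z = 0 :=
  Set.indicator_of_notMem (fun h => hz h.2) _

theorem height_bounds (hψ : LipschitzWith K ψ) {θ : ℝ} {x z : Plane}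
    (h : ‖x - z‖ < θ * height e ψ z) :
    (1 - (1 + K) * θ) * height e ψ z ≤ height e ψ x ∧
      height e ψ x ≤ (1 + (1 + K) * θ) * height e ψ z := by
  have h1 := abs_le.1 (abs_height_sub_le (e := e) hψ x z)
  have h2 : (1 + (K : ℝ)) * ‖x - z‖ ≤ (1 + K) * (θ * height e ψ z) := by gcongr
  constructor <;> nlinarith [h1.1, h1.2]

/-- The height is almost constant on balls of radius `θ` times the height. The ball about `x` of
radius `θ/2` times its height therefore lies in the support, and the kernel there is at least half
of `h(x)⁻²`, where `h` is the height. The area factor `(θ/2)²` times `1/2` is `θ²/8`. -/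
theorem le_lintegral_avgKernel (hψ : LipschitzWith K ψ) {θ : ℝ} (hθ : 0 < θ)
    (hθK : (1 + K) * θ ≤ 1 / 4) {x : Plane} (hx : 0 < height e ψ x) :
    ENNReal.ofReal (θ ^ 2 / 8) * volume (Metric.ball (0 : Plane) 1) ≤
      ∫⁻ z, avgKernel e ψ θ x z := by
  have hsub : ∀ z ∈ Metric.ball x (θ / 2 * height e ψ x),
      ENNReal.ofReal ((height e ψ x)⁻¹ ^ 2 / 2) ≤ avgKernel e ψ θ x z := by
    intro z hz
    rw [Metric.mem_ball, dist_eq_norm] at hz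
    obtain ⟨h1, h2⟩ := height_bounds hψ hz
    have h3 : 7 / 8 * height e ψ x ≤ height e ψ z := by nlinarith
    have h4 : height e ψ z ≤ 9 / 8 * height e ψ x := by nlinarith
    rw [avgKernel, Set.indicator_of_mem]
    · apply ENNReal.ofReal_le_ofReal
      simp only
      have hz0 : 0 < height e ψ z := by linarith
      rw [inv_pow, inv_pow, ← one_div, ← one_div, div_div, div_le_div_iff₀ (by positivity)
        (by positivity)]
      nlinarith
    · refine ⟨?_, by simp only; linarith⟩
      simp only
      rw [norm_sub_rev]
      nlinarith
  calc ENNReal.ofReal (θ ^ 2 / 8) * volume (Metric.ball (0 : Plane) 1)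
      = ENNReal.ofReal ((height e ψ x)⁻¹ ^ 2 / 2) *
          volume (Metric.ball x (θ / 2 * height e ψ x)) := by
        rw [Measure.addHaar_ball volume x (by positivity : 0 ≤ θ / 2 * height e ψ x), ← mul_assoc,
          ← ENNReal.ofReal_mul (by positivity), finrank_euclideanSpace_fin]
        congr 2
        field_simp
        norm_num
    _ = ∫⁻ _ in Metric.ball x (θ / 2 * height e ψ x), ENNReal.ofReal ((height e ψ x)⁻¹ ^ 2 / 2) := by
        rw [setLIntegral_const]
    _ ≤ ∫⁻ z in Metric.ball x (θ / 2 * height e ψ x), avgKernel e ψ θ x z :=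
        setLIntegral_mono_ae' measurableSet_ball (Eventually.of_forall hsub)
    _ ≤ _ := setLIntegral_le_lintegral _ _

/-- The support lies in the ball about `x` of radius `2θ` times its height, and heights there are
comparable within a factor `3/2`: the constant is `4 * 9/4 = 9`. -/
theorem lintegral_avgKernel_le (hψ : LipschitzWith K ψ) {θ : ℝ} (hθ : 0 < θ)
    (hθK : (1 + K) * θ ≤ 1 / 2) (x : Plane) :
    ∫⁻ z, avgKernel e ψ θ x z ≤
      ENNReal.ofReal (9 * θ ^ 2) * volume (Metric.ball (0 : Plane) 1) := by
  have hsub : ∀ z, avgKernel e ψ θ x z ≤ (Metric.ball x (2 * θ * height e ψ x)).indicator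
      (fun _ => ENNReal.ofReal (9 / 4 * (height e ψ x)⁻¹ ^ 2)) z := by
    intro z
    by_cases hz : ‖x - z‖ < θ * height e ψ z ∧ 0 < height e ψ z
    · obtain ⟨h1, h2⟩ := height_bounds hψ hz.1
      have h3 : 1 / 2 * height e ψ z ≤ height e ψ x := by nlinarith [hz.2]
      have h4 : height e ψ x ≤ 3 / 2 * height e ψ z := by nlinarith [hz.2]
      have hx0 : 0 < height e ψ x := by linarith [hz.2]
      rw [avgKernel, Set.indicator_of_mem (by exact hz), Set.indicator_of_mem]
      · apply ENNReal.ofReal_le_ofReal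
        simp only
        have hz0 := hz.2
        rw [inv_pow, inv_pow, ← one_div, ← one_div, mul_one_div, div_le_div_iff₀ (by positivity)
          (by positivity)]
        nlinarith
      · rw [Metric.mem_ball, dist_eq_norm, norm_sub_rev]
        have := hz.1
        nlinarith
    · rw [avgKernel, Set.indicator_of_notMem (by exact hz)]
      exact zero_le
  refine (lintegral_mono hsub).trans ?_
  rw [lintegral_indicator measurableSet_ball, setLIntegral_const]
  by_cases hx : 0 < height e ψ x
  · rw [Measure.addHaar_ball _ _ (by positivity), ← mul_assoc,
      ← ENNReal.ofReal_mul (by positivity), finrank_euclideanSpace_fin]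
    refine le_of_eq ?_
    congr 2
    field_simp
    norm_num
  · rw [Metric.ball_eq_empty.2 (by nlinarith)]
    simp

end

section

variable {e : Plane ≃ₗᵢ[ℝ] Plane} {ψ : ℝ → ℝ} {K : ℝ≥0}

/-! ### From interior oscillation bounds to bounds up to a Lipschitz graph -/

theorem enorm_sub_sq_le (a b : ℝ) : ‖a - b‖ₑ ^ 2 ≤ 2 * (‖a‖ₑ ^ 2 + ‖b‖ₑ ^ 2) := by
  rw [Real.enorm_eq_ofReal_abs, Real.enorm_eq_ofReal_abs, Real.enorm_eq_ofReal_abs,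
    ← ENNReal.ofReal_pow (abs_nonneg _), ← ENNReal.ofReal_pow (abs_nonneg _),
    ← ENNReal.ofReal_pow (abs_nonneg _), sq_abs, sq_abs, sq_abs,
    ← ENNReal.ofReal_add (sq_nonneg _) (sq_nonneg _)]
  have : (2 : ℝ≥0∞) = ENNReal.ofReal 2 := by simp
  rw [this, ← ENNReal.ofReal_mul (by norm_num)]
  exact ENNReal.ofReal_le_ofReal (by nlinarith [sq_nonneg (a + b)])

/-- `g` has mean oscillation on balls controlled by the size of `E` on the concentric balls
with triple radius. -/
def OscillationBound (C : ℝ≥0) (g E : Plane → ℝ) : Prop :=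
  ∀ (z : Plane) (R : ℝ), 0 < R → ∃ c : ℝ,
    eLpNorm (fun x => g x - c) 2 (volume.restrict (Metric.ball z R)) ≤
      C * eLpNorm E 2 (volume.restrict (Metric.ball z (3 * R)))

/-- Both `x` and its stretched image lie in the ball of twice the radius, where `g` is close to one
constant. -/
theorem lintegral_ball_stretch_le (hψ : LipschitzWith K ψ) {θ : ℝ} (hθ : 0 < θ)
    (hθK : (1 + K) * θ ≤ 1 / 4) {C : ℝ≥0} {g E : Plane → ℝ} (hg : Continuous g)
    (h : OscillationBound C g E) {z : Plane} (hz : 0 < height e ψ z) :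
    ∫⁻ x in Metric.ball z (θ * height e ψ z), ‖g x - g (stretch e ψ (1 + θ / 2) x)‖ₑ ^ 2 ≤
      4 * C ^ 2 * ∫⁻ x in Metric.ball z (6 * θ * height e ψ z), ‖E x‖ₑ ^ 2 := by
  obtain ⟨c, hc⟩ := h z (2 * θ * height e ψ z) (by positivity)
  have hr : 3 * (2 * θ * height e ψ z) = 6 * θ * height e ψ z := by ring
  rw [hr, ← sq_le_sq_iff_ennreal, mul_pow, eLpNorm_two_sq, eLpNorm_two_sq] at hc
  set κ := 1 + θ / 2
  set B := Metric.ball z (θ * height e ψ z)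
  set B' := Metric.ball z (2 * θ * height e ψ z)
  have hBB : B ⊆ B' := Metric.ball_subset_ball (by nlinarith [mul_pos hθ hz])
  -- The stretch moves `x` by `θ/2` times its height, which is at most twice the height of `z`.
  have hBs : ∀ x ∈ B, stretch e ψ κ x ∈ B' := by
    intro x hx
    rw [Metric.mem_ball, dist_eq_norm] at hx ⊢
    have hb := height_bounds hψ hx
    have e1 : stretch e ψ κ x - z = (x - z) + ((κ - 1) * height e ψ x) • vertical e := by
      simp only [stretch]; abel
    have hx0 : 0 < height e ψ x := by nlinarith [hb.1]
    have hxz : height e ψ x ≤ 2 * height e ψ z := by nlinarith [hb.2]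
    rw [e1]
    refine (norm_add_le _ _).trans_lt ?_
    have hκ : κ - 1 = θ / 2 := by simp [κ]
    rw [norm_smul, norm_vertical, mul_one, Real.norm_of_nonneg (by rw [hκ]; positivity), hκ]
    nlinarith
  set F : Plane → ℝ≥0∞ := fun x => ‖g x - c‖ₑ ^ 2 with hF
  have hFm : Measurable F := (hg.sub continuous_const).measurable.enorm.pow_const 2
  have h1 : ∫⁻ x in B, F (stretch e ψ κ x) ≤ ∫⁻ x in B', F x := by
    rw [← lintegral_indicator measurableSet_ball, ← lintegral_indicator measurableSet_ball]
    calc ∫⁻ x, B.indicator (fun x => F (stretch e ψ κ x)) x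
        ≤ ∫⁻ x, B'.indicator F (stretch e ψ κ x) := by
          refine lintegral_mono fun x => ?_
          by_cases hx : x ∈ B
          · rw [Set.indicator_of_mem hx, Set.indicator_of_mem (hBs x hx)]
          · rw [Set.indicator_of_notMem hx]
            exact zero_le
      _ = ENNReal.ofReal κ⁻¹ * ∫⁻ x, B'.indicator F x :=
          lintegral_comp_stretch hψ (hFm.indicator measurableSet_ball) (by positivity)
      _ ≤ 1 * ∫⁻ x, B'.indicator F x := by
          gcongr
          rw [← ENNReal.ofReal_one]
          refine ENNReal.ofReal_le_ofReal (inv_le_one_of_one_le₀ ?_)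
          simp only [κ]; linarith
      _ = _ := one_mul _
  calc ∫⁻ x in B, ‖g x - g (stretch e ψ κ x)‖ₑ ^ 2
      ≤ ∫⁻ x in B, 2 * (F x + F (stretch e ψ κ x)) := by
        refine lintegral_mono fun x => ?_
        have := enorm_sub_sq_le (g x - c) (g (stretch e ψ κ x) - c)
        rwa [sub_sub_sub_cancel_right] at this
    _ = 2 * ((∫⁻ x in B, F x) + ∫⁻ x in B, F (stretch e ψ κ x)) := by
        have hm : Measurable fun x => F x + F (stretch e ψ κ x) :=
          hFm.add (hFm.comp (continuous_stretch hψ κ).measurable)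
        rw [lintegral_const_mul _ hm, lintegral_add_left hFm]
    _ ≤ 2 * ((∫⁻ x in B', F x) + ∫⁻ x in B', F x) := by
        gcongr
    _ = 4 * ∫⁻ x in B', F x := by ring
    _ ≤ 4 * (C ^ 2 * ∫⁻ x in Metric.ball z (6 * θ * height e ψ z), ‖E x‖ₑ ^ 2) := by gcongr
    _ = _ := by ring

/-- The part of a cylinder that lies above the graph of `ψ` at a height less than `H`. -/
def layer (e : Plane ≃ₗᵢ[ℝ] Plane) (ψ : ℝ → ℝ) (s₀ a H : ℝ) : Set Plane :=
  {x | |e x 0 - s₀| < a ∧ 0 < height e ψ x ∧ height e ψ x < H}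

theorem measurableSet_layer (hψ : LipschitzWith K ψ) (s₀ a H : ℝ) :
    MeasurableSet (layer e ψ s₀ a H) :=
  (measurableSet_lt ((continuous_coord 0).sub continuous_const).abs.measurable
    measurable_const).inter ((measurableSet_lt measurable_const (continuous_height hψ).measurable).inter
    (measurableSet_lt (continuous_height hψ).measurable measurable_const))

/-- The ball inequalities are integrated over all centres `z` with weight the inverse square of the
height, and Tonelli exchanges the integrals. This replaces a Whitney covering: both kernel integrals
are comparable to constants. The bound `1/12` lets `lintegral_avgKernel_le` be applied with `6 * θ`.
-/
theorem lintegral_layer_le (hψ : LipschitzWith K ψ) {s₀ a H : ℝ} (hH : 0 < H)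
    {Ω : Set Plane} (hΩm : MeasurableSet Ω) (hΩ : layer e ψ s₀ (2 * a) (4 * H) ⊆ Ω) {θ : ℝ}
    (hθ : 0 < θ) (hθK : (1 + K) * θ ≤ 1 / 12) (hθa : 10 * θ * H ≤ a) {M : ℝ≥0∞}
    {G F : Plane → ℝ≥0∞} (hGm : Measurable G) (hFm : Measurable F)
    (h : ∀ z, 0 < height e ψ z → ∫⁻ x in Metric.ball z (θ * height e ψ z), G x ≤
      M * ∫⁻ x in Metric.ball z (6 * θ * height e ψ z), F x) :
    ENNReal.ofReal (θ ^ 2 / 8) * volume (Metric.ball (0 : Plane) 1) *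
      ∫⁻ x in layer e ψ s₀ a H, G x ≤
    M * (ENNReal.ofReal (9 * (6 * θ) ^ 2) * volume (Metric.ball (0 : Plane) 1)) *
      ∫⁻ x in Ω, F x := by
  obtain ⟨D, hD⟩ : ∃ D, D = layer e ψ s₀ a H := ⟨_, rfl⟩
  have hDm : MeasurableSet D := hD ▸ measurableSet_layer hψ _ _ _
  have hGD : Measurable (D.indicator G) := hGm.indicator hDm
  have hFΩ : Measurable (Ω.indicator F) := hFm.indicator hΩm
  rw [← hD]
  have swap : ∀ {A : Plane → ℝ≥0∞} (_ : Measurable A) (θ : ℝ),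
      ∫⁻ x, ∫⁻ z, A x * avgKernel e ψ θ x z = ∫⁻ z, ∫⁻ x, A x * avgKernel e ψ θ x z :=
    fun hA θ => lintegral_lintegral_swap
      ((hA.comp measurable_fst).mul (measurable_avgKernel hψ θ)).aemeasurable
  have hk : ∀ (θ' : ℝ) (x : Plane), Measurable (avgKernel e ψ θ' x) := fun θ' x =>
    (measurable_avgKernel hψ θ').of_uncurry_left
  have pull : ∀ (A : Plane → ℝ≥0∞) (θ : ℝ),
      ∫⁻ x, ∫⁻ z, A x * avgKernel e ψ θ x z = ∫⁻ x, A x * ∫⁻ z, avgKernel e ψ θ x z :=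
    fun A θ' => by
      refine lintegral_congr fun x => ?_
      rw [lintegral_const_mul _ (hk θ' x)]
  have hz : ∀ z, ∫⁻ x, D.indicator G x * avgKernel e ψ θ x z ≤
      M * ∫⁻ x, Ω.indicator F x * avgKernel e ψ (6 * θ) x z := by
    intro z
    by_cases hz0 : 0 < height e ψ z
    swap
    · simp [avgKernel_eq_zero hz0]
    rw [lintegral_mul_avgKernel hGD hz0, lintegral_mul_avgKernel hFΩ hz0]
    by_cases hne : ∃ x ∈ D, x ∈ Metric.ball z (θ * height e ψ z)
    · obtain ⟨x, hxD, hxz⟩ := hne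
      -- If the small ball meets the layer, its centre has height at most `4/3 * H`. The six times
      -- larger ball then stays above the graph, below height `4 * H` and within the wider cylinder.
      have hsub : Metric.ball z (6 * θ * height e ψ z) ⊆ Ω := by
        intro y hy
        rw [Metric.mem_ball, dist_eq_norm] at hxz hy
        obtain ⟨b1, b2⟩ := height_bounds hψ hxz
        obtain ⟨b3, b4⟩ := height_bounds hψ hy
        rw [hD] at hxD
        obtain ⟨d1, d2, d3⟩ := hxD
        have hzH : height e ψ z ≤ 4 / 3 * H := by nlinarith
        have hy0 : 0 < height e ψ y := by nlinarith
        have hyH : height e ψ y < 4 * H := by nlinarith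
        refine hΩ ⟨?_, hy0, hyH⟩
        have c1 := (abs_coord_sub_le (e := e) x z 0)
        have c2 := (abs_coord_sub_le (e := e) y z 0)
        have hθz : θ * height e ψ z ≤ 4 / 3 * (θ * H) := by nlinarith
        rw [abs_lt] at d1 ⊢
        have c1' := abs_le.1 (c1.trans hxz.le)
        have c2' := abs_le.1 (c2.trans hy.le)
        constructor <;> nlinarith [c1'.1, c1'.2, c2'.1, c2'.2, d1.1, d1.2, mul_pos hθ hH]
      calc ENNReal.ofReal ((height e ψ z)⁻¹ ^ 2) *
            ∫⁻ x in Metric.ball z (θ * height e ψ z), D.indicator G x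
          ≤ ENNReal.ofReal ((height e ψ z)⁻¹ ^ 2) *
            ∫⁻ x in Metric.ball z (θ * height e ψ z), G x := by
            gcongr
            exact Set.indicator_le_self _ _ _
        _ ≤ ENNReal.ofReal ((height e ψ z)⁻¹ ^ 2) *
            (M * ∫⁻ x in Metric.ball z (6 * θ * height e ψ z), F x) := by
            gcongr
            exact h z hz0
        _ = ENNReal.ofReal ((height e ψ z)⁻¹ ^ 2) *
            (M * ∫⁻ x in Metric.ball z (6 * θ * height e ψ z), Ω.indicator F x) := by
            congr 2
            refine setLIntegral_congr_fun measurableSet_ball fun x hx => ?_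
            rw [Set.indicator_of_mem (hsub hx)]
        _ = _ := by ring
    · have : ∫⁻ x in Metric.ball z (θ * height e ψ z), D.indicator G x = 0 := by
        rw [setLIntegral_congr_fun (g := fun _ => 0) measurableSet_ball]
        · simp
        · intro x hx
          exact Set.indicator_of_notMem (fun hD => hne ⟨x, hD, hx⟩) _
      rw [this, mul_zero]
      exact zero_le
  calc ENNReal.ofReal (θ ^ 2 / 8) * volume (Metric.ball (0 : Plane) 1) * ∫⁻ x in D, G x
      = ∫⁻ x, D.indicator G x *
          (ENNReal.ofReal (θ ^ 2 / 8) * volume (Metric.ball (0 : Plane) 1)) := by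
        rw [lintegral_mul_const _ hGD, lintegral_indicator hDm, mul_comm]
    _ ≤ ∫⁻ x, D.indicator G x * ∫⁻ z, avgKernel e ψ θ x z := by
        refine lintegral_mono fun x => ?_
        by_cases hx : x ∈ D
        · exact mul_le_mul' le_rfl (le_lintegral_avgKernel hψ hθ (by linarith) (hD.subset hx).2.1)
        · simp [hx]
    _ = ∫⁻ z, ∫⁻ x, D.indicator G x * avgKernel e ψ θ x z := by rw [← pull, swap hGD]
    _ ≤ ∫⁻ z, M * ∫⁻ x, Ω.indicator F x * avgKernel e ψ (6 * θ) x z := lintegral_mono hz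
    _ = M * ∫⁻ z, ∫⁻ x, Ω.indicator F x * avgKernel e ψ (6 * θ) x z := by
        rw [lintegral_const_mul]
        exact Measurable.lintegral_prod_left'
          (f := fun p : Plane × Plane => Ω.indicator F p.1 * avgKernel e ψ (6 * θ) p.1 p.2)
          ((hFΩ.comp measurable_fst).mul (measurable_avgKernel hψ (6 * θ)))
    _ = M * ∫⁻ x, Ω.indicator F x * ∫⁻ z, avgKernel e ψ (6 * θ) x z := by
        rw [← swap hFΩ, pull]
    _ ≤ M * ∫⁻ x, Ω.indicator F x *
        (ENNReal.ofReal (9 * (6 * θ) ^ 2) * volume (Metric.ball (0 : Plane) 1)) := by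
        gcongr with x
        exact lintegral_avgKernel_le hψ (by positivity) (by linarith) x
    _ = M * (ENNReal.ofReal (9 * (6 * θ) ^ 2) * volume (Metric.ball (0 : Plane) 1)) *
        ∫⁻ x in Ω, F x := by
        rw [lintegral_mul_const _ hFΩ, lintegral_indicator hΩm]
        ring

/-- Absorption of `N` into the left-hand side, legitimate because `N` is finite. -/
theorem le_of_le_add_mul {N X Y : ℝ≥0∞} {θ : ℝ≥0} (hθ : θ < 1) (hN : N ≠ ⊤)
    (h : N ≤ X + θ * (N + Y)) : N ≤ ((1 - θ)⁻¹ : ℝ≥0) * (X + Y) := by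
  have h1 : (1 - θ : ℝ≥0) * N ≤ X + Y := by
    have e1 : ((1 - θ : ℝ≥0) : ℝ≥0∞) * N + θ * N = N := by
      rw [← add_mul, ← ENNReal.coe_add, tsub_add_cancel_of_le hθ.le, ENNReal.coe_one, one_mul]
    have h2 : ((1 - θ : ℝ≥0) : ℝ≥0∞) * N + θ * N ≤ (X + Y) + θ * N := by
      rw [e1]
      refine h.trans ?_
      rw [mul_add, ← add_assoc, add_right_comm]
      gcongr
      exact mul_le_of_le_one_left (zero_le) (by exact_mod_cast hθ.le)
    exact (ENNReal.add_le_add_iff_right (ENNReal.mul_ne_top ENNReal.coe_ne_top hN)).1 h2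
  have h0 : (1 - θ : ℝ≥0) ≠ 0 := (tsub_pos_of_lt hθ).ne'
  calc N = ((1 - θ)⁻¹ : ℝ≥0) * ((1 - θ : ℝ≥0) * N) := by
        rw [← mul_assoc, ← ENNReal.coe_mul, inv_mul_cancel₀ h0, ENNReal.coe_one, one_mul]
    _ ≤ _ := by gcongr

theorem isBounded_layer (hψ : LipschitzWith K ψ) (s₀ a H : ℝ) :
    Bornology.IsBounded (layer e ψ s₀ a H) := by
  have hc : IsCompact (graphPoint e ψ '' (Set.Icc (s₀ - a) (s₀ + a) ×ˢ Set.Icc 0 H)) :=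
    (isCompact_Icc.prod isCompact_Icc).image (continuous_graphPoint hψ)
  refine hc.isBounded.subset fun x hx => ⟨(e x 0, height e ψ x), ?_, graphPoint_coord_height x⟩
  obtain ⟨h1, h2, h3⟩ := hx
  rw [abs_lt] at h1
  exact ⟨⟨by linarith, by linarith⟩, h2.le, h3.le⟩

theorem eLpNorm_ne_top_of_isBounded {f : Plane → ℝ} (hf : Continuous f) {S : Set Plane}
    (hS : Bornology.IsBounded S) : eLpNorm f 2 (volume.restrict S) ≠ ⊤ := by
  have hc : IsCompact (closure S) := hS.isCompact_closure
  have : MemLp f 2 (volume.restrict (closure S)) := by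
    obtain ⟨M, hM⟩ := hc.exists_bound_of_continuousOn hf.continuousOn
    have : IsFiniteMeasure (volume.restrict (closure S)) := ⟨by simpa using hc.measure_lt_top⟩
    exact MemLp.of_bound hf.aestronglyMeasurable M
      (ae_restrict_of_forall_mem hc.measurableSet hM)
  exact ne_top_of_le_ne_top this.eLpNorm_ne_top
    (eLpNorm_mono_measure _ (Measure.restrict_mono subset_closure le_rfl))

/-- Write `g` as `(g - g ∘ stretch) + g ∘ stretch`. The first part is controlled by `E`. The second
is a strict contraction of the norm of `g` on the layer together with the strip just above it,
because the stretch multiplies area by `κ > 1`. Absorbing leaves only the strip, which stays away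
from the boundary. -/
theorem eLpNorm_layer_le (hψ : LipschitzWith K ψ) {s₀ a H : ℝ} (ha : 0 < a) (hH : 0 < H)
    {Ω : Set Plane} (hΩm : MeasurableSet Ω) (hΩ : layer e ψ s₀ (2 * a) (4 * H) ⊆ Ω) (C : ℝ≥0) :
    ∃ C' : ℝ≥0, ∀ g E : Plane → ℝ, Continuous g → Continuous E → OscillationBound C g E →
      eLpNorm g 2 (volume.restrict (layer e ψ s₀ a H)) ≤ C' *
        (eLpNorm E 2 (volume.restrict Ω) + eLpNorm g 2 (volume.restrict
          {x | |e x 0 - s₀| < a ∧ H ≤ height e ψ x ∧ height e ψ x < 2 * H})) := by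
  set θ : ℝ := min (1 / (12 * (1 + K))) (a / (10 * H)) with hθ_def
  have hθ : 0 < θ := lt_min (by positivity) (by positivity)
  have hθK : (1 + K) * θ ≤ 1 / 12 := by
    have := min_le_left (1 / (12 * (1 + (K : ℝ)))) (a / (10 * H))
    rw [← hθ_def, le_div_iff₀ (by positivity)] at this
    linarith
  have hθa : 10 * θ * H ≤ a := by
    have := min_le_right (1 / (12 * (1 + (K : ℝ)))) (a / (10 * H))
    rw [← hθ_def, le_div_iff₀ (by positivity)] at this
    linarith
  set κ : ℝ := 1 + θ / 2 with hκ_def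
  have hκ1 : 1 < κ := by rw [hκ_def]; linarith
  have hκ2 : κ < 2 := by
    have : θ ≤ (1 + K) * θ := le_mul_of_one_le_left hθ.le (by simp)
    rw [hκ_def]; linarith
  set v := volume (Metric.ball (0 : Plane) 1)
  have hv0 : v ≠ 0 := (Metric.measure_ball_pos _ _ one_pos).ne'
  have hvt : v ≠ ⊤ := measure_ball_lt_top.ne
  set c0 := ENNReal.ofReal (θ ^ 2 / 8) * v with hc0
  have hc00 : c0 ≠ 0 := mul_ne_zero (by simp; positivity) hv0
  have hc0t : c0 ≠ ⊤ := ENNReal.mul_ne_top ENNReal.ofReal_ne_top hvt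
  set c1 := 4 * (C : ℝ≥0∞) ^ 2 * (ENNReal.ofReal (9 * (6 * θ) ^ 2) * v) with hc1
  have hc1t : c1 ≠ ⊤ := ENNReal.mul_ne_top (ENNReal.mul_ne_top (by simp) (by simp))
    (ENNReal.mul_ne_top ENNReal.ofReal_ne_top hvt)
  -- `x + 1` serves, since `x ≤ (x + 1)²`.
  obtain ⟨A, hA⟩ : ∃ A : ℝ≥0, c0⁻¹ * c1 ≤ (A : ℝ≥0∞) ^ 2 := by
    refine ⟨(c0⁻¹ * c1).toNNReal + 1, ?_⟩
    have ht : c0⁻¹ * c1 ≠ ⊤ := ENNReal.mul_ne_top (ENNReal.inv_ne_top.2 hc00) hc1t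
    calc c0⁻¹ * c1 = ((c0⁻¹ * c1).toNNReal : ℝ≥0∞) := (ENNReal.coe_toNNReal ht).symm
      _ ≤ _ := by
        rw [← ENNReal.coe_pow]
        refine ENNReal.coe_le_coe.2 ?_
        nlinarith [sq_nonneg (c0⁻¹ * c1).toNNReal, zero_le (a := (c0⁻¹ * c1).toNNReal)]
  -- The contraction factor is the square root of the inverse Jacobian of the stretch.
  set q : ℝ≥0 := NNReal.sqrt (Real.toNNReal κ⁻¹) with hq
  have hq1 : q < 1 := by
    rw [hq, ← NNReal.sqrt_one, NNReal.sqrt_lt_sqrt, Real.toNNReal_lt_one]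
    exact inv_lt_one_of_one_lt₀ hκ1
  have hqsq : (q : ℝ≥0∞) ^ 2 = ENNReal.ofReal κ⁻¹ := by
    rw [← ENNReal.coe_pow, hq, NNReal.sq_sqrt]
    rfl
  refine ⟨(1 - q)⁻¹ * (A + 1), fun g E hg hE h => ?_⟩
  set D := layer e ψ s₀ a H with hD
  set S := {x | |e x 0 - s₀| < a ∧ H ≤ height e ψ x ∧ height e ψ x < 2 * H} with hS
  set N := eLpNorm g 2 (volume.restrict D)
  have hNt : N ≠ ⊤ := eLpNorm_ne_top_of_isBounded hg (isBounded_layer hψ _ _ _)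
  set Y := eLpNorm g 2 (volume.restrict S) with hY
  have hgs := hg.comp (continuous_stretch hψ (e := e) κ)
  have h1 : eLpNorm (fun x => g x - g (stretch e ψ κ x)) 2 (volume.restrict D) ≤
      A * eLpNorm E 2 (volume.restrict Ω) := by
    rw [← sq_le_sq_iff_ennreal, mul_pow, eLpNorm_two_sq, eLpNorm_two_sq]
    have : c0 * ∫⁻ x in D, ‖g x - g (stretch e ψ κ x)‖ₑ ^ 2 ≤ c1 * ∫⁻ x in Ω, ‖E x‖ₑ ^ 2 :=
      lintegral_layer_le hψ hH hΩm hΩ hθ hθK hθa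
      ((hg.sub hgs).measurable.enorm.pow_const 2) (hE.measurable.enorm.pow_const 2)
      fun z hz => lintegral_ball_stretch_le hψ hθ (by linarith) hg h hz
    calc _ = c0⁻¹ * (c0 * ∫⁻ x in D, ‖g x - g (stretch e ψ κ x)‖ₑ ^ 2) := by
          rw [← mul_assoc, ENNReal.inv_mul_cancel hc00 hc0t, one_mul]
      _ ≤ c0⁻¹ * (c1 * ∫⁻ x in Ω, ‖E x‖ₑ ^ 2) := by gcongr
      _ ≤ _ := by rw [← mul_assoc]; gcongr
  -- Since `κ < 2`, a point of height below `H` is sent to a height below `2 * H`, so the image lies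
  -- in `D ∪ S`.
  have h2 : eLpNorm (fun x => g (stretch e ψ κ x)) 2 (volume.restrict D) ≤ q * (N + Y) := by
    have h3 : eLpNorm (fun x => g (stretch e ψ κ x)) 2 (volume.restrict D) ≤
        q * eLpNorm g 2 (volume.restrict (D ∪ S)) := by
      have hSm : MeasurableSet S := (measurableSet_lt
        ((continuous_coord 0).sub continuous_const).abs.measurable measurable_const).inter
        ((measurableSet_le measurable_const (continuous_height hψ).measurable).inter
        (measurableSet_lt (continuous_height hψ).measurable measurable_const))
      have hDm : MeasurableSet D := measurableSet_layer hψ _ _ _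
      rw [← sq_le_sq_iff_ennreal, mul_pow, eLpNorm_two_sq, eLpNorm_two_sq, hqsq,
        ← lintegral_indicator hDm, ← lintegral_indicator (hDm.union hSm),
        ← lintegral_comp_stretch (e := e) hψ
          ((hg.measurable.enorm.pow_const 2).indicator (hDm.union hSm)) (by positivity)]
      refine lintegral_mono fun x => ?_
      by_cases hx : x ∈ D
      · rw [Set.indicator_of_mem hx, Set.indicator_of_mem]
        obtain ⟨d1, d2, d3⟩ := hx
        rcases lt_or_ge (height e ψ (stretch e ψ κ x)) H with hlt | hge
        · left
          refine ⟨by rwa [coord_stretch], ?_, hlt⟩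
          rw [height_stretch]; positivity
        · right
          refine ⟨by rwa [coord_stretch], hge, ?_⟩
          rw [height_stretch]; nlinarith
      · rw [Set.indicator_of_notMem hx]
        exact zero_le
    refine h3.trans ?_
    gcongr
    rw [← sq_le_sq_iff_ennreal, eLpNorm_two_sq]
    refine (lintegral_union_le _ _ _).trans ?_
    rw [← eLpNorm_two_sq, ← eLpNorm_two_sq, add_sq]
    exact add_le_add le_self_add le_rfl
  have h3 : N ≤ A * eLpNorm E 2 (volume.restrict Ω) + q * (N + Y) := by
    have e1 : g = (fun x => g x - g (stretch e ψ κ x)) + fun x => g (stretch e ψ κ x) := by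
      funext x; simp
    calc N = eLpNorm ((fun x => g x - g (stretch e ψ κ x)) + fun x => g (stretch e ψ κ x)) 2
          (volume.restrict D) := by rw [← e1]
      _ ≤ _ := (eLpNorm_add_le (hg.sub hgs).aestronglyMeasurable hgs.aestronglyMeasurable
          one_le_two).trans (add_le_add h1 h2)
  refine (le_of_le_add_mul hq1 hNt h3).trans ?_
  rw [ENNReal.coe_mul, mul_assoc]
  gcongr
  rw [mul_add]
  gcongr
  · exact le_self_add
  · exact le_mul_of_one_le_left zero_le (by simp)

end

section

variable {e : Plane ≃ₗᵢ[ℝ] Plane} {ψ : ℝ → ℝ} {K : ℝ≥0}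

/-! ### Vertical estimates and traces on a Lipschitz graph -/

/-- The sum of the absolute values of the partial derivatives. -/
def gradDensity (f : Plane → ℝ) (x : Plane) : ℝ := ∑ j, |partialDeriv j f x|

theorem continuous_gradDensity {f : Plane → ℝ} (hf : IsSmooth f) : Continuous (gradDensity f) :=
  continuous_finsetSum _ fun j _ => (hf.partialDeriv j).continuous.abs

theorem gradDensity_nonneg (f : Plane → ℝ) (x : Plane) : 0 ≤ gradDensity f x :=
  Finset.sum_nonneg fun _ _ => abs_nonneg _

theorem fderiv_eq_sum (f : Plane → ℝ) (x v : Plane) :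
    fderiv ℝ f x v = ∑ j, v j * partialDeriv j f x := by
  have hv : v = ∑ j, v j • (EuclideanSpace.single j (1 : ℝ) : Plane) := by
    ext i
    fin_cases i <;> simp
  conv_lhs => rw [hv]
  simp [partialDeriv]

theorem abs_fderiv_vertical_le (f : Plane → ℝ) (x : Plane) :
    |fderiv ℝ f x (vertical e)| ≤ gradDensity f x := by
  rw [fderiv_eq_sum]
  refine (Finset.abs_sum_le_sum_abs _ _).trans (Finset.sum_le_sum fun j _ => ?_)
  rw [abs_mul]
  refine mul_le_of_le_one_left (abs_nonneg _) ?_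
  exact (PiLp.norm_apply_le (vertical e) j).trans norm_vertical.le

theorem hasDerivAt_graphPoint {f : Plane → ℝ} (hf : IsSmooth f) (s t : ℝ) :
    HasDerivAt (fun t => f (graphPoint e ψ (s, t)))
      (fderiv ℝ f (graphPoint e ψ (s, t)) (vertical e)) t := by
  have e1 : (fun t : ℝ => graphPoint e ψ (s, t)) =
      fun t => graphPoint e ψ (s, 0) + t • vertical e := by
    funext t
    rw [graphPoint_add_vertical, zero_add]
  have h1 : HasDerivAt (fun t : ℝ => graphPoint e ψ (s, t)) (vertical e) t := by
    rw [e1]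
    simpa using ((hasDerivAt_id t).smul_const (vertical e)).const_add (graphPoint e ψ (s, 0))
  exact (hf.differentiable _).hasFDerivAt.comp_hasDerivAt t h1

/-- Fundamental theorem of calculus and Cauchy–Schwarz. Everything below about vertical segments
rests on this. -/
theorem enorm_sq_le_of_hasDerivAt {f f' : ℝ → ℝ} (hf : ∀ t, HasDerivAt f (f' t) t)
    (hf' : Continuous f') {L t u : ℝ} (ht : t ∈ Set.Icc 0 L) (hu : u ∈ Set.Icc 0 L) :
    ‖f t‖ₑ ^ 2 ≤ 2 * ‖f u‖ₑ ^ 2 +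
      ENNReal.ofReal (2 * L) * ∫⁻ τ in Set.Ioo 0 L, ‖f' τ‖ₑ ^ 2 := by
  have hL : 0 ≤ L := ht.1.trans ht.2
  have h1 : f t - f u = ∫ τ in u..t, f' τ :=
    (intervalIntegral.integral_eq_sub_of_hasDerivAt (fun x _ => hf x)
      (hf'.intervalIntegrable _ _)).symm
  have h2 : ‖f u - f t‖ₑ ^ 2 ≤ ENNReal.ofReal L * ∫⁻ τ in Set.Ioo 0 L, ‖f' τ‖ₑ ^ 2 := by
    have h3 : ‖f u - f t‖ₑ ≤ ∫⁻ τ in Set.Ioo 0 L, ‖f' τ‖ₑ := by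
      rw [← enorm_neg, neg_sub, h1, intervalIntegral.intervalIntegral_eq_integral_uIoc, enorm_smul]
      have : ‖(if u ≤ t then (1 : ℝ) else -1)‖ₑ = 1 := by split_ifs <;> simp
      rw [this, one_mul]
      refine (enorm_integral_le_lintegral_enorm _).trans ?_
      rw [restrict_Ioo_eq_restrict_Ioc]
      refine lintegral_mono_set fun τ hτ => ?_
      rw [Set.uIoc, Set.mem_Ioc] at hτ
      exact ⟨lt_of_le_of_lt (le_min hu.1 ht.1) hτ.1, hτ.2.trans (max_le hu.2 ht.2)⟩
    have h4 := ENNReal.lintegral_mul_le_Lp_mul_Lq (volume.restrict (Set.Ioo 0 L))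
      Real.HolderConjugate.two_two (f := fun τ => ‖f' τ‖ₑ) (g := fun _ => 1)
      hf'.measurable.enorm.aemeasurable aemeasurable_const
    simp only [Pi.mul_apply, mul_one, ENNReal.one_rpow, lintegral_const, one_mul,
      Measure.restrict_apply MeasurableSet.univ, Set.univ_inter, Real.volume_Ioo, sub_zero] at h4
    have h5 := pow_le_pow_left₀ zero_le (h3.trans h4) 2
    refine h5.trans (le_of_eq ?_)
    rw [mul_pow, ← ENNReal.rpow_natCast, ← ENNReal.rpow_natCast, ← ENNReal.rpow_mul,
      ← ENNReal.rpow_mul]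
    norm_num
    rw [mul_comm]
  have h6 := enorm_sub_sq_le (f u) (f u - f t)
  rw [sub_sub_cancel] at h6
  refine h6.trans ?_
  rw [mul_add]
  refine add_le_add le_rfl ?_
  calc 2 * ‖f u - f t‖ₑ ^ 2 ≤ 2 * (ENNReal.ofReal L * ∫⁻ τ in Set.Ioo 0 L, ‖f' τ‖ₑ ^ 2) := by gcongr
    _ = _ := by
      rw [ENNReal.ofReal_mul (by norm_num), mul_assoc]
      simp

/-- The points of a cylinder whose height above the graph of `ψ` lies in `J`. -/
def band (e : Plane ≃ₗᵢ[ℝ] Plane) (ψ : ℝ → ℝ) (s₀ a : ℝ) (J : Set ℝ) : Set Plane :=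
  {x | |e x 0 - s₀| < a ∧ height e ψ x ∈ J}

theorem measurableSet_band (hψ : LipschitzWith K ψ) (s₀ a : ℝ) {J : Set ℝ}
    (hJ : MeasurableSet J) : MeasurableSet (band e ψ s₀ a J) :=
  (measurableSet_lt ((continuous_coord 0).sub continuous_const).abs.measurable
    measurable_const).inter ((continuous_height hψ).measurable hJ)

theorem layer_eq_band (s₀ a H : ℝ) : layer e ψ s₀ a H = band e ψ s₀ a (Set.Ioo 0 H) := rfl

theorem lintegral_band (hψ : LipschitzWith K ψ) (s₀ a : ℝ) {J : Set ℝ} (hJ : MeasurableSet J)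
    {F : Plane → ℝ≥0∞} (hF : Measurable F) :
    ∫⁻ x in band e ψ s₀ a J, F x =
      ∫⁻ s in {s | |s - s₀| < a}, ∫⁻ t in J, F (graphPoint e ψ (s, t)) := by
  have hm := measurableSet_band (e := e) hψ s₀ a hJ
  have hI : MeasurableSet {s : ℝ | |s - s₀| < a} :=
    measurableSet_lt (by fun_prop) measurable_const
  rw [← lintegral_indicator hm, lintegral_graphPoint (e := e) (ψ := ψ) (hF.indicator hm),
    ← lintegral_indicator hI]
  refine lintegral_congr fun s => ?_
  by_cases hs : |s - s₀| < a
  · rw [Set.indicator_of_mem (by exact hs), ← lintegral_indicator hJ]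
    refine lintegral_congr fun t => ?_
    by_cases ht : t ∈ J
    · rw [Set.indicator_of_mem ht, Set.indicator_of_mem]
      exact ⟨by rwa [coord_graphPoint], by rwa [height_graphPoint]⟩
    · rw [Set.indicator_of_notMem ht, Set.indicator_of_notMem]
      exact fun h => ht (by have := h.2; rwa [height_graphPoint] at this)
  · rw [Set.indicator_of_notMem (by exact hs)]
    refine (lintegral_congr fun t => ?_).trans lintegral_zero
    refine Set.indicator_of_notMem (fun h => hs ?_) _
    have := h.1
    rwa [coord_graphPoint] at this

theorem measurable_comp_graphPoint (hψ : LipschitzWith K ψ) {F : Plane → ℝ≥0∞}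
    (hF : Measurable F) (s : ℝ) : Measurable fun t => F (graphPoint e ψ (s, t)) :=
  hF.comp ((continuous_graphPoint hψ).comp
    (Continuous.prodMk continuous_const continuous_id)).measurable

theorem enorm_graphPoint_sq_le (hψ : LipschitzWith K ψ) {f : Plane → ℝ} (hf : IsSmooth f)
    {L t u : ℝ} (ht : t ∈ Set.Icc 0 L) (hu : u ∈ Set.Icc 0 L) (s : ℝ) :
    ‖f (graphPoint e ψ (s, t))‖ₑ ^ 2 ≤ 2 * ‖f (graphPoint e ψ (s, u))‖ₑ ^ 2 +
      ENNReal.ofReal (2 * L) *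
        ∫⁻ τ in Set.Ioo 0 L, ‖gradDensity f (graphPoint e ψ (s, τ))‖ₑ ^ 2 := by
  have hc : Continuous fun τ => fderiv ℝ f (graphPoint e ψ (s, τ)) (vertical e) :=
    ((hf.continuous_fderiv (by simp)).comp ((continuous_graphPoint hψ).comp
      (Continuous.prodMk continuous_const continuous_id))).clm_apply continuous_const
  refine (enorm_sq_le_of_hasDerivAt (fun τ => hasDerivAt_graphPoint hf s τ) hc ht hu).trans ?_
  gcongr with τ
  rw [Real.enorm_eq_ofReal_abs, Real.enorm_eq_ofReal_abs, abs_of_nonneg (gradDensity_nonneg f _)]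
  exact ENNReal.ofReal_le_ofReal (abs_fderiv_vertical_le _ _)

/-- The value at height `t` is compared with the value at height `t + H` on the same vertical line,
and the result is integrated over `t`. -/
theorem lintegral_layer_sq_le (hψ : LipschitzWith K ψ) {s₀ a H : ℝ} (hH : 0 < H)
    {f : Plane → ℝ} (hf : IsSmooth f) :
    ∫⁻ x in layer e ψ s₀ a H, ‖f x‖ₑ ^ 2 ≤
      2 * (∫⁻ x in band e ψ s₀ a (Set.Ioo H (2 * H)), ‖f x‖ₑ ^ 2) +
      ENNReal.ofReal (4 * H ^ 2) * ∫⁻ x in layer e ψ s₀ a (2 * H), ‖gradDensity f x‖ₑ ^ 2 := by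
  have hF : Measurable fun x => ‖f x‖ₑ ^ 2 := hf.continuous.measurable.enorm.pow_const 2
  have hP : Measurable fun x => ‖gradDensity f x‖ₑ ^ 2 :=
    (continuous_gradDensity hf).measurable.enorm.pow_const 2
  rw [layer_eq_band, layer_eq_band, lintegral_band hψ _ _ measurableSet_Ioo hF,
    lintegral_band hψ _ _ measurableSet_Ioo hF, lintegral_band hψ _ _ measurableSet_Ioo hP]
  have hm : ∀ (J : Set ℝ) {F : Plane → ℝ≥0∞}, Measurable F →
      Measurable fun s => ∫⁻ t in J, F (graphPoint e ψ (s, t)) := fun J F hF =>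
    (hF.comp (continuous_graphPoint hψ).measurable).lintegral_prod_right'
  rw [← lintegral_const_mul _ (hm _ hF), ← lintegral_const_mul _ (hm _ hP),
    ← lintegral_add_left ((hm _ hF).const_mul 2)]
  refine lintegral_mono fun s => ?_
  have hs := measurable_comp_graphPoint (e := e) hψ hF s
  set A := ∫⁻ t in Set.Ioo 0 (2 * H), ‖gradDensity f (graphPoint e ψ (s, t))‖ₑ ^ 2
  calc ∫⁻ t in Set.Ioo 0 H, ‖f (graphPoint e ψ (s, t))‖ₑ ^ 2
      ≤ ∫⁻ t in Set.Ioo 0 H, (2 * ‖f (graphPoint e ψ (s, t + H))‖ₑ ^ 2 +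
          ENNReal.ofReal (2 * (2 * H)) * A) := by
        refine setLIntegral_mono_ae' measurableSet_Ioo (Eventually.of_forall fun t ht => ?_)
        exact enorm_graphPoint_sq_le hψ hf ⟨ht.1.le, by linarith [ht.2]⟩
          ⟨by linarith [ht.1], by linarith [ht.2]⟩ s
    _ = 2 * (∫⁻ t in Set.Ioo 0 H, ‖f (graphPoint e ψ (s, t + H))‖ₑ ^ 2) +
          ENNReal.ofReal (4 * H ^ 2) * A := by
        have hs' : Measurable fun t => ‖f (graphPoint e ψ (s, t + H))‖ₑ ^ 2 :=
          hs.comp (measurable_id.add_const H)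
        rw [lintegral_add_left (hs'.const_mul 2), lintegral_const_mul _ hs', setLIntegral_const,
          Real.volume_Ioo, sub_zero, mul_right_comm, ← ENNReal.ofReal_mul (by positivity)]
        congr 3
        ring
    _ = _ := by
        congr 2
        rw [← lintegral_indicator measurableSet_Ioo, ← lintegral_indicator measurableSet_Ioo,
          ← lintegral_add_right_eq_self ((Set.Ioo H (2 * H)).indicator fun t =>
            ‖f (graphPoint e ψ (s, t))‖ₑ ^ 2) H]
        refine lintegral_congr fun t => ?_
        have : t + H ∈ Set.Ioo H (2 * H) ↔ t ∈ Set.Ioo 0 H := by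
          simp only [Set.mem_Ioo]; constructor <;> rintro ⟨h1, h2⟩ <;> constructor <;> linarith
        by_cases ht : t ∈ Set.Ioo 0 H
        · rw [Set.indicator_of_mem ht, Set.indicator_of_mem (this.2 ht)]
        · rw [Set.indicator_of_notMem ht, Set.indicator_of_notMem (fun h => ht (this.1 h))]

theorem lipschitzWith_graphPoint (hψ : LipschitzWith K ψ) :
    LipschitzWith (1 + K) fun s => graphPoint e ψ (s, 0) := by
  refine LipschitzWith.of_dist_le_mul fun s t => ?_
  have h1 := hψ.dist_le_mul s t
  rw [graphPoint, graphPoint, e.symm.dist_map, EuclideanSpace.dist_eq, Fin.sum_univ_two]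
  simp only [point_zero, point_one, add_zero]
  rw [Real.sqrt_le_left (by positivity)]
  rw [NNReal.coe_add, NNReal.coe_one]
  have h2 : 0 ≤ dist s t := dist_nonneg
  have h3 : 0 ≤ dist (ψ s) (ψ t) := dist_nonneg
  have : (K : ℝ) * dist s t * dist s t ≥ 0 := by positivity
  nlinarith

/-- The graph is a Lipschitz image of an interval, and Lipschitz maps enlarge one-dimensional
Hausdorff measure by at most their constant. -/
theorem lintegral_graph_le (hψ : LipschitzWith K ψ) (s₀ a : ℝ) {F : Plane → ℝ≥0∞}
    (hF : Measurable F) :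
    ∫⁻ x in band e ψ s₀ a {0}, F x ∂(Measure.hausdorffMeasure 1) ≤
      (1 + K : ℝ≥0) * ∫⁻ s in {s | |s - s₀| < a}, F (graphPoint e ψ (s, 0)) := by
  have hl := lipschitzWith_graphPoint (e := e) hψ
  set c : ℝ → Plane := fun s => graphPoint e ψ (s, 0) with hc
  have hI : MeasurableSet {s : ℝ | |s - s₀| < a} :=
    measurableSet_lt (by fun_prop) measurable_const
  have hle : (Measure.hausdorffMeasure 1 : Measure Plane).restrict (band e ψ s₀ a {0}) ≤
      ((1 + K : ℝ≥0) : ℝ≥0∞) • ((volume.restrict {s : ℝ | |s - s₀| < a}).map c) := by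
    refine Measure.le_iff.2 fun A hA => ?_
    rw [Measure.restrict_apply hA, Measure.smul_apply,
      Measure.map_apply hl.continuous.measurable hA,
      Measure.restrict_apply (hl.continuous.measurable hA)]
    have h1 : A ∩ band e ψ s₀ a {0} ⊆ c '' (c ⁻¹' A ∩ {s | |s - s₀| < a}) := by
      rintro x ⟨hx, hx1, hx2⟩
      have e1 : c (e x 0) = x := by
        rw [Set.mem_singleton_iff] at hx2
        have := graphPoint_coord_height (e := e) (ψ := ψ) x
        rwa [hx2] at this
      exact ⟨e x 0, ⟨by rwa [Set.mem_preimage, e1], hx1⟩, e1⟩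
    refine (measure_mono h1).trans ((hl.hausdorffMeasure_image_le zero_le_one _).trans ?_)
    rw [ENNReal.rpow_one, hausdorffMeasure_real, smul_eq_mul]
  refine (lintegral_mono' hle le_rfl).trans ?_
  rw [lintegral_smul_measure, smul_eq_mul, lintegral_map hF hl.continuous.measurable]

/-- The boundary value is compared with the value at each height below `H`, and the comparison is
averaged over these heights. -/
theorem lintegral_graph_sq_le (hψ : LipschitzWith K ψ) {s₀ a H : ℝ} (hH : 0 < H)
    {f : Plane → ℝ} (hf : IsSmooth f) :
    ∫⁻ x in band e ψ s₀ a {0}, ‖f x‖ₑ ^ 2 ∂(Measure.hausdorffMeasure 1) ≤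
      (1 + K : ℝ≥0) * (ENNReal.ofReal (2 / H) * (∫⁻ x in layer e ψ s₀ a H, ‖f x‖ₑ ^ 2) +
      ENNReal.ofReal (2 * H) * ∫⁻ x in layer e ψ s₀ a H, ‖gradDensity f x‖ₑ ^ 2) := by
  have hF : Measurable fun x => ‖f x‖ₑ ^ 2 := hf.continuous.measurable.enorm.pow_const 2
  have hP : Measurable fun x => ‖gradDensity f x‖ₑ ^ 2 :=
    (continuous_gradDensity hf).measurable.enorm.pow_const 2
  refine (lintegral_graph_le hψ s₀ a hF).trans ?_
  gcongr
  rw [layer_eq_band, lintegral_band hψ _ _ measurableSet_Ioo hF,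
    lintegral_band hψ _ _ measurableSet_Ioo hP]
  have hm : ∀ (J : Set ℝ) {F : Plane → ℝ≥0∞}, Measurable F →
      Measurable fun s => ∫⁻ t in J, F (graphPoint e ψ (s, t)) := fun J F hF =>
    (hF.comp (continuous_graphPoint hψ).measurable).lintegral_prod_right'
  rw [← lintegral_const_mul _ (hm _ hF), ← lintegral_const_mul _ (hm _ hP),
    ← lintegral_add_left ((hm _ hF).const_mul _)]
  refine lintegral_mono fun s => ?_
  have hs := measurable_comp_graphPoint (e := e) hψ hF s
  set A := ∫⁻ t in Set.Ioo 0 H, ‖gradDensity f (graphPoint e ψ (s, t))‖ₑ ^ 2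
  set X := ‖f (graphPoint e ψ (s, 0))‖ₑ ^ 2
  have h1 : ENNReal.ofReal H * X ≤ 2 * (∫⁻ t in Set.Ioo 0 H, ‖f (graphPoint e ψ (s, t))‖ₑ ^ 2) +
      ENNReal.ofReal (2 * H) * A * ENNReal.ofReal H := by
    calc ENNReal.ofReal H * X = ∫⁻ _ in Set.Ioo 0 H, X := by
          rw [setLIntegral_const, Real.volume_Ioo, sub_zero, mul_comm]
      _ ≤ ∫⁻ t in Set.Ioo 0 H, (2 * ‖f (graphPoint e ψ (s, t))‖ₑ ^ 2 +
          ENNReal.ofReal (2 * H) * A) := by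
          refine setLIntegral_mono_ae' measurableSet_Ioo (Eventually.of_forall fun t ht => ?_)
          exact enorm_graphPoint_sq_le hψ hf ⟨le_rfl, hH.le⟩ ⟨ht.1.le, ht.2.le⟩ s
      _ = _ := by
          rw [lintegral_add_left (hs.const_mul 2), lintegral_const_mul _ hs, setLIntegral_const,
            Real.volume_Ioo, sub_zero]
  have hinv : ENNReal.ofReal H⁻¹ * ENNReal.ofReal H = 1 := by
    rw [← ENNReal.ofReal_mul (by positivity), inv_mul_cancel₀ hH.ne', ENNReal.ofReal_one]
  calc X = ENNReal.ofReal H⁻¹ * (ENNReal.ofReal H * X) := by rw [← mul_assoc, hinv, one_mul]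
    _ ≤ ENNReal.ofReal H⁻¹ * (2 * (∫⁻ t in Set.Ioo 0 H, ‖f (graphPoint e ψ (s, t))‖ₑ ^ 2) +
      ENNReal.ofReal (2 * H) * A * ENNReal.ofReal H) := by gcongr
    _ = 2 * ENNReal.ofReal H⁻¹ * (∫⁻ t in Set.Ioo 0 H, ‖f (graphPoint e ψ (s, t))‖ₑ ^ 2) +
      (ENNReal.ofReal H⁻¹ * ENNReal.ofReal H) * (ENNReal.ofReal (2 * H) * A) := by ring
    _ = _ := by
      rw [hinv, one_mul]
      congr 2
      rw [div_eq_mul_inv, ENNReal.ofReal_mul (by norm_num)]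
      simp

end

section

/-! ### Norms of rigid motions -/

theorem eLpNorm_sum_two_le {F : Fin 2 → Plane → ℝ} (hF : ∀ i, Continuous (F i))
    (μ : Measure Plane) : eLpNorm (fun x => ∑ i, F i x) 2 μ ≤ ∑ i, eLpNorm (F i) 2 μ := by
  rw [Fin.sum_univ_two]
  simp only [Fin.sum_univ_two]
  exact eLpNorm_add_le (hF 0).aestronglyMeasurable (hF 1).aestronglyMeasurable one_le_two

theorem eLpNorm_abs (f : Plane → ℝ) (μ : Measure Plane) :
    eLpNorm (fun x => |f x|) 2 μ = eLpNorm f 2 μ := eLpNorm_norm f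

theorem eLpNorm_gradDensity_le {f : Plane → ℝ} (hf : IsSmooth f) (μ : Measure Plane) :
    eLpNorm (gradDensity f) 2 μ ≤ ∑ j, eLpNorm (partialDeriv j f) 2 μ := by
  have h := eLpNorm_sum_two_le (F := fun j x => |partialDeriv j f x|)
    (fun j => (hf.partialDeriv j).continuous.abs) μ
  simp only [eLpNorm_abs] at h
  exact h

theorem eLpNorm_sizeDensity_le {φ : Fin 2 → Plane → ℝ} (hφ : ∀ i, IsSmooth (φ i))
    (μ : Measure Plane) : eLpNorm (sizeDensity φ) 2 μ ≤
      ∑ i, (eLpNorm (φ i) 2 μ + ∑ j, eLpNorm (partialDeriv j (φ i)) 2 μ) := by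
  have h := eLpNorm_sum_two_le (F := fun i x => |φ i x| + gradDensity (φ i) x)
    (fun i => (hφ i).continuous.abs.add (continuous_gradDensity (hφ i))) μ
  have h' : ∀ i, eLpNorm (fun x => |φ i x| + gradDensity (φ i) x) 2 μ ≤
      eLpNorm (φ i) 2 μ + ∑ j, eLpNorm (partialDeriv j (φ i)) 2 μ := fun i => by
    have h1 : eLpNorm (fun x => |φ i x| + gradDensity (φ i) x) 2 μ ≤
        eLpNorm (fun x => |φ i x|) 2 μ + eLpNorm (gradDensity (φ i)) 2 μ :=
      eLpNorm_add_le (hφ i).continuous.abs.aestronglyMeasurable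
        (continuous_gradDensity (hφ i)).aestronglyMeasurable one_le_two
    rw [eLpNorm_abs] at h1
    exact h1.trans (by gcongr; exact eLpNorm_gradDensity_le (hφ i) μ)
  exact h.trans (Finset.sum_le_sum fun i _ => h' i)

theorem abs_le_sizeDensity (φ : Fin 2 → Plane → ℝ) (i : Fin 2) (x : Plane) :
    |φ i x| ≤ sizeDensity φ x := by
  have h : ∀ k, 0 ≤ |φ k x| + ∑ j, |partialDeriv j (φ k) x| := fun k => by positivity
  refine le_trans ?_ (Finset.single_le_sum (fun k _ => h k) (Finset.mem_univ i))
  exact le_add_of_nonneg_right (by positivity)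

theorem abs_partialDeriv_le_sizeDensity (φ : Fin 2 → Plane → ℝ) (i j : Fin 2) (x : Plane) :
    |partialDeriv j (φ i) x| ≤ sizeDensity φ x := by
  have h : ∀ k, 0 ≤ |φ k x| + ∑ j, |partialDeriv j (φ k) x| := fun k => by positivity
  refine le_trans ?_ (Finset.single_le_sum (fun k _ => h k) (Finset.mem_univ i))
  have := Finset.single_le_sum (f := fun j => |partialDeriv j (φ i) x|)
    (fun k _ => abs_nonneg _) (Finset.mem_univ j)
  exact this.trans (le_add_of_nonneg_left (abs_nonneg _))

theorem eLpNorm_le_sizeDensity (φ : Fin 2 → Plane → ℝ) (i : Fin 2) (μ : Measure Plane) :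
    eLpNorm (φ i) 2 μ ≤ eLpNorm (sizeDensity φ) 2 μ :=
  eLpNorm_mono_real fun x => abs_le_sizeDensity φ i x

theorem eLpNorm_partialDeriv_le_sizeDensity (φ : Fin 2 → Plane → ℝ) (i j : Fin 2)
    (μ : Measure Plane) : eLpNorm (partialDeriv j (φ i)) 2 μ ≤ eLpNorm (sizeDensity φ) 2 μ :=
  eLpNorm_mono_real fun x => abs_partialDeriv_le_sizeDensity φ i j x

/-- A nonzero rigid motion vanishes at one point at most. If `μ` is not carried by a point, the
linear map from coefficients to `L²` is injective on a finite-dimensional space, hence bounded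
below. -/
theorem exists_enorm_le_rigid {μ : Measure Plane} (h2 : ∀ a b c i, MemLp (rigid a b c i) 2 μ)
    (hμ : ∀ p, μ {p}ᶜ ≠ 0) : ∃ C : ℝ≥0, ∀ a b c : ℝ,
      ‖a‖ₑ + ‖b‖ₑ + ‖c‖ₑ ≤ C * ∑ i, eLpNorm (rigid a b c i) 2 μ := by
  let L : (ℝ × ℝ × ℝ) →ₗ[ℝ] (Fin 2 → Lp ℝ 2 μ) :=
    { toFun := fun q i => (h2 q.1 q.2.1 q.2.2 i).toLp _
      map_add' := fun q r => by
        funext i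
        rw [Pi.add_apply, ← MemLp.toLp_add, MemLp.toLp_eq_toLp_iff]
        refine Eventually.of_forall fun x => ?_
        fin_cases i <;> simp [rigid] <;> ring
      map_smul' := fun t q => by
        funext i
        rw [RingHom.id_apply, Pi.smul_apply, ← MemLp.toLp_const_smul, MemLp.toLp_eq_toLp_iff]
        refine Eventually.of_forall fun x => ?_
        fin_cases i <;> simp [rigid] <;> ring }
  have hL : LinearMap.ker L = ⊥ := by
    rw [LinearMap.ker_eq_bot']
    rintro ⟨a, b, c⟩ h
    have h' : ∀ i, rigid a b c i =ᵐ[μ] 0 := fun i => by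
      have hi : (h2 a b c i).toLp _ = 0 := congrFun h i
      exact (MemLp.coeFn_toLp _).symm.trans (hi ▸ Lp.coeFn_zero ℝ 2 μ)
    have h0 : ∀ᵐ x ∂μ, a + c * x 1 = 0 := h' 0
    have h1 : ∀ᵐ x ∂μ, b - c * x 0 = 0 := h' 1
    have hc : c = 0 := by
      by_contra hc
      -- The centre of the rotation.
      refine hμ (point (b / c, -a / c)) ?_
      have : ∀ᵐ x ∂μ, x = point (b / c, -a / c) := by
        filter_upwards [h0, h1] with x e0 e1
        ext i
        fin_cases i
        · simp only [Fin.zero_eta, point_zero]; rw [eq_div_iff hc]; linarith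
        · simp only [Fin.mk_one, point_one]; rw [eq_div_iff hc]; linarith
      exact this
    have hne : μ ≠ 0 := fun h => hμ 0 (by simp [h])
    have : (ae μ).NeBot := ae_neBot.2 hne
    obtain ⟨x, e0, e1⟩ := (h0.and h1).exists
    subst hc
    simp only [zero_mul, add_zero, sub_zero] at e0 e1
    rw [e0, e1]; rfl
  obtain ⟨k, -, hk⟩ := L.exists_antilipschitzWith hL
  refine ⟨3 * k, fun a b c => ?_⟩
  have h1 : ‖(a, b, c)‖ₑ ≤ k * ‖L (a, b, c)‖ₑ := by
    have := hk (a, b, c) 0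
    rwa [map_zero, edist_zero_right, edist_zero_right] at this
  have h3 : ‖L (a, b, c)‖ₑ ≤ ∑ i, eLpNorm (rigid a b c i) 2 μ := by
    have : ∀ i, ‖L (a, b, c) i‖ₑ = eLpNorm (rigid a b c i) 2 μ := fun i => by
      rw [Lp.enorm_def]
      exact eLpNorm_congr_ae (h2 a b c i).coeFn_toLp
    rw [← ofReal_norm]
    refine ENNReal.ofReal_le_of_le_toReal ?_
    rw [pi_norm_le_iff_of_nonneg ENNReal.toReal_nonneg]
    intro i
    rw [← toReal_enorm, this]
    refine ENNReal.toReal_mono (ENNReal.sum_ne_top.2 fun j _ => (h2 a b c j).eLpNorm_ne_top) ?_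
    exact Finset.single_le_sum (f := fun i => eLpNorm (rigid a b c i) 2 μ)
      (fun _ _ => zero_le) (Finset.mem_univ i)
  have hn : ∀ t : ℝ, |t| ≤ ‖(a, b, c)‖ → ‖t‖ₑ ≤ ‖(a, b, c)‖ₑ := fun t ht => by
    rw [← ofReal_norm, ← ofReal_norm]
    exact ENNReal.ofReal_le_ofReal ht
  have e1 : ‖a‖ₑ ≤ ‖(a, b, c)‖ₑ := hn _ (norm_fst_le (a, b, c))
  have e2 : ‖b‖ₑ ≤ ‖(a, b, c)‖ₑ := hn _ ((norm_fst_le (b, c)).trans (norm_snd_le (a, b, c)))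
  have e3 : ‖c‖ₑ ≤ ‖(a, b, c)‖ₑ := hn _ ((norm_snd_le (b, c)).trans (norm_snd_le (a, b, c)))
  calc ‖a‖ₑ + ‖b‖ₑ + ‖c‖ₑ ≤ ‖(a, b, c)‖ₑ + ‖(a, b, c)‖ₑ + ‖(a, b, c)‖ₑ := by gcongr
    _ = 3 * ‖(a, b, c)‖ₑ := by ring
    _ ≤ 3 * (k * ∑ i, eLpNorm (rigid a b c i) 2 μ) := by gcongr; exact h1.trans (by gcongr)
    _ = _ := by push_cast; ring

theorem sizeDensity_rigid_le (a b c : ℝ) (x : Plane) :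
    sizeDensity (rigid a b c) x ≤ (|a| + |b| + |c|) * (2 + 2 * ‖x‖) := by
  have h0 : |x 0| ≤ ‖x‖ := PiLp.norm_apply_le x 0
  have h1 : |x 1| ≤ ‖x‖ := PiLp.norm_apply_le x 1
  have e0 : |a + c * x 1| ≤ |a| + |c| * ‖x‖ :=
    (abs_add_le _ _).trans (by rw [abs_mul]; gcongr)
  have e1 : |b - c * x 0| ≤ |b| + |c| * ‖x‖ :=
    (abs_sub _ _).trans (by rw [abs_mul]; gcongr)
  have : sizeDensity (rigid a b c) x = |a + c * x 1| + |b - c * x 0| + 2 * |c| := by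
    simp only [sizeDensity, Fin.sum_univ_two, partialDeriv_rigid]
    simp [rigid]
    ring
  rw [this]
  nlinarith [abs_nonneg a, abs_nonneg b, abs_nonneg c, norm_nonneg x,
    mul_nonneg (abs_nonneg a) (norm_nonneg x), mul_nonneg (abs_nonneg b) (norm_nonneg x)]

theorem eLpNorm_sizeDensity_rigid_le {S : Set Plane} (hS : Bornology.IsBounded S) :
    ∃ C : ℝ≥0, ∀ a b c : ℝ, eLpNorm (sizeDensity (rigid a b c)) 2 (volume.restrict S) ≤
      C * (‖a‖ₑ + ‖b‖ₑ + ‖c‖ₑ) := by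
  have hc : Continuous fun x : Plane => 2 + 2 * ‖x‖ := by fun_prop
  have hne := eLpNorm_ne_top_of_isBounded hc hS
  refine ⟨(eLpNorm (fun x : Plane => 2 + 2 * ‖x‖) 2 (volume.restrict S)).toNNReal,
    fun a b c => ?_⟩
  rw [ENNReal.coe_toNNReal hne, mul_comm]
  calc eLpNorm (sizeDensity (rigid a b c)) 2 (volume.restrict S)
      ≤ eLpNorm ((|a| + |b| + |c|) • fun x : Plane => 2 + 2 * ‖x‖) 2 (volume.restrict S) := by
        refine eLpNorm_mono_real fun x => ?_
        rw [Real.norm_of_nonneg (sizeDensity_nonneg _ _)]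
        exact sizeDensity_rigid_le a b c x
    _ = _ := by
        rw [eLpNorm_const_smul, Real.enorm_of_nonneg (by positivity),
          ENNReal.ofReal_add (by positivity) (by positivity),
          ENNReal.ofReal_add (by positivity) (by positivity), ← Real.enorm_eq_ofReal_abs,
          ← Real.enorm_eq_ofReal_abs, ← Real.enorm_eq_ofReal_abs]

theorem isSmooth_sub_rigid {φ : Fin 2 → Plane → ℝ} (hφ : ∀ i, IsSmooth (φ i)) (a b c : ℝ)
    (i : Fin 2) : IsSmooth fun x => φ i x - rigid a b c i x :=
  (hφ i).sub (isSmooth_rigid a b c i)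

/-- The rigid part of a field is controlled by the values of the field on a set that is not
reduced to a point. -/
theorem exists_eLpNorm_sizeDensity_le {S : Set Plane} (hS : Bornology.IsBounded S)
    {μ : Measure Plane} (h2 : ∀ a b c i, MemLp (rigid a b c i) 2 μ)
    (hμ : ∀ p, μ {p}ᶜ ≠ 0) : ∃ C : ℝ≥0, ∀ φ : Fin 2 → Plane → ℝ, (∀ i, IsSmooth (φ i)) →
      ∀ a b c : ℝ, eLpNorm (sizeDensity φ) 2 (volume.restrict S) ≤
        eLpNorm (sizeDensity fun i x => φ i x - rigid a b c i x) 2 (volume.restrict S) +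
        C * ∑ i, (eLpNorm (φ i) 2 μ + eLpNorm (fun x => φ i x - rigid a b c i x) 2 μ) := by
  obtain ⟨C₁, h₁⟩ := exists_enorm_le_rigid h2 hμ
  obtain ⟨C₂, h₂⟩ := eLpNorm_sizeDensity_rigid_le hS
  refine ⟨C₂ * C₁, fun φ hφ a b c => ?_⟩
  have hs := isSmooth_sub_rigid hφ a b c
  have h3 : eLpNorm (sizeDensity φ) 2 (volume.restrict S) ≤
      eLpNorm ((sizeDensity fun i x => φ i x - rigid a b c i x) + sizeDensity (rigid a b c)) 2
        (volume.restrict S) := by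
    refine eLpNorm_mono_real fun x => ?_
    rw [Real.norm_of_nonneg (sizeDensity_nonneg _ _)]
    have := sizeDensity_add_le hs (isSmooth_rigid a b c) x
    simpa using this
  refine h3.trans ((eLpNorm_add_le (continuous_sizeDensity hs).aestronglyMeasurable
    (continuous_sizeDensity (isSmooth_rigid a b c)).aestronglyMeasurable one_le_two).trans ?_)
  refine add_le_add le_rfl ((h₂ a b c).trans ?_)
  rw [ENNReal.coe_mul, mul_assoc]
  gcongr
  refine (h₁ a b c).trans ?_
  gcongr with i
  have h4 : rigid a b c i = φ i - fun x => φ i x - rigid a b c i x := by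
    funext x; simp
  calc eLpNorm (rigid a b c i) 2 μ = eLpNorm (φ i - fun x => φ i x - rigid a b c i x) 2 μ := by
        rw [← h4]
    _ ≤ _ := eLpNorm_sub_le (hφ i).continuous.aestronglyMeasurable
        (hs i).continuous.aestronglyMeasurable one_le_two

theorem korn_ball_sizeDensity (z : Plane) {R : ℝ} (hR : 0 < R) : ∃ C : ℝ≥0,
    ∀ φ : Fin 2 → Plane → ℝ, (∀ i, IsSmooth (φ i)) → ∃ a b c : ℝ,
      eLpNorm (sizeDensity fun i x => φ i x - rigid a b c i x) 2
        (volume.restrict (Metric.ball z R)) ≤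
        C * eLpNorm (strainDensity φ) 2 (volume.restrict (Metric.ball z (3 * R))) := by
  obtain ⟨C, hC⟩ := korn_ball
  refine ⟨2 * (C * R.toNNReal + 2 * C), fun φ hφ => ?_⟩
  obtain ⟨a, b, c, h1, h2⟩ := hC φ hφ z R hR
  refine ⟨a, b, c, (eLpNorm_sizeDensity_le (isSmooth_sub_rigid hφ a b c) _).trans ?_⟩
  have h3 : ∀ i j, partialDeriv j (fun x => φ i x - rigid a b c i x) =
      fun x => partialDeriv j (φ i) x - !![0, c; -c, 0] i j := fun i j => by
    funext x
    rw [partialDeriv_sub (hφ i).differentiable.differentiableAt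
      (isSmooth_rigid a b c i).differentiable.differentiableAt, partialDeriv_rigid]
  calc _ ≤ ∑ i : Fin 2, (C * ENNReal.ofReal R *
          eLpNorm (strainDensity φ) 2 (volume.restrict (Metric.ball z (3 * R))) +
          ∑ j : Fin 2, C *
          eLpNorm (strainDensity φ) 2 (volume.restrict (Metric.ball z (3 * R)))) := by
        gcongr with i _ j
        · exact h1 i
        · rw [h3]; exact h2 i j
    _ = _ := by
        simp only [Finset.sum_const, Finset.card_univ, Fintype.card_fin, nsmul_eq_mul]
        push_cast
        rw [ENNReal.ofReal]
        ring

end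

section

variable {e : Plane ≃ₗᵢ[ℝ] Plane} {ψ : ℝ → ℝ} {K : ℝ≥0} {Ω B : Set Plane}

/-! ### Charts of a Lipschitz boundary -/

/-- Boxes in the coordinates (abscissa, height) replace the balls of the definition. The boundary
point has height zero: a positive height would put it in `Ω`, a negative one would keep it away from
`Ω`. -/
theorem HasLipschitzBoundary.exists_chart (hΩ : HasLipschitzBoundary Ω) (ho : IsOpen Ω)
    {x₀ : Plane} (hx₀ : x₀ ∈ frontier Ω) :
    ∃ (e : Plane ≃ₗᵢ[ℝ] Plane) (ψ : ℝ → ℝ) (K : ℝ≥0) (a H : ℝ), LipschitzWith K ψ ∧ 0 < a ∧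
      0 < H ∧ height e ψ x₀ = 0 ∧ ∀ x, |e x 0 - e x₀ 0| < 2 * a → |height e ψ x| < 4 * H →
        (x ∈ Ω ↔ 0 < height e ψ x) := by
  obtain ⟨e, ψ, K, r, hψ, hr, h⟩ := hΩ x₀ hx₀
  have h' : ∀ y ∈ Metric.ball x₀ r, (y ∈ Ω ↔ 0 < height e ψ y) := fun y hy => by
    rw [h y hy, height, sub_pos]
  have hcl := hx₀.1
  have hni : x₀ ∉ Ω := by rw [ho.frontier_eq] at hx₀; exact hx₀.2
  have h0 : height e ψ x₀ = 0 := by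
    have h1 := mt (h' x₀ (Metric.mem_ball_self hr)).2 hni
    refine le_antisymm (not_lt.1 h1) (not_lt.1 fun h2 => ?_)
    have h3 : {x | height e ψ x < 0} ∩ Metric.ball x₀ r ∈ 𝓝 x₀ :=
      inter_mem ((isOpen_lt (continuous_height hψ) continuous_const).mem_nhds h2)
        (Metric.ball_mem_nhds _ hr)
    obtain ⟨y, ⟨hy1, hy2⟩, hy3⟩ := mem_closure_iff_nhds.1 hcl _ h3
    exact lt_asymm hy1 ((h' y hy2).1 hy3)
  -- On the box, `(1 + K)` times the horizontal displacement is at most `r/4` and the height is less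
  -- than `r/4`, so the distance to `x₀` is less than `r`.
  refine ⟨e, ψ, K, r / (8 * (1 + K)), r / 16, hψ, by positivity, by positivity, h0,
    fun x hx hh => h' x ?_⟩
  have hk : 2 * (r / (8 * (1 + (K : ℝ)))) * (1 + K) = r / 4 := by
    have : (1 + (K : ℝ)) ≠ 0 := by positivity
    field_simp; norm_num
  have h2 := hψ.dist_le_mul (e x 0) (e x₀ 0)
  rw [Real.dist_eq, Real.dist_eq] at h2
  have h3 : |e x 1 - e x₀ 1| ≤ |height e ψ x| + |ψ (e x 0) - ψ (e x₀ 0)| := by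
    have : e x 1 - e x₀ 1 = height e ψ x + (ψ (e x 0) - ψ (e x₀ 0)) := by
      simp only [height] at h0 ⊢; linarith
    rw [this]; exact abs_add_le _ _
  have h4 : dist x x₀ ≤ |e x 0 - e x₀ 0| + |e x 1 - e x₀ 1| := by
    rw [← e.dist_map, EuclideanSpace.dist_eq, Fin.sum_univ_two, Real.dist_eq, Real.dist_eq]
    rw [Real.sqrt_le_left (by positivity)]
    nlinarith [mul_nonneg (abs_nonneg (e x 0 - e x₀ 0)) (abs_nonneg (e x 1 - e x₀ 1))]
  rw [Metric.mem_ball]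
  have h5 : |e x 0 - e x₀ 0| * (1 + K) ≤ r / 4 := by
    rw [← hk]; gcongr
  linarith


/-- In suitable coordinates near `x₀`, the set `Ω` lies above the graph of `ψ`. -/
def IsChart (Ω : Set Plane) (e : Plane ≃ₗᵢ[ℝ] Plane) (ψ : ℝ → ℝ) (s₀ a H : ℝ) : Prop :=
  ∀ x, |e x 0 - s₀| < 2 * a → |height e ψ x| < 4 * H → (x ∈ Ω ↔ 0 < height e ψ x)

theorem IsChart.layer_subset {s₀ a H : ℝ} (h : IsChart Ω e ψ s₀ a H) :
    layer e ψ s₀ (2 * a) (4 * H) ⊆ Ω := fun x hx =>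
  (h x hx.1 (by rw [abs_of_pos hx.2.1]; exact hx.2.2)).2 hx.2.1

theorem IsChart.mem_frontier_iff {s₀ a H : ℝ} (h : IsChart Ω e ψ s₀ a H) (ho : IsOpen Ω)
    (hψ : LipschitzWith K ψ) {x : Plane} (hx : |e x 0 - s₀| < 2 * a)
    (hh : |height e ψ x| < 4 * H) : x ∈ frontier Ω ↔ height e ψ x = 0 := by
  have hH : 0 < 4 * H := (abs_nonneg _).trans_lt hh
  rw [ho.frontier_eq, Set.mem_sdiff, h x hx hh]
  constructor
  · rintro ⟨h1, h2⟩
    refine le_antisymm (not_lt.1 h2) (not_lt.1 fun h3 => ?_)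
    have hU : IsOpen {y | height e ψ y < 0 ∧ |e y 0 - s₀| < 2 * a ∧ |height e ψ y| < 4 * H} :=
      (isOpen_lt (continuous_height hψ) continuous_const).inter
        ((isOpen_lt ((continuous_coord 0).sub continuous_const).abs continuous_const).inter
          (isOpen_lt (continuous_height hψ).abs continuous_const))
    obtain ⟨y, ⟨hy1, hy2, hy3⟩, hy⟩ := mem_closure_iff.1 h1 _ hU ⟨h3, hx, hh⟩
    exact lt_asymm hy1 ((h y hy2 hy3).1 hy)
  · intro h0
    refine ⟨?_, h0.le.not_gt⟩
    have hc : Tendsto (fun t : ℝ => x + t • vertical e) (𝓝[>] 0) (𝓝 x) := by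
      have : ContinuousAt (fun t : ℝ => x + t • vertical e) 0 := by fun_prop
      have h2 := this.tendsto
      simp only [zero_smul, add_zero] at h2
      exact h2.mono_left nhdsWithin_le_nhds
    refine mem_closure_of_tendsto hc ?_
    filter_upwards [Ioo_mem_nhdsGT hH] with t ht
    refine (h _ ?_ ?_).2 ?_
    · rwa [coord_add_vertical_zero]
    · rw [height_add_vertical, h0, zero_add, abs_of_pos ht.1]; exact ht.2
    · rw [height_add_vertical, h0, zero_add]; exact ht.1

/-- The abscissa is a 1-Lipschitz function whose image of this boundary part contains an interval.
-/
theorem hausdorffMeasure_ne_zero (hΩ : HasLipschitzBoundary Ω) (ho : IsOpen Ω) {U : Set Plane}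
    (hU : IsOpen U) (hne : (frontier Ω ∩ U).Nonempty) :
    (Measure.hausdorffMeasure 1 : Measure Plane) (frontier Ω ∩ U) ≠ 0 := by
  obtain ⟨x₀, hx₀, hxU⟩ := hne
  obtain ⟨e, ψ, K, a, H, hψ, ha, hH, h0, hch⟩ := hΩ.exists_chart ho hx₀
  replace hch : IsChart Ω e ψ (e x₀ 0) a H := hch
  have hc : Continuous fun s => graphPoint e ψ (s, 0) := (lipschitzWith_graphPoint hψ).continuous
  have hx : graphPoint e ψ (e x₀ 0, 0) = x₀ := by
    have := graphPoint_coord_height (e := e) (ψ := ψ) x₀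
    rwa [h0] at this
  obtain ⟨δ, hδ, hsub⟩ := Metric.mem_nhds_iff.1 (inter_mem
    (hc.continuousAt.preimage_mem_nhds (by rw [hx]; exact hU.mem_nhds hxU))
    (Metric.ball_mem_nhds (e x₀ 0) (by positivity : 0 < 2 * a)))
  have hl : LipschitzWith 1 fun x => e x 0 := LipschitzWith.of_dist_le_mul fun x y => by
    rw [NNReal.coe_one, one_mul, Real.dist_eq, dist_eq_norm]
    exact abs_coord_sub_le x y 0
  have h1 := hl.hausdorffMeasure_image_le zero_le_one (frontier Ω ∩ U)
  have h2 : Metric.ball (e x₀ 0) δ ⊆ (fun x => e x 0) '' (frontier Ω ∩ U) := fun s hs => by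
    obtain ⟨hs1, hs2⟩ := hsub hs
    refine ⟨graphPoint e ψ (s, 0), ⟨?_, hs1⟩, coord_graphPoint _⟩
    rw [hch.mem_frontier_iff ho hψ, height_graphPoint]
    · rw [coord_graphPoint]; exact hs2
    · rw [height_graphPoint]; simpa using hH
  have h3 := (measure_mono h2).trans h1
  rw [hausdorffMeasure_real, Real.volume_ball] at h3
  intro h4
  rw [h4] at h3
  simp at h3
  linarith

/-! ### Fields controlled by the strain and by the values on a ball -/

/-- The norm of a field on `A` is controlled by its strain on `Ω` and its norm on `B`. -/
def Controlled (Ω B A : Set Plane) : Prop :=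
  ∃ C : ℝ≥0, ∀ φ : Fin 2 → Plane → ℝ, (∀ i, IsSmooth (φ i)) →
    eLpNorm (sizeDensity φ) 2 (volume.restrict A) ≤
      C * (eLpNorm (strainDensity φ) 2 (volume.restrict Ω) +
        eLpNorm (sizeDensity φ) 2 (volume.restrict B))

theorem eLpNorm_restrict_mono {f : Plane → ℝ} {A A' : Set Plane} {μ : Measure Plane}
    (h : A ⊆ A') : eLpNorm f 2 (μ.restrict A) ≤ eLpNorm f 2 (μ.restrict A') :=
  eLpNorm_mono_measure f (Measure.restrict_mono h le_rfl)

theorem Controlled.mono {A A' : Set Plane} (h : A ⊆ A') (hA : Controlled Ω B A') :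
    Controlled Ω B A := by
  obtain ⟨C, hC⟩ := hA
  exact ⟨C, fun φ hφ => (eLpNorm_restrict_mono h).trans (hC φ hφ)⟩

theorem eLpNorm_restrict_union_le (f : Plane → ℝ) (μ : Measure Plane) (A A' : Set Plane) :
    eLpNorm f 2 (μ.restrict (A ∪ A')) ≤
      eLpNorm f 2 (μ.restrict A) + eLpNorm f 2 (μ.restrict A') := by
  rw [← sq_le_sq_iff_ennreal, eLpNorm_two_sq, add_sq, eLpNorm_two_sq, eLpNorm_two_sq]
  exact (lintegral_union_le _ _ _).trans (add_le_add le_self_add le_rfl)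

theorem Controlled.union {A A' : Set Plane} (h : Controlled Ω B A) (h' : Controlled Ω B A') :
    Controlled Ω B (A ∪ A') := by
  obtain ⟨C, hC⟩ := h
  obtain ⟨C', hC'⟩ := h'
  refine ⟨C + C', fun φ hφ => (eLpNorm_restrict_union_le _ _ _ _).trans ?_⟩
  rw [ENNReal.coe_add, add_mul]
  exact add_le_add (hC φ hφ) (hC' φ hφ)

theorem controlled_self : Controlled Ω B B :=
  ⟨1, fun φ _ => by rw [ENNReal.coe_one, one_mul]; exact le_add_self⟩

theorem controlled_empty : Controlled Ω B ∅ := ⟨0, fun φ _ => by simp⟩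

theorem memLp_rigid {S : Set Plane} (hS : Bornology.IsBounded S) (a b c : ℝ) (i : Fin 2) :
    MemLp (rigid a b c i) 2 (volume.restrict S) :=
  ⟨(isSmooth_rigid a b c i).continuous.aestronglyMeasurable,
    (eLpNorm_ne_top_of_isBounded (isSmooth_rigid a b c i).continuous hS).lt_top⟩

theorem volume_ball_restrict_compl_ne_zero (y p : Plane) {r : ℝ} (hr : 0 < r) :
    (volume.restrict (Metric.ball y r)) {p}ᶜ ≠ 0 := by
  rw [Measure.restrict_apply (measurableSet_singleton p).compl, Set.inter_comm,
    ← Set.sdiff_eq_compl_inter.trans (Set.inter_comm _ _), measure_sdiff_null (measure_singleton p)]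
  exact (Metric.measure_ball_pos _ _ hr).ne'

/-- On the larger ball the field is known modulo a rigid motion, and that rigid motion is determined
by its values on the smaller ball. -/
theorem Controlled.ball {y z : Plane} {r R : ℝ} (hr : 0 < r) (hR : 0 < R)
    (h : Controlled Ω B (Metric.ball y r)) (hsub : Metric.ball y r ⊆ Metric.ball z R)
    (hz : Metric.ball z (3 * R) ⊆ Ω) : Controlled Ω B (Metric.ball z R) := by
  obtain ⟨C, hC⟩ := h
  obtain ⟨C₁, h₁⟩ := korn_ball_sizeDensity z hR
  obtain ⟨C₂, h₂⟩ := exists_eLpNorm_sizeDensity_le (S := Metric.ball z R) Metric.isBounded_ball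
    (μ := volume.restrict (Metric.ball y r)) (memLp_rigid Metric.isBounded_ball)
    (fun p => volume_ball_restrict_compl_ne_zero y p hr)
  refine ⟨C₁ + C₂ * (2 * (C + C₁)), fun φ hφ => ?_⟩
  obtain ⟨a, b, c, h₃⟩ := h₁ φ hφ
  obtain ⟨E, hE⟩ : ∃ E, E = eLpNorm (strainDensity φ) 2 (volume.restrict Ω) +
    eLpNorm (sizeDensity φ) 2 (volume.restrict B) := ⟨_, rfl⟩
  rw [← hE]
  have h₄ : eLpNorm (sizeDensity fun i x => φ i x - rigid a b c i x) 2
      (volume.restrict (Metric.ball z R)) ≤ C₁ * E := by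
    refine h₃.trans ?_
    gcongr
    rw [hE]
    exact (eLpNorm_restrict_mono hz).trans le_self_add
  refine (h₂ φ hφ a b c).trans ?_
  calc _ ≤ C₁ * E + C₂ * ∑ i : Fin 2, (C * E + C₁ * E) := by
        refine add_le_add h₄ (mul_le_mul' le_rfl (Finset.sum_le_sum fun i _ => add_le_add ?_ ?_))
        · rw [hE]
          exact (eLpNorm_le_sizeDensity φ i _).trans (hC φ hφ)
        · refine (eLpNorm_restrict_mono hsub).trans (le_trans ?_ h₄)
          exact eLpNorm_le_sizeDensity (fun i x => φ i x - rigid a b c i x) i _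
    _ = _ := by
        simp only [Finset.sum_const, Finset.card_univ, Fintype.card_fin, nsmul_eq_mul]
        push_cast
        ring

/-- The set of points with a controlled neighbourhood is open, and it is closed in `Ω` by
`Controlled.ball`; connectedness concludes. -/
theorem exists_ball_controlled (hΩ : IsOpen Ω) (hc : IsPreconnected Ω) {z₀ : Plane} {r₀ : ℝ}
    (hr₀ : 0 < r₀) (hz₀ : z₀ ∈ Ω) {x : Plane} (hx : x ∈ Ω) :
    ∃ ρ > 0, Controlled Ω (Metric.ball z₀ r₀) (Metric.ball x ρ) := by
  have hu : IsOpen {x | ∃ ρ > 0, Controlled Ω (Metric.ball z₀ r₀) (Metric.ball x ρ)} := by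
    refine Metric.isOpen_iff.2 fun y ⟨ρ, hρ, hy⟩ => ⟨ρ, hρ, fun w hw => ?_⟩
    refine ⟨ρ - dist w y, sub_pos.2 hw, hy.mono (Metric.ball_subset_ball' ?_)⟩
    linarith
  refine hc.subset_of_closure_inter_subset hu ⟨z₀, hz₀, r₀, hr₀, controlled_self⟩ ?_ hx
  rintro w ⟨hw, hwΩ⟩
  obtain ⟨ε, hε, hsub⟩ := Metric.isOpen_iff.1 hΩ w hwΩ
  obtain ⟨y, ⟨ρ, hρ, hy⟩, hyw⟩ := Metric.mem_closure_iff.1 hw (ε / 3) (by positivity)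
  rw [dist_comm] at hyw
  -- The radius `ε / 3` is such that the tripled ball, required by the ball inequality, still lies
  -- in `Ω`.
  refine ⟨ε / 3, by positivity, Controlled.ball (r := min ρ (ε / 3 - dist y w))
    (lt_min hρ (sub_pos.2 hyw)) (by positivity)
    (hy.mono (Metric.ball_subset_ball (min_le_left _ _))) (Metric.ball_subset_ball' ?_) ?_⟩
  · have := min_le_right ρ (ε / 3 - dist y w)
    linarith
  · rwa [mul_div_cancel₀ _ three_ne_zero]

theorem controlled_of_isCompact (hΩ : IsOpen Ω) (hc : IsPreconnected Ω) {z₀ : Plane} {r₀ : ℝ}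
    (hr₀ : 0 < r₀) (hz₀ : z₀ ∈ Ω) {A : Set Plane} (hA : IsCompact A) (hsub : A ⊆ Ω) :
    Controlled Ω (Metric.ball z₀ r₀) A := by
  refine hA.induction_on controlled_empty (fun s t hst ht => ht.mono hst)
    (fun s t hs ht => hs.union ht) fun x hx => ?_
  obtain ⟨ρ, hρ, h⟩ := exists_ball_controlled hΩ hc hr₀ hz₀ (hsub hx)
  exact ⟨_, mem_nhdsWithin_of_mem_nhds (Metric.ball_mem_nhds x hρ), h⟩

end

section

variable {e : Plane ≃ₗᵢ[ℝ] Plane} {ψ : ℝ → ℝ} {K : ℝ≥0} {Ω B : Set Plane}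

/-! ### Estimates up to the boundary -/

theorem exists_oscillationBound : ∃ C : ℝ≥0, ∀ φ : Fin 2 → Plane → ℝ, (∀ i, IsSmooth (φ i)) →
    ∀ i j, OscillationBound C (partialDeriv j (φ i)) (strainDensity φ) := by
  obtain ⟨C, hC⟩ := korn_ball
  refine ⟨C, fun φ hφ i j z R hR => ?_⟩
  obtain ⟨a, b, c, -, h⟩ := hC φ hφ z R hR
  exact ⟨_, h i j⟩

theorem eLpNorm_layer_le_of_grad (hψ : LipschitzWith K ψ) {s₀ a H : ℝ} (hH : 0 < H)
    {f : Plane → ℝ} (hf : IsSmooth f) :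
    eLpNorm f 2 (volume.restrict (layer e ψ s₀ a H)) ≤
      2 * eLpNorm f 2 (volume.restrict (band e ψ s₀ a (Set.Ioo H (2 * H)))) +
      ENNReal.ofReal (2 * H) *
        eLpNorm (gradDensity f) 2 (volume.restrict (layer e ψ s₀ a (2 * H))) := by
  rw [← sq_le_sq_iff_ennreal, eLpNorm_two_sq]
  refine (lintegral_layer_sq_le hψ hH hf).trans ?_
  rw [← eLpNorm_two_sq, ← eLpNorm_two_sq, add_sq, mul_pow, mul_pow,
    ← ENNReal.ofReal_pow (by positivity), add_right_comm]
  have h1 : (2 * H) ^ 2 = 4 * H ^ 2 := by ring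
  rw [h1]
  refine le_trans (add_le_add (mul_le_mul' ?_ le_rfl) le_rfl) le_self_add
  norm_num

theorem eLpNorm_graph_le (hψ : LipschitzWith K ψ) {s₀ a H : ℝ} (hH : 0 < H) : ∃ C : ℝ≥0,
    ∀ f, IsSmooth f → eLpNorm f 2 (lengthOn (band e ψ s₀ a {0})) ≤
      C * (eLpNorm f 2 (volume.restrict (layer e ψ s₀ a H)) +
        eLpNorm (gradDensity f) 2 (volume.restrict (layer e ψ s₀ a H))) := by
  -- The summand 1 ensures `C ≤ C²`, so the constant of the squared estimate also serves after
  -- taking roots.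
  obtain ⟨C, hC⟩ : ∃ C, C = 1 + (1 + K) * ((2 / H).toNNReal + (2 * H).toNNReal) := ⟨_, rfl⟩
  refine ⟨C, fun f hf => ?_⟩
  obtain ⟨X, hX⟩ : ∃ X, X = eLpNorm f 2 (volume.restrict (layer e ψ s₀ a H)) := ⟨_, rfl⟩
  obtain ⟨Y, hY⟩ : ∃ Y, Y =
    eLpNorm (gradDensity f) 2 (volume.restrict (layer e ψ s₀ a H)) := ⟨_, rfl⟩
  rw [← hX, ← hY, ← sq_le_sq_iff_ennreal, eLpNorm_two_sq]
  refine (lintegral_graph_sq_le hψ hH hf).trans ?_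
  rw [← eLpNorm_two_sq, ← eLpNorm_two_sq, ← hX, ← hY, mul_pow]
  have h1 : (C : ℝ≥0∞) ≤ (C : ℝ≥0∞) ^ 2 := by
    have : 1 ≤ C := by rw [hC]; exact le_self_add
    exact_mod_cast le_self_pow₀ this two_ne_zero
  have h2 : X ^ 2 + Y ^ 2 ≤ (X + Y) ^ 2 := by
    rw [add_sq, add_right_comm]; exact le_self_add
  refine le_trans ?_ (mul_le_mul' h1 h2)
  have hk : ((1 + K : ℝ≥0) : ℝ≥0∞) *
      (((2 / H).toNNReal + (2 * H).toNNReal : ℝ≥0) : ℝ≥0∞) ≤ C := by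
    rw [← ENNReal.coe_mul, hC, ENNReal.coe_le_coe]; exact le_add_self
  calc _ ≤ ((1 + K : ℝ≥0) : ℝ≥0∞) *
        ((((2 / H).toNNReal + (2 * H).toNNReal : ℝ≥0) : ℝ≥0∞) * X ^ 2 +
        (((2 / H).toNNReal + (2 * H).toNNReal : ℝ≥0) : ℝ≥0∞) * Y ^ 2) := by
        rw [ENNReal.ofReal, ENNReal.ofReal, ENNReal.coe_add (2 / H).toNNReal]
        gcongr
        · exact le_self_add
        · exact le_add_self
    _ = _ * (X ^ 2 + Y ^ 2) := by rw [← mul_add, ← mul_assoc]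
    _ ≤ _ := mul_le_mul' hk le_rfl

theorem IsChart.isCompact_band (hψ : LipschitzWith K ψ) (s₀ a h₁ h₂ : ℝ) :
    IsCompact {x | |e x 0 - s₀| ≤ a ∧ h₁ ≤ height e ψ x ∧ height e ψ x ≤ h₂} := by
  have hc : IsCompact (graphPoint e ψ '' (Set.Icc (s₀ - a) (s₀ + a) ×ˢ Set.Icc h₁ h₂)) :=
    (isCompact_Icc.prod isCompact_Icc).image (continuous_graphPoint hψ)
  refine hc.of_isClosed_subset ?_ fun x hx => ⟨(e x 0, height e ψ x), ?_, graphPoint_coord_height x⟩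
  · exact (isClosed_le ((continuous_coord 0).sub continuous_const).abs continuous_const).inter
      ((isClosed_le continuous_const (continuous_height hψ)).inter
        (isClosed_le (continuous_height hψ) continuous_const))
  · obtain ⟨h1, h2, h3⟩ := hx
    rw [abs_le] at h1
    exact ⟨⟨by linarith, by linarith⟩, h2, h3⟩

/-- A compact band at positive height is controlled by interior estimates. The stretch argument
brings the gradient down to the graph, and integration along verticals then does the same for the
values. The latter step uses gradients up to twice the height, hence `H / 2`. -/
theorem IsChart.controlled {s₀ a H : ℝ} (h : IsChart Ω e ψ s₀ a H) (ha : 0 < a) (hH : 0 < H)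
    (hψ : LipschitzWith K ψ) (hΩ : IsOpen Ω) (hc : IsPreconnected Ω) {z₀ : Plane} {r₀ : ℝ}
    (hr₀ : 0 < r₀) (hz₀ : z₀ ∈ Ω) :
    Controlled Ω (Metric.ball z₀ r₀) (layer e ψ s₀ a (H / 2)) := by
  have hsub : {x | |e x 0 - s₀| ≤ a ∧ H / 2 ≤ height e ψ x ∧ height e ψ x ≤ 2 * H} ⊆ Ω :=
    fun x ⟨h1, h2, h3⟩ => h.layer_subset ⟨by linarith, by linarith, by linarith⟩
  obtain ⟨C₁, h₁⟩ := controlled_of_isCompact hΩ hc hr₀ hz₀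
    (IsChart.isCompact_band hψ s₀ a (H / 2) (2 * H)) hsub
  obtain ⟨C₂, h₂⟩ := exists_oscillationBound
  obtain ⟨C₃, h₃⟩ := eLpNorm_layer_le hψ ha hH hΩ.measurableSet h.layer_subset C₂
  obtain ⟨D, hD⟩ : ∃ D : ℝ≥0, D = C₃ * (1 + C₁) := ⟨_, rfl⟩
  refine ⟨2 * (2 * C₁ + H.toNNReal * (2 * D) + 2 * D), fun φ hφ => ?_⟩
  obtain ⟨E, hE⟩ : ∃ E, E = eLpNorm (strainDensity φ) 2 (volume.restrict Ω) +
    eLpNorm (sizeDensity φ) 2 (volume.restrict (Metric.ball z₀ r₀)) := ⟨_, rfl⟩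
  specialize h₁ φ hφ
  rw [← hE] at h₁ ⊢
  have hg : ∀ i j, eLpNorm (partialDeriv j (φ i)) 2 (volume.restrict (layer e ψ s₀ a H)) ≤
      D * E := fun i j => by
    refine (h₃ _ _ ((hφ i).partialDeriv j).continuous (continuous_strainDensity hφ)
      (h₂ φ hφ i j)).trans ?_
    rw [hD, ENNReal.coe_mul, mul_assoc, ENNReal.coe_add, ENNReal.coe_one, add_mul, one_mul]
    gcongr
    · rw [hE]; exact le_self_add
    · refine ((eLpNorm_restrict_mono ?_).trans
        (eLpNorm_partialDeriv_le_sizeDensity φ i j _)).trans h₁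
      rintro x ⟨h1, h2, h3⟩
      exact ⟨h1.le, by linarith, h3.le⟩
  have hgd : ∀ i, eLpNorm (gradDensity (φ i)) 2 (volume.restrict (layer e ψ s₀ a H)) ≤
      2 * D * E := fun i => by
    refine (eLpNorm_gradDensity_le (hφ i) _).trans ((Finset.sum_le_sum fun j _ => hg i j).trans ?_)
    simp only [Finset.sum_const, Finset.card_univ, Fintype.card_fin, nsmul_eq_mul]
    exact le_of_eq (by push_cast; ring)
  have hf : ∀ i, eLpNorm (φ i) 2 (volume.restrict (layer e ψ s₀ a (H / 2))) ≤
      2 * (C₁ * E) + ENNReal.ofReal H * (2 * D * E) := fun i => by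
    refine (eLpNorm_layer_le_of_grad hψ (half_pos hH) (hφ i)).trans ?_
    have h2 : 2 * (H / 2) = H := by ring
    rw [h2]
    gcongr
    · refine ((eLpNorm_restrict_mono ?_).trans (eLpNorm_le_sizeDensity φ i _)).trans h₁
      rintro x ⟨h1, h2, h3⟩
      exact ⟨h1.le, h2.le, by linarith⟩
    · exact hgd i
  have hl : layer e ψ s₀ a (H / 2) ⊆ layer e ψ s₀ a H := fun x hx =>
    ⟨hx.1, hx.2.1, by linarith [hx.2.2]⟩
  refine (eLpNorm_sizeDensity_le hφ _).trans ?_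
  calc _ ≤ ∑ i : Fin 2, (2 * (C₁ * E) + ENNReal.ofReal H * (2 * D * E) + ∑ j : Fin 2, D * E) :=
        Finset.sum_le_sum fun i _ => add_le_add (hf i)
          (Finset.sum_le_sum fun j _ => (eLpNorm_restrict_mono hl).trans (hg i j))
    _ = _ := by
        simp only [Finset.sum_const, Finset.card_univ, Fintype.card_fin, nsmul_eq_mul]
        rw [ENNReal.ofReal]
        push_cast
        ring

theorem IsChart.nhds {a H : ℝ} (ha : 0 < a) (hH : 0 < H) (hψ : LipschitzWith K ψ) {x₀ : Plane}
    (h0 : height e ψ x₀ = 0) : {x | |e x 0 - e x₀ 0| < a ∧ |height e ψ x| < H} ∈ 𝓝 x₀ := by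
  refine ((isOpen_lt ((continuous_coord 0).sub continuous_const).abs continuous_const).inter
    (isOpen_lt (continuous_height hψ).abs continuous_const)).mem_nhds ⟨?_, ?_⟩
  · simpa using ha
  · simpa [h0] using hH

/-- Compactness of the closure reduces the claim to neighbourhoods: interior points have controlled
balls, boundary points have controlled layers. -/
theorem IsBoundedLipschitzDomain.controlled (hΩ : IsBoundedLipschitzDomain Ω) {z₀ : Plane}
    {r₀ : ℝ} (hr₀ : 0 < r₀) (hz₀ : z₀ ∈ Ω) : Controlled Ω (Metric.ball z₀ r₀) Ω := by
  have hpc := hΩ.isConnected.isPreconnected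
  have hcl : IsCompact (closure Ω) := hΩ.isBounded.isCompact_closure
  suffices h : Controlled Ω (Metric.ball z₀ r₀) (closure Ω ∩ Ω) from
    h.mono (Set.subset_inter subset_closure le_rfl)
  refine hcl.induction_on (p := fun A => Controlled Ω (Metric.ball z₀ r₀) (A ∩ Ω))
    (by simpa using controlled_empty)
    (fun s t hst ht => ht.mono (Set.inter_subset_inter_left _ hst))
    (fun s t hs ht => by simpa only [Set.union_inter_distrib_right] using hs.union ht)
    fun x hx => ?_
  by_cases hxΩ : x ∈ Ω
  · obtain ⟨ρ, hρ, h⟩ := exists_ball_controlled hΩ.isOpen hpc hr₀ hz₀ hxΩ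
    exact ⟨_, mem_nhdsWithin_of_mem_nhds (Metric.ball_mem_nhds x hρ),
      h.mono Set.inter_subset_left⟩
  · have hf : x ∈ frontier Ω := by rw [hΩ.isOpen.frontier_eq]; exact ⟨hx, hxΩ⟩
    obtain ⟨e, ψ, K, a, H, hψ, ha, hH, h0, hch⟩ := hΩ.lipschitz.exists_chart hΩ.isOpen hf
    replace hch : IsChart Ω e ψ (e x 0) a H := hch
    refine ⟨_, mem_nhdsWithin_of_mem_nhds (IsChart.nhds ha (half_pos hH) hψ h0),
      (hch.controlled ha hH hψ hΩ.isOpen hpc hr₀ hz₀).mono ?_⟩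
    rintro y ⟨⟨h1, h2⟩, h3⟩
    exact ⟨h1, (hch y (by linarith) (by linarith)).1 h3, (le_abs_self _).trans_lt h2⟩

/-- Korn's second inequality modulo rigid motions. -/
theorem IsBoundedLipschitzDomain.korn_rigid (hΩ : IsBoundedLipschitzDomain Ω) : ∃ C : ℝ≥0,
    ∀ φ : Fin 2 → Plane → ℝ, (∀ i, IsSmooth (φ i)) → ∃ a b c : ℝ,
      eLpNorm (sizeDensity fun i x => φ i x - rigid a b c i x) 2 (volume.restrict Ω) ≤
        C * eLpNorm (strainDensity φ) 2 (volume.restrict Ω) := by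
  obtain ⟨z₀, hz₀⟩ := hΩ.isConnected.nonempty
  obtain ⟨ε, hε, hsub⟩ := Metric.isOpen_iff.1 hΩ.isOpen z₀ hz₀
  have hr₀ : 0 < ε / 3 := by positivity
  obtain ⟨C₁, h₁⟩ := hΩ.controlled hr₀ hz₀
  obtain ⟨C₂, h₂⟩ := korn_ball_sizeDensity z₀ hr₀
  rw [mul_div_cancel₀ _ three_ne_zero] at h₂
  refine ⟨C₁ * (1 + C₂), fun φ hφ => ?_⟩
  obtain ⟨a, b, c, h₃⟩ := h₂ φ hφ
  refine ⟨a, b, c, (h₁ _ (isSmooth_sub_rigid hφ a b c)).trans ?_⟩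
  rw [strainDensity_sub_rigid hφ, ENNReal.coe_mul, mul_assoc, ENNReal.coe_add, ENNReal.coe_one,
    add_mul, one_mul]
  gcongr
  exact h₃.trans (mul_le_mul' le_rfl (eLpNorm_restrict_mono hsub))

/-- The trace inequality for smooth functions. -/
theorem IsBoundedLipschitzDomain.trace_le (hΩ : IsBoundedLipschitzDomain Ω) : ∃ C : ℝ≥0,
    ∀ f, IsSmooth f → eLpNorm f 2 (lengthOn (frontier Ω)) ≤
      C * (eLpNorm f 2 (volume.restrict Ω) + eLpNorm (gradDensity f) 2 (volume.restrict Ω)) := by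
  have hcl : IsCompact (frontier Ω) :=
    hΩ.isBounded.isCompact_closure.of_isClosed_subset isClosed_frontier frontier_subset_closure
  suffices h : ∃ C : ℝ≥0, ∀ f, IsSmooth f →
      eLpNorm f 2 (lengthOn (frontier Ω ∩ frontier Ω)) ≤
      C * (eLpNorm f 2 (volume.restrict Ω) + eLpNorm (gradDensity f) 2 (volume.restrict Ω)) by
    rwa [Set.inter_self] at h
  refine hcl.induction_on (p := fun A => ∃ C : ℝ≥0, ∀ f, IsSmooth f →
      eLpNorm f 2 (lengthOn (A ∩ frontier Ω)) ≤
      C * (eLpNorm f 2 (volume.restrict Ω) + eLpNorm (gradDensity f) 2 (volume.restrict Ω)))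
    ⟨0, fun f _ => by simp⟩ ?_ ?_ fun x hx => ?_
  · rintro s t hst ⟨C, hC⟩
    exact ⟨C, fun f hf => (eLpNorm_restrict_mono (Set.inter_subset_inter_left _ hst)).trans
      (hC f hf)⟩
  · rintro s t ⟨C, hC⟩ ⟨C', hC'⟩
    refine ⟨C + C', fun f hf => ?_⟩
    rw [Set.union_inter_distrib_right, ENNReal.coe_add, add_mul]
    exact (eLpNorm_restrict_union_le _ _ _ _).trans (add_le_add (hC f hf) (hC' f hf))
  · obtain ⟨e, ψ, K, a, H, hψ, ha, hH, h0, hch⟩ := hΩ.lipschitz.exists_chart hΩ.isOpen hx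
    replace hch : IsChart Ω e ψ (e x 0) a H := hch
    obtain ⟨C, hC⟩ := eLpNorm_graph_le (e := e) hψ (s₀ := e x 0) (a := a) hH
    refine ⟨_, mem_nhdsWithin_of_mem_nhds (IsChart.nhds ha hH hψ h0), C, fun f hf => ?_⟩
    have hl : layer e ψ (e x 0) a H ⊆ Ω := fun y hy =>
      hch.layer_subset ⟨by linarith [hy.1], hy.2.1, by linarith [hy.2.2]⟩
    refine (eLpNorm_restrict_mono ?_).trans ((hC f hf).trans (mul_le_mul' le_rfl
      (add_le_add (eLpNorm_restrict_mono hl) (eLpNorm_restrict_mono hl))))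
    rintro y ⟨⟨h1, h2⟩, h3⟩
    exact ⟨h1, (hch.mem_frontier_iff hΩ.isOpen hψ (by linarith) (by linarith)).1 h3⟩

theorem eLpNorm_gradDensity_le_sizeDensity (φ : Fin 2 → Plane → ℝ) (i : Fin 2)
    (μ : Measure Plane) : eLpNorm (gradDensity (φ i)) 2 μ ≤ eLpNorm (sizeDensity φ) 2 μ := by
  refine eLpNorm_mono_real fun x => ?_
  rw [Real.norm_of_nonneg (gradDensity_nonneg _ _)]
  have h : ∀ k, 0 ≤ |φ k x| + ∑ j, |partialDeriv j (φ k) x| := fun k => by positivity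
  refine le_trans ?_ (Finset.single_le_sum (fun k _ => h k) (Finset.mem_univ i))
  exact le_add_of_nonneg_left (abs_nonneg _)

theorem IsBoundedLipschitzDomain.trace_le_sizeDensity (hΩ : IsBoundedLipschitzDomain Ω) :
    ∃ C : ℝ≥0, ∀ φ : Fin 2 → Plane → ℝ, (∀ i, IsSmooth (φ i)) →
      ∀ i, eLpNorm (φ i) 2 (lengthOn (frontier Ω)) ≤
        C * eLpNorm (sizeDensity φ) 2 (volume.restrict Ω) := by
  obtain ⟨C, hC⟩ := hΩ.trace_le
  refine ⟨C * 2, fun φ hφ i => (hC _ (hφ i)).trans ?_⟩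
  rw [ENNReal.coe_mul, mul_assoc, ENNReal.coe_ofNat, two_mul]
  gcongr
  · exact eLpNorm_le_sizeDensity φ i _
  · exact eLpNorm_gradDensity_le_sizeDensity φ i _

theorem IsBoundedLipschitzDomain.memLp_frontier (hΩ : IsBoundedLipschitzDomain Ω)
    {f : Plane → ℝ} (hf : IsSmooth f) : MemLp f 2 (lengthOn (frontier Ω)) := by
  obtain ⟨C, hC⟩ := hΩ.trace_le
  refine ⟨hf.continuous.aestronglyMeasurable, (hC f hf).trans_lt ?_⟩
  exact ENNReal.mul_lt_top ENNReal.coe_lt_top (ENNReal.add_lt_top.2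
    ⟨(eLpNorm_ne_top_of_isBounded hf.continuous hΩ.isBounded).lt_top,
      (eLpNorm_ne_top_of_isBounded (continuous_gradDensity hf) hΩ.isBounded).lt_top⟩)

/-- Korn's inequality, with the boundary values on a relatively open part of the boundary. -/
theorem IsBoundedLipschitzDomain.korn (hΩ : IsBoundedLipschitzDomain Ω) {Γ U : Set Plane}
    (hU : IsOpen U) (hΓ : Γ = frontier Ω ∩ U) (hne : Γ.Nonempty) : ∃ C : ℝ≥0,
    ∀ φ : Fin 2 → Plane → ℝ, (∀ i, IsSmooth (φ i)) →
      eLpNorm (sizeDensity φ) 2 (volume.restrict Ω) ≤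
        C * (eLpNorm (strainDensity φ) 2 (volume.restrict Ω) +
          ∑ i, eLpNorm (φ i) 2 (lengthOn Γ)) := by
  obtain ⟨C₁, h₁⟩ := hΩ.korn_rigid
  obtain ⟨C₂, h₂⟩ := hΩ.trace_le_sizeDensity
  have hsub : Γ ⊆ frontier Ω := by rw [hΓ]; exact Set.inter_subset_left
  -- Points have zero length and `Γ` has positive length, so boundary values on `Γ` determine a
  -- rigid motion.
  have hatom : ∀ p, (lengthOn Γ) {p}ᶜ ≠ 0 := fun p => by
    have := Measure.nullSingletonClass_hausdorff Plane one_pos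
    rw [Measure.restrict_apply (measurableSet_singleton p).compl, Set.inter_comm,
      ← Set.sdiff_eq_compl_inter.trans (Set.inter_comm _ _),
      measure_sdiff_null (measure_singleton p), hΓ]
    exact hausdorffMeasure_ne_zero hΩ.lipschitz hΩ.isOpen hU (hΓ ▸ hne)
  obtain ⟨C₃, h₃⟩ := exists_eLpNorm_sizeDensity_le (S := Ω) hΩ.isBounded (μ := lengthOn Γ)
    (fun a b c i => (hΩ.memLp_frontier (isSmooth_rigid a b c i)).mono_measure
      (Measure.restrict_mono hsub le_rfl)) hatom
  refine ⟨C₁ + C₃ * (1 + 2 * C₂ * C₁), fun φ hφ => ?_⟩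
  obtain ⟨a, b, c, h₄⟩ := h₁ φ hφ
  obtain ⟨E, hE⟩ : ∃ E, E = eLpNorm (strainDensity φ) 2 (volume.restrict Ω) := ⟨_, rfl⟩
  obtain ⟨T, hT⟩ : ∃ T, T = ∑ i, eLpNorm (φ i) 2 (lengthOn Γ) := ⟨_, rfl⟩
  rw [← hE] at h₄
  rw [← hE, ← hT]
  refine (h₃ φ hφ a b c).trans ?_
  rw [Finset.sum_add_distrib, ← hT]
  have h₅ : ∑ i, eLpNorm (fun x => φ i x - rigid a b c i x) 2 (lengthOn Γ) ≤
      2 * C₂ * C₁ * E := by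
    calc _ ≤ ∑ i : Fin 2, C₂ * (C₁ * E) := Finset.sum_le_sum fun i _ =>
          (eLpNorm_restrict_mono hsub).trans
            ((h₂ _ (isSmooth_sub_rigid hφ a b c) i).trans (mul_le_mul' le_rfl h₄))
      _ = _ := by
          simp only [Finset.sum_const, Finset.card_univ, Fintype.card_fin, nsmul_eq_mul]
          push_cast; ring
  calc _ ≤ C₁ * E + C₃ * (T + 2 * C₂ * C₁ * E) := by gcongr
    _ ≤ C₁ * (E + T) + C₃ * ((E + T) + 2 * C₂ * C₁ * (E + T)) := by
        gcongr <;> first | exact le_self_add | exact le_add_self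
    _ = _ := by push_cast; ring

end

/-! ### Weak derivatives and the Hilbert space of jets. -/

section

variable {Ω : Set Plane} {v w v' w' : Plane → ℝ} {i : Fin 2}

/-! ### Weak partial derivatives -/

theorem integral_mul_eq_inner {μ : Measure Plane} {v θ : Plane → ℝ} (hv : MemLp v 2 μ)
    (hθ : MemLp θ 2 μ) : ∫ x, v x * θ x ∂μ = inner ℝ (hv.toLp v) (hθ.toLp θ) := by
  rw [L2.inner_def]
  refine integral_congr_ae ?_
  filter_upwards [hv.coeFn_toLp, hθ.coeFn_toLp] with x h1 h2
  rw [h1, h2]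
  simp [mul_comm]

theorem memLp_of_hasCompactSupport {θ : Plane → ℝ} (h : Continuous θ) (hc : HasCompactSupport θ)
    (Ω : Set Plane) : MemLp θ 2 (areaOn Ω) :=
  h.memLp_of_hasCompactSupport hc

theorem IsWeakPartial.congr (h : IsWeakPartial Ω i v w) (hv : v =ᵐ[areaOn Ω] v')
    (hw : w =ᵐ[areaOn Ω] w') : IsWeakPartial Ω i v' w' := fun φ h1 h2 h3 => by
  have e1 : ∫ x in Ω, v' x * partialDeriv i φ x = ∫ x in Ω, v x * partialDeriv i φ x :=
    integral_congr_ae (by filter_upwards [hv] with x hx; rw [hx])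
  have e2 : ∫ x in Ω, w' x * φ x = ∫ x in Ω, w x * φ x :=
    integral_congr_ae (by filter_upwards [hw] with x hx; rw [hx])
  rw [e1, e2, h φ h1 h2 h3]

theorem IsWeakPartial.ae_eq (hΩ : IsOpen Ω) (h : IsWeakPartial Ω i v w)
    (h' : IsWeakPartial Ω i v w') (hw : MemLp w 2 (areaOn Ω)) (hw' : MemLp w' 2 (areaOn Ω)) :
    w =ᵐ[areaOn Ω] w' := by
  have hd : MemLp (fun x => w x - w' x) 2 (areaOn Ω) := hw.sub hw'
  have hloc : LocallyIntegrableOn (fun x => w x - w' x) Ω := by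
    refine (locallyIntegrableOn_iff hΩ.isLocallyClosed).2 fun k hk hkc => ?_
    have : IsFiniteMeasure (volume.restrict k) := ⟨by simpa using hkc.measure_lt_top⟩
    exact (hd.mono_measure (Measure.restrict_mono hk le_rfl)).integrable one_le_two
  have h0 := hΩ.ae_eq_zero_of_integral_contDiff_smul_eq_zero hloc fun φ h1 h2 h3 => ?_
  · rw [EventuallyEq, ae_restrict_iff' hΩ.measurableSet]
    filter_upwards [h0] with x hx hxΩ
    exact sub_eq_zero.1 (hx hxΩ)
  · have hφ := memLp_of_hasCompactSupport h1.continuous h2 Ω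
    have e1 : ∫ x in Ω, φ x * (w x - w' x) = ∫ x, φ x * (w x - w' x) := by
      refine setIntegral_eq_integral_of_forall_compl_eq_zero fun x hx => ?_
      rw [image_eq_zero_of_notMem_tsupport fun hx' => hx (h3 hx'), zero_mul]
    have e2 : ∫ x in Ω, φ x * (w x - w' x) =
        (∫ x in Ω, w x * φ x) - ∫ x in Ω, w' x * φ x := by
      have i1 : Integrable (fun x => w x * φ x) (areaOn Ω) := hw.integrable_mul hφ
      have i2 : Integrable (fun x => w' x * φ x) (areaOn Ω) := hw'.integrable_mul hφ
      rw [← integral_sub i1 i2]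
      exact integral_congr_ae (Eventually.of_forall fun x => by ring)
    simp only [smul_eq_mul]
    rw [← e1, e2]
    have := h φ h1 h2 h3
    have := h' φ h1 h2 h3
    linarith

theorem isWeakPartial_of_isSmooth {f : Plane → ℝ} (hf : IsSmooth f) (Ω : Set Plane) (i : Fin 2) :
    IsWeakPartial Ω i f (partialDeriv i f) := fun φ h1 h2 h3 => by
  have hz : ∀ x, x ∉ Ω → φ x = 0 := fun x hx =>
    image_eq_zero_of_notMem_tsupport fun hx' => hx (h3 hx')
  have hz' : ∀ x, x ∉ Ω → partialDeriv i φ x = 0 := fun x hx => by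
    have : x ∉ tsupport (fderiv ℝ φ) := fun hx' => hx (h3 (tsupport_fderiv_subset ℝ hx'))
    rw [partialDeriv, image_eq_zero_of_notMem_tsupport this]
    rfl
  rw [setIntegral_eq_integral_of_forall_compl_eq_zero fun x hx => by rw [hz' x hx, mul_zero],
    setIntegral_eq_integral_of_forall_compl_eq_zero fun x hx => by rw [hz x hx, mul_zero]]
  have := integral_mul_partialDeriv h1 hf h2 i
  rw [← neg_eq_iff_eq_neg] at this
  simp only [mul_comm (partialDeriv i φ _), mul_comm (φ _)] at this
  exact this.symm

/-- Both sides of the defining identity are inner products with fixed `L²` functions, so weak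
convergence suffices. -/
theorem isWeakPartial_of_tendsto {V W : ℕ → Lp ℝ 2 (areaOn Ω)} {v w : Lp ℝ 2 (areaOn Ω)}
    (hv : ∀ θ : Lp ℝ 2 (areaOn Ω), Tendsto (fun n => inner ℝ (V n) θ) atTop (𝓝 (inner ℝ v θ)))
    (hw : ∀ θ : Lp ℝ 2 (areaOn Ω), Tendsto (fun n => inner ℝ (W n) θ) atTop (𝓝 (inner ℝ w θ)))
    (h : ∀ n, IsWeakPartial Ω i (V n) (W n)) : IsWeakPartial Ω i v w := fun φ h1 h2 h3 => by
  have hφ := memLp_of_hasCompactSupport h1.continuous h2 Ω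
  have hφ' := memLp_of_hasCompactSupport (IsSmooth.partialDeriv h1 i).continuous
    (hasCompactSupport_partialDeriv h2 i) Ω
  have key : ∀ (u θ : Plane → ℝ) (hu : MemLp u 2 (areaOn Ω)) (hθ : MemLp θ 2 (areaOn Ω)),
    ∫ x in Ω, u x * θ x = inner ℝ (hu.toLp u) (hθ.toLp θ) := fun u θ hu hθ =>
      integral_mul_eq_inner hu hθ
  have h4 : ∀ n, inner ℝ (V n) (hφ'.toLp _) = - inner ℝ (W n) (hφ.toLp _) := fun n => by
    have := h n φ h1 h2 h3
    rwa [key _ _ (Lp.memLp _) hφ', key _ _ (Lp.memLp _) hφ, Lp.toLp_coeFn, Lp.toLp_coeFn] at this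
  rw [key _ _ (Lp.memLp _) hφ', key _ _ (Lp.memLp _) hφ, Lp.toLp_coeFn, Lp.toLp_coeFn]
  refine tendsto_nhds_unique (hv (hφ'.toLp _)) ?_
  simp only [h4]
  exact (hw _).neg

theorem MemH1.memLp_weakPartial (h : MemH1 Ω v) (i : Fin 2) :
    MemLp (weakPartial Ω i v) 2 (areaOn Ω) := by
  rw [weakPartial, dif_pos (h.2 i)]
  exact (h.2 i).choose_spec.1

theorem MemH1.isWeakPartial (h : MemH1 Ω v) (i : Fin 2) :
    IsWeakPartial Ω i v (weakPartial Ω i v) := by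
  rw [weakPartial, dif_pos (h.2 i)]
  exact (h.2 i).choose_spec.2

theorem weakPartial_ae_eq (hΩ : IsOpen Ω) (hw : MemLp w 2 (areaOn Ω))
    (h : IsWeakPartial Ω i v w) : weakPartial Ω i v =ᵐ[areaOn Ω] w := by
  have hex : ∃ w, MemLp w 2 (areaOn Ω) ∧ IsWeakPartial Ω i v w := ⟨w, hw, h⟩
  rw [weakPartial, dif_pos hex]
  exact hex.choose_spec.2.ae_eq hΩ h hex.choose_spec.1 hw

end

section

variable {Ω : Set Plane}

/-! ### The Hilbert space of values, gradients and boundary values -/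

/-- The measures for the components of a jet: values and partial derivatives live in `Ω`,
boundary values on the boundary. -/
@[reducible] def jetMeasure (Ω : Set Plane) : Fin 2 × Option (Option (Fin 2)) → Measure Plane
  | (_, none) => lengthOn (frontier Ω)
  | (_, some _) => areaOn Ω

/-- The values and first derivatives of a vector field on `Ω`, and its boundary values. -/
abbrev JetSpace (Ω : Set Plane) : Type :=
  PiLp 2 fun k : Fin 2 × Option (Option (Fin 2)) => Lp ℝ 2 (jetMeasure Ω k)

/-- The `i`-th component of the field. -/
def jetValue (Ω : Set Plane) (i : Fin 2) : JetSpace Ω →L[ℝ] Lp ℝ 2 (areaOn Ω) :=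
  PiLp.proj 2 (fun k => Lp ℝ 2 (jetMeasure Ω k)) (i, some none)

/-- The `j`-th partial derivative of the `i`-th component of the field. -/
def jetPartial (Ω : Set Plane) (i j : Fin 2) : JetSpace Ω →L[ℝ] Lp ℝ 2 (areaOn Ω) :=
  PiLp.proj 2 (fun k => Lp ℝ 2 (jetMeasure Ω k)) (i, some (some j))

/-- The boundary values of the `i`-th component of the field. -/
def jetTrace (Ω : Set Plane) (i : Fin 2) : JetSpace Ω →L[ℝ] Lp ℝ 2 (lengthOn (frontier Ω)) :=
  PiLp.proj 2 (fun k => Lp ℝ 2 (jetMeasure Ω k)) (i, none)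

/-- The jet with given components. -/
def mkJet (v : Fin 2 → Lp ℝ 2 (areaOn Ω)) (w : Fin 2 → Fin 2 → Lp ℝ 2 (areaOn Ω))
    (t : Fin 2 → Lp ℝ 2 (lengthOn (frontier Ω))) : JetSpace Ω :=
  WithLp.toLp 2 fun
    | (i, none) => t i
    | (i, some none) => v i
    | (i, some (some j)) => w i j

@[simp] theorem jetValue_mkJet (v : Fin 2 → Lp ℝ 2 (areaOn Ω))
    (w : Fin 2 → Fin 2 → Lp ℝ 2 (areaOn Ω)) (t : Fin 2 → Lp ℝ 2 (lengthOn (frontier Ω)))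
    (i : Fin 2) : jetValue Ω i (mkJet v w t) = v i := rfl

@[simp] theorem jetPartial_mkJet (v : Fin 2 → Lp ℝ 2 (areaOn Ω))
    (w : Fin 2 → Fin 2 → Lp ℝ 2 (areaOn Ω)) (t : Fin 2 → Lp ℝ 2 (lengthOn (frontier Ω)))
    (i j : Fin 2) : jetPartial Ω i j (mkJet v w t) = w i j := rfl

@[simp] theorem jetTrace_mkJet (v : Fin 2 → Lp ℝ 2 (areaOn Ω))
    (w : Fin 2 → Fin 2 → Lp ℝ 2 (areaOn Ω)) (t : Fin 2 → Lp ℝ 2 (lengthOn (frontier Ω)))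
    (i : Fin 2) : jetTrace Ω i (mkJet v w t) = t i := rfl

theorem norm_jet_le (U : JetSpace Ω) : ‖U‖ ≤
    ∑ i, (‖jetTrace Ω i U‖ + ‖jetValue Ω i U‖ + ∑ j, ‖jetPartial Ω i j U‖) := by
  have h : ‖U‖ ≤ ∑ k, ‖U k‖ := by
    rw [← Real.sqrt_sq (norm_nonneg U), PiLp.norm_sq_eq_of_L2]
    refine Real.sqrt_le_iff.2 ⟨Finset.sum_nonneg fun _ _ => norm_nonneg _, ?_⟩
    exact Finset.sum_sq_le_sq_sum_of_nonneg fun _ _ => norm_nonneg _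
  refine h.trans (le_of_eq ?_)
  rw [Fintype.sum_prod_type]
  refine Finset.sum_congr rfl fun i _ => ?_
  rw [Fintype.sum_option, Fintype.sum_option, add_assoc]
  rfl

theorem tendsto_jet {U : ℕ → JetSpace Ω} {V : JetSpace Ω}
    (hv : ∀ i, Tendsto (fun n => jetValue Ω i (U n)) atTop (𝓝 (jetValue Ω i V)))
    (hw : ∀ i j, Tendsto (fun n => jetPartial Ω i j (U n)) atTop (𝓝 (jetPartial Ω i j V)))
    (ht : ∀ i, Tendsto (fun n => jetTrace Ω i (U n)) atTop (𝓝 (jetTrace Ω i V))) :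
    Tendsto U atTop (𝓝 V) := by
  rw [tendsto_iff_norm_sub_tendsto_zero]
  refine squeeze_zero (fun _ => norm_nonneg _) (fun n => norm_jet_le _) ?_
  have h0 : (0 : ℝ) = ∑ i : Fin 2, (0 + 0 + ∑ j : Fin 2, 0) := by simp
  rw [h0]
  refine tendsto_finsetSum _ fun i _ => ((?_ : Tendsto _ _ _).add ?_).add
    (tendsto_finsetSum _ fun j _ => ?_)
  · simpa only [map_sub] using tendsto_iff_norm_sub_tendsto_zero.1 (ht i)
  · simpa only [map_sub] using tendsto_iff_norm_sub_tendsto_zero.1 (hv i)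
  · simpa only [map_sub] using tendsto_iff_norm_sub_tendsto_zero.1 (hw i j)

/-- The components of the jet `U` are represented by the functions `v`, `w`, `t`. -/
def IsJet (U : JetSpace Ω) (v : Fin 2 → Plane → ℝ) (w : Fin 2 → Fin 2 → Plane → ℝ)
    (t : Fin 2 → Plane → ℝ) : Prop :=
  ∀ i, jetValue Ω i U =ᵐ[areaOn Ω] v i ∧ (∀ j, jetPartial Ω i j U =ᵐ[areaOn Ω] w i j) ∧
    jetTrace Ω i U =ᵐ[lengthOn (frontier Ω)] t i

theorem exists_isJet {v : Fin 2 → Plane → ℝ} {w : Fin 2 → Fin 2 → Plane → ℝ}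
    {t : Fin 2 → Plane → ℝ} (hv : ∀ i, MemLp (v i) 2 (areaOn Ω))
    (hw : ∀ i j, MemLp (w i j) 2 (areaOn Ω)) (ht : ∀ i, MemLp (t i) 2 (lengthOn (frontier Ω))) :
    ∃ U : JetSpace Ω, IsJet U v w t :=
  ⟨mkJet (fun i => (hv i).toLp _) (fun i j => (hw i j).toLp _) fun i => (ht i).toLp _,
    fun i => ⟨(hv i).coeFn_toLp, fun j => (hw i j).coeFn_toLp, (ht i).coeFn_toLp⟩⟩

theorem IsJet.add {U U' : JetSpace Ω} {v v' : Fin 2 → Plane → ℝ}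
    {w w' : Fin 2 → Fin 2 → Plane → ℝ} {t t' : Fin 2 → Plane → ℝ}
    (h : IsJet U v w t) (h' : IsJet U' v' w' t') :
    IsJet (U + U') (fun i x => v i x + v' i x) (fun i j x => w i j x + w' i j x)
      (fun i x => t i x + t' i x) := fun i => by
  simp only [map_add]
  exact ⟨(Lp.coeFn_add _ _).trans ((h i).1.add (h' i).1),
    fun j => (Lp.coeFn_add _ _).trans (((h i).2.1 j).add ((h' i).2.1 j)),
    (Lp.coeFn_add _ _).trans ((h i).2.2.add (h' i).2.2)⟩

theorem IsJet.smul {U : JetSpace Ω} {v : Fin 2 → Plane → ℝ}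
    {w : Fin 2 → Fin 2 → Plane → ℝ} {t : Fin 2 → Plane → ℝ} (h : IsJet U v w t) (c : ℝ) :
    IsJet (c • U) (fun i x => c * v i x) (fun i j x => c * w i j x) (fun i x => c * t i x) :=
    fun i => by
  simp only [map_smul]
  exact ⟨(Lp.coeFn_smul _ _).trans ((h i).1.const_smul c),
    fun j => (Lp.coeFn_smul _ _).trans (((h i).2.1 j).const_smul c),
    (Lp.coeFn_smul _ _).trans ((h i).2.2.const_smul c)⟩

theorem partialDeriv_const_mul {f : Plane → ℝ} (hf : IsSmooth f) (c : ℝ) (j : Fin 2) (x : Plane) :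
    partialDeriv j (fun y => c * f y) x = c * partialDeriv j f x := by
  simp [partialDeriv, fderiv_const_mul hf.differentiable.differentiableAt]

/-- The jets of smooth fields. -/
def smoothJets (Ω : Set Plane) : Submodule ℝ (JetSpace Ω) where
  carrier := {U | ∃ φ : Fin 2 → Plane → ℝ, (∀ i, IsSmooth (φ i)) ∧
    IsJet U φ (fun i j => partialDeriv j (φ i)) φ}
  add_mem' := by
    rintro U V ⟨φ, hφ, hU⟩ ⟨χ, hχ, hV⟩
    refine ⟨fun i x => φ i x + χ i x, fun i => (hφ i).add (hχ i), ?_⟩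
    have : (fun i j => partialDeriv j fun x => φ i x + χ i x) =
        fun i j x => partialDeriv j (φ i) x + partialDeriv j (χ i) x := by
      funext i j x
      exact partialDeriv_add (hφ i).differentiable.differentiableAt
        (hχ i).differentiable.differentiableAt j
    rw [this]
    exact hU.add hV
  zero_mem' := by
    refine ⟨fun _ _ => 0, fun _ => contDiff_const, fun i => ?_⟩
    have h0 : ∀ j, partialDeriv j (fun _ : Plane => (0 : ℝ)) = 0 := fun j => by
      funext x; simp [partialDeriv]
    simp only [map_zero, h0]
    exact ⟨Lp.coeFn_zero _ _ _, fun j => Lp.coeFn_zero _ _ _, Lp.coeFn_zero _ _ _⟩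
  smul_mem' := by
    rintro c U ⟨φ, hφ, hU⟩
    refine ⟨fun i x => c * φ i x, fun i => contDiff_const.mul (hφ i), ?_⟩
    have : (fun i j => partialDeriv j fun x => c * φ i x) =
        fun i j x => c * partialDeriv j (φ i) x := by
      funext i j x
      exact partialDeriv_const_mul (hφ i) c j x
    rw [this]
    exact hU.smul c

/-- The jets of `H¹` fields with a trace. -/
def sobolevJets (Ω : Set Plane) : Submodule ℝ (JetSpace Ω) := (smoothJets Ω).topologicalClosure

/-- The restriction of boundary values to a part of the boundary. -/
def traceOn (Ω Γ : Set Plane) (i : Fin 2) :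
    JetSpace Ω →L[ℝ] Lp ℝ 2 ((lengthOn (frontier Ω)).restrict Γ) :=
  (LpToLpRestrictCLM Plane ℝ ℝ (lengthOn (frontier Ω)) 2 Γ).comp (jetTrace Ω i)

/-- The jets of the fields of `V^D`. -/
def dirichletJets (Ω ΓD : Set Plane) : Submodule ℝ (JetSpace Ω) :=
  sobolevJets Ω ⊓ ⨅ i, (traceOn Ω ΓD i).ker

theorem mem_dirichletJets {ΓD : Set Plane} {U : JetSpace Ω} :
    U ∈ dirichletJets Ω ΓD ↔ U ∈ sobolevJets Ω ∧ ∀ i, traceOn Ω ΓD i U = 0 := by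
  simp only [dirichletJets, Submodule.mem_inf, Submodule.mem_iInf]
  rfl

theorem isClosed_dirichletJets (Ω ΓD : Set Plane) :
    IsClosed (dirichletJets Ω ΓD : Set (JetSpace Ω)) := by
  have : (dirichletJets Ω ΓD : Set (JetSpace Ω)) =
      (sobolevJets Ω : Set (JetSpace Ω)) ∩ ⋂ i, {U | traceOn Ω ΓD i U = 0} := by
    ext U
    simp [mem_dirichletJets]
  rw [this]
  refine (Submodule.isClosed_topologicalClosure _).inter (isClosed_iInter fun i => ?_)
  exact isClosed_eq (traceOn Ω ΓD i).continuous continuous_const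

theorem memLp_areaOn (hΩ : IsBoundedLipschitzDomain Ω) {f : Plane → ℝ} (hf : Continuous f) :
    MemLp f 2 (areaOn Ω) :=
  ⟨hf.aestronglyMeasurable, (eLpNorm_ne_top_of_isBounded hf hΩ.isBounded).lt_top⟩

theorem exists_isJet_of_isSmooth (hΩ : IsBoundedLipschitzDomain Ω) {φ : Fin 2 → Plane → ℝ}
    (hφ : ∀ i, IsSmooth (φ i)) :
    ∃ U : JetSpace Ω, IsJet U φ (fun i j => partialDeriv j (φ i)) φ :=
  exists_isJet (fun i => memLp_areaOn hΩ (hφ i).continuous)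
    (fun i j => memLp_areaOn hΩ ((hφ i).partialDeriv j).continuous)
    (fun i => hΩ.memLp_frontier (hφ i))

theorem tendsto_Lp_iff_of_ae_eq {μ : Measure Plane} {F : ℕ → Lp ℝ 2 μ} {G : Lp ℝ 2 μ}
    {f : ℕ → Plane → ℝ} {g : Plane → ℝ} (hf : ∀ n, F n =ᵐ[μ] f n) (hg : G =ᵐ[μ] g) :
    Tendsto F atTop (𝓝 G) ↔ Tendsto (fun n => eLpNorm (fun x => f n x - g x) 2 μ) atTop (𝓝 0) := by
  rw [Lp.tendsto_Lp_iff_tendsto_eLpNorm']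
  refine tendsto_congr fun n => eLpNorm_congr_ae ?_
  exact (hf n).sub hg

/-- The jet of a field of `V^D`. -/
def IsFieldJet (U : JetSpace Ω) (v T : Plane → Plane) : Prop :=
  IsJet U (fun i x => v x i) (fun i j => weakPartial Ω j fun x => v x i) fun i x => T x i

theorem lengthOn_restrict {ΓD U : Set Plane} (hU : IsOpen U) (hΓ : ΓD = frontier Ω ∩ U) :
    (lengthOn (frontier Ω)).restrict ΓD = lengthOn ΓD := by
  have hm : MeasurableSet ΓD := hΓ ▸ isClosed_frontier.measurableSet.inter hU.measurableSet
  rw [lengthOn, Measure.restrict_restrict hm, Set.inter_eq_left.2 (by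
    rw [hΓ]; exact Set.inter_subset_left)]

theorem traceOn_ae_eq {Γ : Set Plane} (U : JetSpace Ω) (i : Fin 2) :
    traceOn Ω Γ i U =ᵐ[(lengthOn (frontier Ω)).restrict Γ] jetTrace Ω i U :=
  LpToLpRestrictCLM_coeFn ℝ Γ (jetTrace Ω i U)

theorem forall_traceOn_eq_zero_iff {ΓD : Set Plane} {U : JetSpace Ω} {T : Plane → Plane}
    (hT : ∀ i, jetTrace Ω i U =ᵐ[lengthOn (frontier Ω)] fun x => T x i) :
    (∀ i, traceOn Ω ΓD i U = 0) ↔ ∀ᵐ x ∂((lengthOn (frontier Ω)).restrict ΓD), T x = 0 := by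
  have h1 : ∀ i, traceOn Ω ΓD i U =ᵐ[(lengthOn (frontier Ω)).restrict ΓD] fun x => T x i :=
    fun i => (traceOn_ae_eq U i).trans (ae_restrict_of_ae (hT i))
  have h2 : ∀ i, traceOn Ω ΓD i U = 0 ↔
      ∀ᵐ x ∂((lengthOn (frontier Ω)).restrict ΓD), T x i = 0 := fun i => by
    rw [Lp.eq_zero_iff_ae_eq_zero]
    exact ⟨fun h => (h1 i).symm.trans h, fun h => (h1 i).trans h⟩
  simp only [h2]
  rw [← ae_all_iff]
  refine eventually_congr (Eventually.of_forall fun x => ⟨fun h => ?_, fun h i => by simp [h]⟩)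
  ext i
  exact h i

/-- `HasTrace` asks for smooth approximation in all components of the jet at once. The approximating
sequences of the two components of the field are paired index by index. -/
theorem exists_jet_of_memVDWithTrace (hΩ : IsBoundedLipschitzDomain Ω) {ΓD U : Set Plane}
    (hU : IsOpen U) (hΓ : ΓD = frontier Ω ∩ U) {v T : Plane → Plane}
    (h : MemVDWithTrace Ω ΓD v T) : ∃ V ∈ dirichletJets Ω ΓD, IsFieldJet V v T := by
  obtain ⟨V, hV⟩ := exists_isJet (Ω := Ω) (v := fun i x => v x i)
    (w := fun i j => weakPartial Ω j fun x => v x i) (t := fun i x => T x i)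
    (fun i => (h.1 i).1.1) (fun i j => (h.1 i).1.memLp_weakPartial j) (fun i => (h.1 i).2.1)
  refine ⟨V, mem_dirichletJets.2 ⟨?_, ?_⟩, hV⟩
  · choose φ hφ h0 h1 h2 using fun i => (h.1 i).2.2
    choose W hW using fun n => exists_isJet_of_isSmooth hΩ (φ := fun i => φ i n)
      (fun i => hφ i n)
    refine mem_closure_of_tendsto (f := W) (b := atTop) ?_
      (Eventually.of_forall fun n => ⟨_, fun i => hφ i n, hW n⟩)
    refine tendsto_jet (fun i => ?_) (fun i j => ?_) fun i => ?_
    · exact (tendsto_Lp_iff_of_ae_eq (fun n => (hW n i).1) (hV i).1).2 (h0 i)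
    · exact (tendsto_Lp_iff_of_ae_eq (fun n => (hW n i).2.1 j) ((hV i).2.1 j)).2 (h1 i j)
    · exact (tendsto_Lp_iff_of_ae_eq (fun n => (hW n i).2.2) (hV i).2.2).2 (h2 i)
  · rw [forall_traceOn_eq_zero_iff fun i => (hV i).2.2, lengthOn_restrict hU hΓ]
    exact h.2

/-- Converse dictionary: in a limit of smooth jets, the derivative components are the weak
derivatives of the value component, and the boundary component is its trace. -/
theorem exists_field_of_mem_dirichletJets (hΩ : IsBoundedLipschitzDomain Ω) {ΓD U : Set Plane}
    (hU : IsOpen U) (hΓ : ΓD = frontier Ω ∩ U) {V : JetSpace Ω} (hV : V ∈ dirichletJets Ω ΓD) :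
    ∃ v T, MemVDWithTrace Ω ΓD v T ∧ IsFieldJet V v T := by
  obtain ⟨h1, h2⟩ := mem_dirichletJets.1 hV
  obtain ⟨W, hW, hlim⟩ := mem_closure_iff_seq_limit.1
    (show V ∈ closure (smoothJets Ω : Set (JetSpace Ω)) from h1)
  choose φ hφ hWφ using hW
  have hv : ∀ i, Tendsto (fun n => jetValue Ω i (W n)) atTop (𝓝 (jetValue Ω i V)) := fun i =>
    ((jetValue Ω i).continuous.tendsto V).comp hlim
  have hw : ∀ i j, Tendsto (fun n => jetPartial Ω i j (W n)) atTop (𝓝 (jetPartial Ω i j V)) :=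
    fun i j => ((jetPartial Ω i j).continuous.tendsto V).comp hlim
  have ht : ∀ i, Tendsto (fun n => jetTrace Ω i (W n)) atTop (𝓝 (jetTrace Ω i V)) := fun i =>
    ((jetTrace Ω i).continuous.tendsto V).comp hlim
  have hweak : ∀ i j, IsWeakPartial Ω j (jetValue Ω i V) (jetPartial Ω i j V) := fun i j =>
    isWeakPartial_of_tendsto (fun θ => (hv i).inner tendsto_const_nhds)
      (fun θ => (hw i j).inner tendsto_const_nhds) fun n =>
      (isWeakPartial_of_isSmooth (hφ n i) Ω j).congr (hWφ n i).1.symm ((hWφ n i).2.1 j).symm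
  have hae : ∀ i j, weakPartial Ω j (jetValue Ω i V) =ᵐ[areaOn Ω] jetPartial Ω i j V :=
    fun i j => weakPartial_ae_eq hΩ.isOpen (Lp.memLp _) (hweak i j)
  have hjet : IsFieldJet V (fun x => WithLp.toLp 2 fun i => jetValue Ω i V x)
      (fun x => WithLp.toLp 2 fun i => jetTrace Ω i V x) := fun i =>
    ⟨EventuallyEq.rfl, fun j => (hae i j).symm, EventuallyEq.rfl⟩
  refine ⟨_, _, ⟨fun i => ⟨⟨Lp.memLp _, fun j => ⟨_, Lp.memLp _, hweak i j⟩⟩, Lp.memLp _,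
    fun n => φ n i, fun n => hφ n i, ?_, fun j => ?_, ?_⟩, ?_⟩, hjet⟩
  · exact (tendsto_Lp_iff_of_ae_eq (fun n => (hWφ n i).1) EventuallyEq.rfl).1 (hv i)
  · exact (tendsto_Lp_iff_of_ae_eq (fun n => (hWφ n i).2.1 j) (hae i j).symm).1 (hw i j)
  · exact (tendsto_Lp_iff_of_ae_eq (fun n => (hWφ n i).2.2) EventuallyEq.rfl).1 (ht i)
  · rw [forall_traceOn_eq_zero_iff fun i => (hjet i).2.2, lengthOn_restrict hU hΓ] at h2
    exact h2

end

/-! ### Coercivity of the elastic form and solvability of the state equation. -/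

section

variable {Ω ΓD : Set Plane}

/-! ### Korn's inequality for jets -/

/-- The strain component `ε i j` of a jet. -/
def jetStrain (Ω : Set Plane) (i j : Fin 2) : JetSpace Ω →L[ℝ] Lp ℝ 2 (areaOn Ω) :=
  (1 / 2 : ℝ) • (jetPartial Ω i j + jetPartial Ω j i)

theorem jetStrain_apply (U : JetSpace Ω) (i j : Fin 2) :
    jetStrain Ω i j U = (1 / 2 : ℝ) • (jetPartial Ω i j U + jetPartial Ω j i U) := rfl

theorem IsJet.jetStrain {U : JetSpace Ω} {v : Fin 2 → Plane → ℝ} {w : Fin 2 → Fin 2 → Plane → ℝ}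
    {t : Fin 2 → Plane → ℝ} (h : IsJet U v w t) (i j : Fin 2) :
    jetStrain Ω i j U =ᵐ[areaOn Ω] fun x => (w i j x + w j i x) / 2 := by
  rw [jetStrain_apply]
  filter_upwards [Lp.coeFn_smul (1 / 2 : ℝ) (jetPartial Ω i j U + jetPartial Ω j i U),
    Lp.coeFn_add (jetPartial Ω i j U) (jetPartial Ω j i U), (h i).2.1 j, (h j).2.1 i]
    with x h1 h2 h3 h4
  rw [h1, Pi.smul_apply, h2, Pi.add_apply, h3, h4, smul_eq_mul]
  ring

theorem enorm_Lp_eq {μ : Measure Plane} {F : Lp ℝ 2 μ} {f : Plane → ℝ} (h : F =ᵐ[μ] f) :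
    ‖F‖ₑ = eLpNorm f 2 μ := by
  rw [Lp.enorm_def]
  exact eLpNorm_congr_ae h

theorem norm_le_of_enorm_le {E : Type*} [NormedAddCommGroup E] {x : E} {C : ℝ≥0} {s : ℝ}
    (hs : 0 ≤ s) (h : ‖x‖ₑ ≤ C * ENNReal.ofReal s) : ‖x‖ ≤ C * s := by
  rw [← ofReal_norm, ← ENNReal.ofReal_coe_nnreal, ← ENNReal.ofReal_mul C.coe_nonneg] at h
  exact (ENNReal.ofReal_le_ofReal_iff (by positivity)).1 h

theorem eLpNorm_strainDensity_le {φ : Fin 2 → Plane → ℝ} (hφ : ∀ i, IsSmooth (φ i))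
    (μ : Measure Plane) : eLpNorm (strainDensity φ) 2 μ ≤
      ∑ i, ∑ j, eLpNorm (fun x => (partialDeriv j (φ i) x + partialDeriv i (φ j) x) / 2) 2 μ := by
  have hc : ∀ i j, Continuous fun x => |(partialDeriv j (φ i) x + partialDeriv i (φ j) x) / 2| :=
    fun i j => ((((hφ i).partialDeriv j).continuous.add
      ((hφ j).partialDeriv i).continuous).div_const 2).abs
  have h := eLpNorm_sum_two_le
    (F := fun i x => ∑ j, |(partialDeriv j (φ i) x + partialDeriv i (φ j) x) / 2|)
    (fun i => continuous_finsetSum _ fun j _ => hc i j) μ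
  refine h.trans (Finset.sum_le_sum fun i _ => ?_)
  have h' := eLpNorm_sum_two_le (hc i) μ
  simp only [eLpNorm_abs] at h'
  exact h'

/-- Both sides are continuous in the jet, so the inequality passes from smooth jets to their
closure. The boundary component of the norm is handled by the trace inequality. -/
theorem korn_jets (hΩ : IsBoundedLipschitzDomain Ω) {U : Set Plane} (hU : IsOpen U)
    (hΓ : ΓD = frontier Ω ∩ U) (hne : ΓD.Nonempty) : ∃ C : ℝ, 0 ≤ C ∧ ∀ V ∈ sobolevJets Ω,
      ‖V‖ ≤ C * (∑ i, ∑ j, ‖jetStrain Ω i j V‖ + ∑ i, ‖traceOn Ω ΓD i V‖) := by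
  obtain ⟨C₁, h₁⟩ := hΩ.korn hU hΓ hne
  obtain ⟨C₂, h₂⟩ := hΩ.trace_le_sizeDensity
  refine ⟨2 * (C₂ * C₁ + C₁ + 2 * C₁), by positivity, fun V hV => ?_⟩
  refine closure_minimal (s := (smoothJets Ω : Set (JetSpace Ω)))
    (t := {V | ‖V‖ ≤ 2 * (C₂ * C₁ + C₁ + 2 * C₁) *
      (∑ i, ∑ j, ‖jetStrain Ω i j V‖ + ∑ i, ‖traceOn Ω ΓD i V‖)}) ?_ ?_ hV
  · rintro V ⟨φ, hφ, hVφ⟩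
    obtain ⟨s, hs⟩ : ∃ s, s = ∑ i, ∑ j, ‖jetStrain Ω i j V‖ + ∑ i, ‖traceOn Ω ΓD i V‖ := ⟨_, rfl⟩
    rw [Set.mem_ofPred_eq, ← hs]
    have hs0 : 0 ≤ s := by rw [hs]; positivity
    have hE : eLpNorm (strainDensity φ) 2 (volume.restrict Ω) +
        ∑ i, eLpNorm (φ i) 2 (lengthOn ΓD) ≤ ENNReal.ofReal s := by
      rw [hs, ENNReal.ofReal_add (by positivity) (by positivity),
        ENNReal.ofReal_sum_of_nonneg (fun _ _ => by positivity),
        ENNReal.ofReal_sum_of_nonneg (fun _ _ => by positivity)]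
      refine add_le_add ((eLpNorm_strainDensity_le hφ _).trans ?_) ?_
      · refine Finset.sum_le_sum fun i _ => ?_
        rw [ENNReal.ofReal_sum_of_nonneg (fun _ _ => by positivity)]
        refine Finset.sum_le_sum fun j _ => ?_
        rw [ofReal_norm, enorm_Lp_eq (hVφ.jetStrain i j)]
      · refine Finset.sum_le_sum fun i _ => ?_
        rw [ofReal_norm, enorm_Lp_eq ((traceOn_ae_eq V i).trans (ae_restrict_of_ae (hVφ i).2.2)),
          lengthOn_restrict hU hΓ]
    have hsize : eLpNorm (sizeDensity φ) 2 (volume.restrict Ω) ≤ C₁ * ENNReal.ofReal s :=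
      (h₁ φ hφ).trans (mul_le_mul' le_rfl hE)
    have hv : ∀ i, ‖jetValue Ω i V‖ ≤ C₁ * s := fun i => norm_le_of_enorm_le hs0 (by
      rw [enorm_Lp_eq (hVφ i).1]
      exact (eLpNorm_le_sizeDensity φ i _).trans hsize)
    have hw : ∀ i j, ‖jetPartial Ω i j V‖ ≤ C₁ * s := fun i j => norm_le_of_enorm_le hs0 (by
      rw [enorm_Lp_eq ((hVφ i).2.1 j)]
      exact (eLpNorm_partialDeriv_le_sizeDensity φ i j _).trans hsize)
    have ht : ∀ i, ‖jetTrace Ω i V‖ ≤ (C₂ * C₁ : ℝ≥0) * s := fun i => norm_le_of_enorm_le hs0 (by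
      rw [enorm_Lp_eq (hVφ i).2.2, ENNReal.coe_mul, mul_assoc]
      exact (h₂ φ hφ i).trans (mul_le_mul' le_rfl hsize))
    calc ‖V‖ ≤ _ := norm_jet_le V
      _ ≤ ∑ i : Fin 2, ((C₂ * C₁ : ℝ≥0) * s + C₁ * s + ∑ j : Fin 2, C₁ * s) := by
        gcongr with i _ j
        exacts [ht i, hv i, hw i j]
      _ = _ := by
        simp only [Finset.sum_const, Finset.card_univ, Fintype.card_fin, nsmul_eq_mul]
        push_cast
        ring
  · refine isClosed_le continuous_norm (continuous_const.mul (Continuous.add ?_ ?_))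
    · exact continuous_finsetSum _ fun i _ => continuous_finsetSum _ fun j _ =>
        (jetStrain Ω i j).continuous.norm
    · exact continuous_finsetSum _ fun i _ => (traceOn Ω ΓD i).continuous.norm

/-! ### The weighted elastic form -/

/-- Multiplication by a bounded function. -/
def mulOp (q : Lp ℝ ∞ (areaOn Ω)) : Lp ℝ 2 (areaOn Ω) →L[ℝ] Lp ℝ 2 (areaOn Ω) :=
  (ContinuousLinearMap.mul ℝ ℝ).holderL (areaOn Ω) ∞ 2 2 q

theorem mulOp_ae_eq (q : Lp ℝ ∞ (areaOn Ω)) (a : Lp ℝ 2 (areaOn Ω)) :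
    mulOp q a =ᵐ[areaOn Ω] fun x => q x * a x :=
  (ContinuousLinearMap.mul ℝ ℝ).coeFn_holder q a

theorem inner_mulOp_ae_eq (q : Lp ℝ ∞ (areaOn Ω)) (a b : Lp ℝ 2 (areaOn Ω)) :
    (fun x => inner ℝ (mulOp q a x) (b x)) =ᵐ[areaOn Ω] fun x => q x * (a x * b x) := by
  filter_upwards [mulOp_ae_eq q a] with x hx
  rw [hx, RCLike.inner_apply]
  simp only [conj_trivial]
  ring

theorem integrable_mulOp (q : Lp ℝ ∞ (areaOn Ω)) (a b : Lp ℝ 2 (areaOn Ω)) :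
    Integrable (fun x => q x * (a x * b x)) (areaOn Ω) :=
  (L2.integrable_inner (mulOp q a) b).congr (inner_mulOp_ae_eq q a b)

theorem inner_mulOp (q : Lp ℝ ∞ (areaOn Ω)) (a b : Lp ℝ 2 (areaOn Ω)) :
    inner ℝ (mulOp q a) b = ∫ x in Ω, q x * (a x * b x) := by
  rw [L2.inner_def]
  exact integral_congr_ae (inner_mulOp_ae_eq q a b)

theorem mul_norm_sq_le_inner_mulOp {q : Lp ℝ ∞ (areaOn Ω)} {q₀ : ℝ}
    (hq : ∀ᵐ x ∂(areaOn Ω), q₀ ≤ q x) (a : Lp ℝ 2 (areaOn Ω)) :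
    q₀ * ‖a‖ ^ 2 ≤ inner ℝ (mulOp q a) a := by
  rw [← real_inner_self_eq_norm_sq, inner_mulOp, L2.inner_def, ← integral_const_mul]
  refine integral_mono_ae ((L2.integrable_inner a a).const_mul q₀) (integrable_mulOp q a a) ?_
  filter_upwards [hq] with x hx
  rw [RCLike.inner_apply]
  simp only [conj_trivial]
  exact mul_le_mul_of_nonneg_right hx (mul_self_nonneg _)

/-- The trace of the strain of a jet. -/
def jetDiv (Ω : Set Plane) : JetSpace Ω →L[ℝ] Lp ℝ 2 (areaOn Ω) := ∑ i, jetStrain Ω i i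

/-- The elastic form with the weight `q`. -/
def weightForm (mu lam : ℝ) (q : Lp ℝ ∞ (areaOn Ω)) : JetSpace Ω →L[ℝ] JetSpace Ω →L[ℝ] ℝ :=
  (2 * mu) • (∑ i, ∑ j, ContinuousLinearMap.bilinearComp (innerSL ℝ)
    ((mulOp q).comp (jetStrain Ω i j)) (jetStrain Ω i j)) +
  lam • ContinuousLinearMap.bilinearComp (innerSL ℝ) ((mulOp q).comp (jetDiv Ω)) (jetDiv Ω)

theorem weightForm_apply (mu lam : ℝ) (q : Lp ℝ ∞ (areaOn Ω)) (U V : JetSpace Ω) :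
    weightForm mu lam q U V =
      2 * mu * (∑ i, ∑ j, inner ℝ (mulOp q (jetStrain Ω i j U)) (jetStrain Ω i j V)) +
      lam * inner ℝ (mulOp q (jetDiv Ω U)) (jetDiv Ω V) := by
  simp [weightForm, innerSL_apply_apply]
  ring

theorem jetDiv_ae_eq (U : JetSpace Ω) :
    jetDiv Ω U =ᵐ[areaOn Ω] fun x => ∑ i, jetStrain Ω i i U x := by
  have : jetDiv Ω U = jetStrain Ω 0 0 U + jetStrain Ω 1 1 U := by
    simp [jetDiv, Fin.sum_univ_two]
  rw [this]
  filter_upwards [Lp.coeFn_add (jetStrain Ω 0 0 U) (jetStrain Ω 1 1 U)] with x hx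
  rw [hx, Fin.sum_univ_two]
  rfl

theorem IsFieldJet.strain {U : JetSpace Ω} {u T : Plane → Plane} (h : IsFieldJet U u T)
    (i j : Fin 2) : jetStrain Ω i j U =ᵐ[areaOn Ω] fun x => strain Ω u x i j := by
  filter_upwards [h.jetStrain i j] with x hx
  rw [hx, MinCompliance.strain]
  simp [weakJacobian]
  ring

theorem frobenius_elasticTensor (mu lam : ℝ) (A B : Matrix (Fin 2) (Fin 2) ℝ) :
    frobenius (elasticTensor mu lam A) B =
      2 * mu * (∑ i, ∑ j, A i j * B i j) + lam * ((∑ i, A i i) * ∑ i, B i i) := by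
  simp [frobenius, elasticTensor, Matrix.trace, Fin.sum_univ_two]
  ring

/-- Bridge between integrals of representatives and a bounded bilinear form. Jets hold classes
modulo null sets, so the arbitrary choice inside `weakPartial` is harmless. -/
theorem elasticForm_eq_weightForm {mu lam p : ℝ} {ρ : Plane → ℝ} {q : Lp ℝ ∞ (areaOn Ω)}
    (hq : q =ᵐ[areaOn Ω] fun x => ρ x ^ p) {U V : JetSpace Ω} {u v T T' : Plane → Plane}
    (hU : IsFieldJet U u T) (hV : IsFieldJet V v T') :
    elasticForm Ω mu lam p ρ u v = weightForm mu lam q U V := by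
  have hI : ∀ a b : Lp ℝ 2 (areaOn Ω), Integrable (fun x => q x * (a x * b x)) (areaOn Ω) :=
    integrable_mulOp q
  rw [weightForm_apply]
  simp only [inner_mulOp]
  have h1 : ∑ i, ∑ j, ∫ x in Ω, q x * (jetStrain Ω i j U x * jetStrain Ω i j V x) =
      ∫ x in Ω, ∑ i, ∑ j, q x * (jetStrain Ω i j U x * jetStrain Ω i j V x) := by
    rw [integral_finsetSum _ fun i _ => integrable_finsetSum _ fun j _ => hI _ _]
    refine Finset.sum_congr rfl fun i _ => ?_
    rw [integral_finsetSum _ fun j _ => hI _ _]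
  rw [h1, ← integral_const_mul, ← integral_const_mul, ← integral_add]
  · refine integral_congr_ae ?_
    filter_upwards [hq, jetDiv_ae_eq U, jetDiv_ae_eq V,
      ae_all_iff.2 fun i => ae_all_iff.2 fun j => hU.strain i j,
      ae_all_iff.2 fun i => ae_all_iff.2 fun j => hV.strain i j] with x h2 h3 h4 h5 h6
    rw [h3, h4, h2, frobenius_elasticTensor]
    simp only [h5, h6, ← Finset.mul_sum]
    ring
  · exact (integrable_finsetSum _ fun i _ => integrable_finsetSum _ fun j _ => hI _ _).const_mul _
  · exact (hI _ _).const_mul _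

theorem weightForm_symm (mu lam : ℝ) (q : Lp ℝ ∞ (areaOn Ω)) (U V : JetSpace Ω) :
    weightForm mu lam q U V = weightForm mu lam q V U := by
  rw [weightForm_apply, weightForm_apply]
  have h : ∀ a b : Lp ℝ 2 (areaOn Ω), inner ℝ (mulOp q a) b = inner ℝ (mulOp q b) a :=
    fun a b => by
      rw [inner_mulOp, inner_mulOp]
      exact integral_congr_ae (Eventually.of_forall fun x => by ring)
  simp only [h (jetDiv Ω U), fun i j => h (jetStrain Ω i j U)]

theorem sum_norm_sq_le_weightForm {mu lam q₀ : ℝ} (hmu : 0 ≤ mu) (hlam : 0 ≤ lam)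
    (hq₀ : 0 ≤ q₀) {q : Lp ℝ ∞ (areaOn Ω)} (hq : ∀ᵐ x ∂(areaOn Ω), q₀ ≤ q x) (V : JetSpace Ω) :
    2 * mu * (q₀ * ∑ i, ∑ j, ‖jetStrain Ω i j V‖ ^ 2) ≤ weightForm mu lam q V V := by
  have h : ∀ a : Lp ℝ 2 (areaOn Ω), q₀ * ‖a‖ ^ 2 ≤ inner ℝ (mulOp q a) a :=
    mul_norm_sq_le_inner_mulOp hq
  have h5 : 0 ≤ inner ℝ (mulOp q (jetDiv Ω V)) (jetDiv Ω V) :=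
    (mul_nonneg hq₀ (sq_nonneg _)).trans (h _)
  rw [weightForm_apply]
  refine le_trans ?_ (le_add_of_nonneg_right (mul_nonneg hlam h5))
  refine mul_le_mul_of_nonneg_left ?_ (mul_nonneg zero_le_two hmu)
  simp only [Finset.mul_sum]
  exact Finset.sum_le_sum fun i _ => Finset.sum_le_sum fun j _ => h _

theorem weightForm_nonneg {mu lam : ℝ} (hmu : 0 ≤ mu) (hlam : 0 ≤ lam) {q : Lp ℝ ∞ (areaOn Ω)}
    (hq : ∀ᵐ x ∂(areaOn Ω), 0 ≤ q x) (U : JetSpace Ω) : 0 ≤ weightForm mu lam q U U := by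
  have := sum_norm_sq_le_weightForm hmu hlam le_rfl hq U
  rwa [zero_mul, mul_zero] at this

theorem sq_sum_norm_jetStrain_le (V : JetSpace Ω) :
    (∑ i, ∑ j, ‖jetStrain Ω i j V‖) ^ 2 ≤ 4 * ∑ i, ∑ j, ‖jetStrain Ω i j V‖ ^ 2 := by
  have := sq_sum_le_card_mul_sum_sq (s := (Finset.univ : Finset (Fin 2 × Fin 2)))
    (f := fun k => ‖jetStrain Ω k.1 k.2 V‖)
  rw [Fintype.sum_prod_type, Fintype.sum_prod_type] at this
  simpa only [Finset.card_univ, Fintype.card_prod, Fintype.card_fin, Nat.reduceMul,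
    Nat.cast_ofNat] using this

theorem weightForm_coercive (hΩ : IsBoundedLipschitzDomain Ω) {U : Set Plane} (hU : IsOpen U)
    (hΓ : ΓD = frontier Ω ∩ U) (hne : ΓD.Nonempty) {mu lam q₀ : ℝ} (hmu : 0 < mu)
    (hlam : 0 ≤ lam) (hq₀ : 0 < q₀) {q : Lp ℝ ∞ (areaOn Ω)}
    (hq : ∀ᵐ x ∂(areaOn Ω), q₀ ≤ q x) : ∃ c > 0, ∀ V ∈ dirichletJets Ω ΓD,
      c * ‖V‖ ^ 2 ≤ weightForm mu lam q V V := by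
  obtain ⟨C, hC, h⟩ := korn_jets hΩ hU hΓ hne
  -- The 4 comes from Cauchy–Schwarz over the four strain components; the `+ 1` keeps the
  -- denominator positive when `C = 0`.
  refine ⟨2 * mu * q₀ / (4 * (C ^ 2 + 1)), by positivity, fun V hV => ?_⟩
  obtain ⟨hV1, hV2⟩ := mem_dirichletJets.1 hV
  have h1 := h V hV1
  simp only [hV2, norm_zero, Finset.sum_const_zero, add_zero] at h1
  refine le_trans ?_ (sum_norm_sq_le_weightForm hmu.le hlam hq₀.le hq V)
  have h2 := sq_sum_norm_jetStrain_le V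
  generalize ∑ i, ∑ j, ‖jetStrain Ω i j V‖ ^ 2 = S at h2 ⊢
  generalize ∑ i, ∑ j, ‖jetStrain Ω i j V‖ = s at h1 h2
  have ht := norm_nonneg V
  generalize ‖V‖ = t at h1 ht ⊢
  have h3 : t ^ 2 ≤ C ^ 2 * (4 * S) := by
    calc t ^ 2 ≤ (C * s) ^ 2 := by gcongr
      _ = C ^ 2 * s ^ 2 := by ring
      _ ≤ _ := by gcongr
  have hS : 0 ≤ S := by nlinarith [sq_nonneg s]
  rw [div_mul_eq_mul_div, div_le_iff₀ (by positivity)]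
  have h4 : 2 * mu * q₀ * t ^ 2 ≤ 2 * mu * q₀ * (C ^ 2 * (4 * S)) := by gcongr
  have h5 : 0 ≤ 2 * mu * q₀ * S := by positivity
  linarith

end

section

variable {Ω ΓD ΓN : Set Plane} {f g : Plane → Plane} {mu lam p : ℝ}

/-! ### The state equation -/

theorem integral_inner_eq_sum {μ : Measure Plane} {F v : Plane → Plane} (hF : MemLp F 2 μ)
    {a : Fin 2 → Lp ℝ 2 μ} (ha : ∀ i, a i =ᵐ[μ] fun x => v x i) :
    ∫ x, inner ℝ (F x) (v x) ∂μ = ∑ i, inner ℝ ((hF.eval_piLp i).toLp _) (a i) := by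
  simp only [L2.inner_def]
  rw [← integral_finsetSum _ fun i _ => L2.integrable_inner _ _]
  refine integral_congr_ae ?_
  filter_upwards [ae_all_iff.2 ha, ae_all_iff.2 fun i => (hF.eval_piLp i).coeFn_toLp]
    with x h1 h2
  rw [PiLp.inner_apply]
  simp only [h1, h2]

theorem exists_load (hΓ : IsBoundarySplitting Ω ΓD ΓN) (hf : MemLp f 2 (areaOn Ω))
    (hg : MemLp g 2 (lengthOn ΓN)) : ∃ F : JetSpace Ω →L[ℝ] ℝ, ∀ V v T, IsFieldJet V v T →
      F V = (∫ x in Ω, inner ℝ (f x) (v x)) + ∫ x, inner ℝ (g x) (T x) ∂(lengthOn ΓN) := by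
  obtain ⟨U, hU, hN⟩ := hΓ.relOpenN
  rw [← lengthOn_restrict hU hN] at hg ⊢
  refine ⟨∑ i, (innerSL ℝ ((hf.eval_piLp i).toLp _)).comp (jetValue Ω i) +
    ∑ i, (innerSL ℝ ((hg.eval_piLp i).toLp _)).comp (traceOn Ω ΓN i), fun V v T h => ?_⟩
  rw [integral_inner_eq_sum hf fun i => (h i).1, integral_inner_eq_sum hg fun i =>
    (traceOn_ae_eq V i).trans (ae_restrict_of_ae (h i).2.2)]
  simp

/-- `U` is the jet of a state for the load `F` and the weight `q`. -/
def IsJetState (ΓD : Set Plane) (mu lam : ℝ) (F : JetSpace Ω →L[ℝ] ℝ) (q : Lp ℝ ∞ (areaOn Ω))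
    (U : JetSpace Ω) : Prop :=
  U ∈ dirichletJets Ω ΓD ∧ ∀ V ∈ dirichletJets Ω ΓD, weightForm mu lam q U V = F V

/-- Lax–Milgram on the closed subspace of Dirichlet jets. -/
theorem exists_isJetState (hΩ : IsBoundedLipschitzDomain Ω) (hΓ : IsBoundarySplitting Ω ΓD ΓN)
    (hne : ΓD.Nonempty) (hmu : 0 < mu) (hlam : 0 ≤ lam) {q₀ : ℝ} (hq₀ : 0 < q₀)
    {q : Lp ℝ ∞ (areaOn Ω)} (hq : ∀ᵐ x ∂(areaOn Ω), q₀ ≤ q x) (F : JetSpace Ω →L[ℝ] ℝ) :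
    ∃ U, IsJetState ΓD mu lam F q U := by
  obtain ⟨O, hO, hD⟩ := hΓ.relOpenD
  obtain ⟨c, hc, hcoer⟩ := weightForm_coercive hΩ hO hD hne hmu hlam hq₀ hq
  have : CompleteSpace (dirichletJets Ω ΓD) := (isClosed_dirichletJets Ω ΓD).completeSpace_coe
  obtain ⟨B, hB⟩ : ∃ B : dirichletJets Ω ΓD →L[ℝ] dirichletJets Ω ΓD →L[ℝ] ℝ,
      ∀ U V, B U V = weightForm mu lam q U V :=
    ⟨(weightForm mu lam q).bilinearComp (dirichletJets Ω ΓD).subtypeL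
      (dirichletJets Ω ΓD).subtypeL, fun U V => rfl⟩
  have hBc : IsCoercive B := ⟨c, hc, fun V => by
    rw [hB, mul_assoc, ← sq]
    exact hcoer V V.2⟩
  obtain ⟨G, hG⟩ : ∃ G : dirichletJets Ω ΓD →L[ℝ] ℝ, ∀ V, G V = F V :=
    ⟨F.comp (dirichletJets Ω ΓD).subtypeL, fun V => rfl⟩
  refine ⟨hBc.continuousLinearEquivOfBilin.symm
    ((InnerProductSpace.toDual ℝ (dirichletJets Ω ΓD)).symm G), Subtype.coe_prop _,
    fun V hV => ?_⟩
  have h1 := hB (hBc.continuousLinearEquivOfBilin.symm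
    ((InnerProductSpace.toDual ℝ (dirichletJets Ω ΓD)).symm G)) ⟨V, hV⟩
  rw [← hBc.continuousLinearEquivOfBilin_apply, ContinuousLinearEquiv.apply_symm_apply,
    InnerProductSpace.toDual_symm_apply, hG] at h1
  exact h1.symm

theorem IsJetState.unique (hΩ : IsBoundedLipschitzDomain Ω) (hΓ : IsBoundarySplitting Ω ΓD ΓN)
    (hne : ΓD.Nonempty) (hmu : 0 < mu) (hlam : 0 ≤ lam) {q₀ : ℝ} (hq₀ : 0 < q₀)
    {q : Lp ℝ ∞ (areaOn Ω)} (hq : ∀ᵐ x ∂(areaOn Ω), q₀ ≤ q x) {F : JetSpace Ω →L[ℝ] ℝ}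
    {U U' : JetSpace Ω} (h : IsJetState ΓD mu lam F q U) (h' : IsJetState ΓD mu lam F q U') :
    U = U' := by
  obtain ⟨O, hO, hD⟩ := hΓ.relOpenD
  obtain ⟨c, hc, hcoer⟩ := weightForm_coercive hΩ hO hD hne hmu hlam hq₀ hq
  have hd : U - U' ∈ dirichletJets Ω ΓD := sub_mem h.1 h'.1
  have h1 := hcoer _ hd
  have h0 : weightForm mu lam q (U - U') (U - U') = 0 := by
    rw [map_sub (weightForm mu lam q) U U', sub_apply, h.2 _ hd, h'.2 _ hd, sub_self]
  rw [h0] at h1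
  have h2 : ‖U - U'‖ ^ 2 ≤ 0 := by
    by_contra! h3
    have := mul_pos hc h3
    linarith
  have h3 : ‖U - U'‖ = 0 := by
    have := le_antisymm h2 (sq_nonneg _)
    exact pow_eq_zero_iff two_ne_zero |>.1 this
  exact sub_eq_zero.1 (norm_eq_zero.1 h3)

theorem IsState.exists_isJetState (hΩ : IsBoundedLipschitzDomain Ω)
    (hΓ : IsBoundarySplitting Ω ΓD ΓN) {F : JetSpace Ω →L[ℝ] ℝ}
    (hF : ∀ V v T, IsFieldJet V v T →
      F V = (∫ x in Ω, inner ℝ (f x) (v x)) + ∫ x, inner ℝ (g x) (T x) ∂(lengthOn ΓN))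
    {ρ : Plane → ℝ} {q : Lp ℝ ∞ (areaOn Ω)} (hq : q =ᵐ[areaOn Ω] fun x => ρ x ^ p)
    {u : Plane → Plane} (hu : IsState Ω ΓD ΓN f g mu lam p ρ u) :
    ∃ U T, IsJetState ΓD mu lam F q U ∧ IsFieldJet U u T := by
  obtain ⟨O, hO, hD⟩ := hΓ.relOpenD
  obtain ⟨⟨T, hT⟩, h⟩ := hu
  obtain ⟨U, hU, hUu⟩ := exists_jet_of_memVDWithTrace hΩ hO hD hT
  refine ⟨U, T, ⟨hU, fun V hV => ?_⟩, hUu⟩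
  obtain ⟨v, S, hv, hVv⟩ := exists_field_of_mem_dirichletJets hΩ hO hD hV
  rw [← elasticForm_eq_weightForm hq hUu hVv, h v S hv, hF V v S hVv]

theorem IsJetState.exists_isState (hΩ : IsBoundedLipschitzDomain Ω)
    (hΓ : IsBoundarySplitting Ω ΓD ΓN) {F : JetSpace Ω →L[ℝ] ℝ}
    (hF : ∀ V v T, IsFieldJet V v T →
      F V = (∫ x in Ω, inner ℝ (f x) (v x)) + ∫ x, inner ℝ (g x) (T x) ∂(lengthOn ΓN))
    {ρ : Plane → ℝ} {q : Lp ℝ ∞ (areaOn Ω)} (hq : q =ᵐ[areaOn Ω] fun x => ρ x ^ p)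
    {U : JetSpace Ω} (hU : IsJetState ΓD mu lam F q U) :
    ∃ u T, IsState Ω ΓD ΓN f g mu lam p ρ u ∧ IsFieldJet U u T := by
  obtain ⟨O, hO, hD⟩ := hΓ.relOpenD
  obtain ⟨u, T, hu, hUu⟩ := exists_field_of_mem_dirichletJets hΩ hO hD hU.1
  refine ⟨u, T, ⟨⟨T, hu⟩, fun v S hv => ?_⟩, hUu⟩
  obtain ⟨V, hV, hVv⟩ := exists_jet_of_memVDWithTrace hΩ hO hD hv
  rw [elasticForm_eq_weightForm hq hUu hVv, hU.2 V hV, hF V v S hVv]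

theorem IsFieldJet.ae_eq {U : JetSpace Ω} {u u' T T' : Plane → Plane} (h : IsFieldJet U u T)
    (h' : IsFieldJet U u' T') : u =ᵐ[areaOn Ω] u' := by
  filter_upwards [ae_all_iff.2 fun i => (h i).1, ae_all_iff.2 fun i => (h' i).1] with x h1 h2
  ext i
  rw [← h1 i, ← h2 i]

/-- The density weight `ρ ^ p` as a bounded function. -/
theorem exists_weight {rhoMin V₀ : ℝ} (hrho0 : 0 < rhoMin) (hp : 0 ≤ p) {ρ : Plane → ℝ}
    (hρ : ρ ∈ admissible Ω rhoMin V₀) : ∃ q : Lp ℝ ∞ (areaOn Ω),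
      (q =ᵐ[areaOn Ω] fun x => ρ x ^ p) ∧ ∀ᵐ x ∂(areaOn Ω), rhoMin ^ p ≤ q x ∧ q x ≤ 1 := by
  have hm : AEStronglyMeasurable (fun x => ρ x ^ p) (areaOn Ω) :=
    (hρ.1.1.aestronglyMeasurable.aemeasurable.pow_const p).aestronglyMeasurable
  have hb : ∀ᵐ x ∂(areaOn Ω), rhoMin ^ p ≤ ρ x ^ p ∧ ρ x ^ p ≤ 1 := by
    filter_upwards [hρ.2.1] with x hx
    exact ⟨Real.rpow_le_rpow hrho0.le hx.1 hp, Real.rpow_le_one (hrho0.le.trans hx.1) hx.2 hp⟩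
  have hL : MemLp (fun x => ρ x ^ p) ∞ (areaOn Ω) := memLp_top_of_bound hm 1 (by
    filter_upwards [hb] with x hx
    rw [Real.norm_of_nonneg ((Real.rpow_nonneg hrho0.le p).trans hx.1)]
    exact hx.2)
  refine ⟨hL.toLp _, hL.coeFn_toLp, ?_⟩
  filter_upwards [hL.coeFn_toLp, hb] with x h1 h2
  rw [h1]
  exact h2

/-- The compliance dominates the concave dual functional. -/
theorem IsJetState.two_mul_sub_le (hmu : 0 ≤ mu) (hlam : 0 ≤ lam) {q : Lp ℝ ∞ (areaOn Ω)}
    (hq : ∀ᵐ x ∂(areaOn Ω), 0 ≤ q x) {F : JetSpace Ω →L[ℝ] ℝ} {U V : JetSpace Ω}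
    (hU : IsJetState ΓD mu lam F q U) (hV : V ∈ dirichletJets Ω ΓD) :
    2 * F V - weightForm mu lam q V V ≤ weightForm mu lam q U U := by
  -- Expanding the energy of `U - V` gives the claim, because the energy pairing of `U` with `V`
  -- equals `F V`.
  have h1 := weightForm_nonneg hmu hlam hq (U - V)
  have h2 := hU.2 V hV
  have h3 := weightForm_symm mu lam q V U
  simp only [map_sub, sub_apply] at h1
  linarith

end

/-! ### A Rellich-type compactness theorem and its use for densities. -/

section

/-! ### Translations of Sobolev functions -/

theorem sq_lintegral_le {α : Type*} [MeasurableSpace α] (μ : Measure α) {h : α → ℝ≥0∞}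
    (hh : AEMeasurable h μ) : (∫⁻ x, h x ∂μ) ^ 2 ≤ μ Set.univ * ∫⁻ x, h x ^ 2 ∂μ := by
  have h4 := ENNReal.lintegral_mul_le_Lp_mul_Lq μ Real.HolderConjugate.two_two (f := h)
    (g := fun _ => 1) hh aemeasurable_const
  simp only [Pi.mul_apply, mul_one, ENNReal.one_rpow, lintegral_const, one_mul] at h4
  have h5 := pow_le_pow_left₀ zero_le h4 2
  refine h5.trans (le_of_eq ?_)
  rw [mul_pow, ← ENNReal.rpow_natCast, ← ENNReal.rpow_natCast, ← ENNReal.rpow_mul,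
    ← ENNReal.rpow_mul]
  norm_num
  rw [mul_comm]

theorem integrable_mul_comp_sub {w θ : Plane → ℝ} (hw : Integrable w) (hθ : Continuous θ)
    (hc : HasCompactSupport θ) (y : Plane) :
    Integrable (fun z : Plane × ℝ => w z.1 * θ (z.1 - z.2 • y))
      (volume.prod (volume.restrict (Set.Ioc 0 1))) := by
  obtain ⟨C, hC⟩ := hθ.bounded_above_of_compact_support hc
  have h1 : Integrable (fun z : Plane × ℝ => w z.1)
      (volume.prod (volume.restrict (Set.Ioc (0 : ℝ) 1))) := hw.comp_fst _
  have hcont : Continuous fun z : Plane × ℝ => θ (z.1 - z.2 • y) :=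
    hθ.comp (continuous_fst.sub (continuous_snd.smul continuous_const))
  exact h1.mul_bdd (c := C) hcont.aestronglyMeasurable (Eventually.of_forall fun z => hC _)

theorem integrable_mul_comp_add {S θ : Plane → ℝ} (hS : Integrable S) (hSm : Measurable S)
    (hθ : Continuous θ) (C : ℝ) (hC : ∀ x, ‖θ x‖ ≤ C) (y : Plane) :
    Integrable (fun z : Plane × ℝ => θ z.1 * S (z.1 + z.2 • y))
      (volume.prod (volume.restrict (Set.Ioc 0 1))) := by
  have hm : Measurable fun z : Plane × ℝ => S (z.1 + z.2 • y) :=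
    hSm.comp (continuous_fst.add (continuous_snd.smul continuous_const)).measurable
  have h1 : Integrable (fun z : Plane × ℝ => S (z.1 + z.2 • y))
      (volume.prod (volume.restrict (Set.Ioc 0 1))) := by
    refine ⟨hm.aestronglyMeasurable, ?_⟩
    rw [HasFiniteIntegral, lintegral_prod_symm _ hm.enorm.aemeasurable]
    have : ∀ t : ℝ, ∫⁻ x : Plane, ‖S (x + t • y)‖ₑ = ∫⁻ x, ‖S x‖ₑ := fun t =>
      lintegral_add_right_eq_self (fun x => ‖S x‖ₑ) (t • y)
    simp only [this, setLIntegral_const]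
    exact ENNReal.mul_lt_top hS.2 (by simp)
  exact h1.bdd_mul (c := C) (hθ.comp continuous_fst).aestronglyMeasurable
    (Eventually.of_forall fun z => hC _)

theorem sub_eq_integral_fderiv {ψ : Plane → ℝ} (hψ : IsSmooth ψ) (x y : Plane) :
    ψ (x - y) - ψ x = ∫ t in (0 : ℝ)..1, -fderiv ℝ ψ (x - t • y) y := by
  have h : ∀ t ∈ Set.uIcc (0 : ℝ) 1, HasDerivAt (fun t : ℝ => ψ (x - t • y))
      (-fderiv ℝ ψ (x - t • y) y) t := fun t _ => by
    have h1 : HasDerivAt (fun t : ℝ => x - t • y) (-y) t := by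
      have := ((hasDerivAt_id t).smul_const y).const_sub x
      simpa using this
    have h2 := (hψ.differentiable (x - t • y)).hasFDerivAt.comp_hasDerivAt t h1
    rw [map_neg] at h2
    exact h2
  have hc : Continuous fun t : ℝ => -fderiv ℝ ψ (x - t • y) y :=
    (((hψ.continuous_fderiv (by simp)).comp (by fun_prop)).clm_apply continuous_const).neg
  rw [intervalIntegral.integral_eq_sub_of_hasDerivAt h (hc.intervalIntegrable _ _)]
  simp

/-- Weak form of the fundamental theorem of calculus along the segment from `x` to `x + y`, with `S`
in the role of the derivative in direction `y`. Against a test function, the translations are moved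
onto the test function, where the classical theorem applies. -/
theorem ae_translate_sub_eq {w S : Plane → ℝ} {K : Set Plane} {y : Plane} (hw : Integrable w)
    (hS : Integrable S) (hSm : Measurable S) (hK : IsOpen K)
    (h : ∀ ψ, IsSmooth ψ → HasCompactSupport ψ → tsupport ψ ⊆ K → ∀ t ∈ Set.Icc (0 : ℝ) 1,
      ∫ x, w x * fderiv ℝ ψ (x - t • y) y = -∫ x, S x * ψ (x - t • y)) :
    ∀ᵐ x, x ∈ K → w (x + y) - w x - ∫ t in Set.Ioc (0 : ℝ) 1, S (x + t • y) = 0 := by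
  have hw1 : Integrable fun x => w (x + y) := hw.comp_add_right y
  have hS1 := integrable_mul_comp_add hS hSm (θ := fun _ => 1) continuous_const 1 (by simp) y
  simp only [one_mul] at hS1
  have hS2 : Integrable fun x => ∫ t in Set.Ioc (0 : ℝ) 1, S (x + t • y) := hS1.integral_prod_left
  refine hK.ae_eq_zero_of_integral_contDiff_smul_eq_zero
    (((hw1.sub hw).sub hS2).locallyIntegrable.locallyIntegrableOn K) fun ψ h1 h2 h3 => ?_
  obtain ⟨C, hC⟩ := h1.continuous.bounded_above_of_compact_support h2
  have hb : ∀ {u : Plane → ℝ}, Integrable u → Integrable fun x => ψ x * u x := fun hu =>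
    hu.bdd_mul (c := C) h1.continuous.aestronglyMeasurable (Eventually.of_forall hC)
  have e1 : ∫ x, ψ x • (w (x + y) - w x - ∫ t in Set.Ioc (0 : ℝ) 1, S (x + t • y)) =
      (∫ x, ψ x * w (x + y)) - (∫ x, ψ x * w x) -
        ∫ x, ψ x * ∫ t in Set.Ioc (0 : ℝ) 1, S (x + t • y) := by
    have i1 := hb hw1
    have i2 := hb hw
    have i3 := hb hS2
    have i4 : Integrable fun x => ψ x * w (x + y) - ψ x * w x := i1.sub i2
    rw [← integral_sub i1 i2, ← integral_sub i4 i3]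
    refine integral_congr_ae (Eventually.of_forall fun x => ?_)
    simp only [smul_eq_mul]
    ring
  have e2 : ∀ (u : Plane → ℝ) (c : Plane), ∫ x, ψ x * u (x + c) = ∫ x, u x * ψ (x - c) :=
    fun u c => by
      rw [← integral_add_right_eq_self (fun x => u x * ψ (x - c)) c]
      simp only [add_sub_cancel_right, mul_comm]
  have e3 : ∫ x, ψ x * ∫ t in Set.Ioc (0 : ℝ) 1, S (x + t • y) =
      ∫ t in Set.Ioc (0 : ℝ) 1, ∫ x, S x * ψ (x - t • y) := by
    have := integral_integral_swap (f := fun x t => ψ x * S (x + t • y))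
      (integrable_mul_comp_add hS hSm h1.continuous C hC y)
    simp only [integral_const_mul, e2] at this
    exact this
  have hfc : Continuous fun z => fderiv ℝ ψ z y :=
    (h1.continuous_fderiv (by simp)).clm_apply continuous_const
  have e4 : (∫ x, ψ x * w (x + y)) - (∫ x, ψ x * w x) =
      ∫ t in Set.Ioc (0 : ℝ) 1, ∫ x, -(w x * fderiv ℝ ψ (x - t • y) y) := by
    have h0 := integrable_mul_comp_sub hw hfc (h2.fderiv_apply ℝ y) y
    have := integral_integral_swap (f := fun x t => -(w x * fderiv ℝ ψ (x - t • y) y)) h0.neg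
    rw [← this, e2, ← integral_sub]
    · refine integral_congr_ae (Eventually.of_forall fun x => ?_)
      simp only [integral_neg, integral_const_mul]
      have h5 := sub_eq_integral_fderiv h1 x y
      rw [intervalIntegral.integral_of_le zero_le_one, integral_neg] at h5
      rw [← mul_neg, ← h5]
      ring
    · refine hw.mul_bdd (c := C) ?_ (Eventually.of_forall fun x => hC _)
      exact (h1.continuous.comp (continuous_id.sub continuous_const)).aestronglyMeasurable
    · exact hb hw
  rw [e1, e3, e4, sub_eq_zero]
  refine setIntegral_congr_fun measurableSet_Ioc fun t ht => ?_
  simp only [integral_neg]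
  rw [h ψ h1 h2 h3 t ⟨ht.1.le, ht.2⟩, neg_neg]

/-- Jensen's inequality in `t`, Tonelli, and translation invariance of the area. -/
theorem lintegral_translate_sub_sq_le {w S : Plane → ℝ} {K : Set Plane} {y : Plane}
    (hSm : Measurable S) (hK : MeasurableSet K)
    (h : ∀ᵐ x, x ∈ K → w (x + y) - w x - ∫ t in Set.Ioc (0 : ℝ) 1, S (x + t • y) = 0) :
    ∫⁻ x in K, ‖w (x + y) - w x‖ₑ ^ 2 ≤ ∫⁻ x, ‖S x‖ₑ ^ 2 := by
  have hm : Measurable fun z : Plane × ℝ => S (z.1 + z.2 • y) :=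
    hSm.comp (continuous_fst.add (continuous_snd.smul continuous_const)).measurable
  calc ∫⁻ x in K, ‖w (x + y) - w x‖ₑ ^ 2
      ≤ ∫⁻ x in K, ∫⁻ t in Set.Ioc (0 : ℝ) 1, ‖S (x + t • y)‖ₑ ^ 2 := by
        refine lintegral_mono_ae ?_
        rw [ae_restrict_iff' hK]
        filter_upwards [h] with x hx hxK
        rw [sub_eq_zero.1 (hx hxK)]
        have h1 := sq_lintegral_le (volume.restrict (Set.Ioc (0 : ℝ) 1))
          (h := fun t => ‖S (x + t • y)‖ₑ)
          (hm.comp (measurable_const.prodMk measurable_id)).enorm.aemeasurable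
        rw [Measure.restrict_apply_univ, Real.volume_Ioc, sub_zero, ENNReal.ofReal_one,
          one_mul] at h1
        exact (pow_le_pow_left₀ zero_le (enorm_integral_le_lintegral_enorm _) 2).trans h1
    _ ≤ ∫⁻ x, ∫⁻ t in Set.Ioc (0 : ℝ) 1, ‖S (x + t • y)‖ₑ ^ 2 := setLIntegral_le_lintegral _ _
    _ = ∫⁻ t in Set.Ioc (0 : ℝ) 1, ∫⁻ x, ‖S (x + t • y)‖ₑ ^ 2 :=
        lintegral_lintegral_swap (hm.enorm.pow_const 2).aemeasurable
    _ = ∫⁻ _ in Set.Ioc (0 : ℝ) 1, ∫⁻ x, ‖S x‖ₑ ^ 2 := by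
        refine lintegral_congr fun t => ?_
        exact lintegral_add_right_eq_self (fun x => ‖S x‖ₑ ^ 2) (t • y)
    _ = _ := by simp

end

section

variable {Ω : Set Plane}

/-! ### Compactness of bounded sequences with bounded gradients -/

theorem measurable_indicator_Lp (hΩ : IsOpen Ω) (w : Lp ℝ 2 (areaOn Ω)) :
    Measurable (Ω.indicator w) :=
  (Lp.stronglyMeasurable w).measurable.indicator hΩ.measurableSet

theorem lintegral_indicator_sq (hΩ : IsOpen Ω) (w : Lp ℝ 2 (areaOn Ω)) :
    ∫⁻ x, ‖Ω.indicator w x‖ₑ ^ 2 = ‖w‖ₑ ^ 2 := by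
  rw [Lp.enorm_def, eLpNorm_two_sq, ← lintegral_indicator hΩ.measurableSet]
  refine lintegral_congr fun x => ?_
  by_cases hx : x ∈ Ω <;> simp [hx]

theorem integrable_indicator_Lp (hΩ : IsOpen Ω) (hb : Bornology.IsBounded Ω)
    (w : Lp ℝ 2 (areaOn Ω)) : Integrable (Ω.indicator w) := by
  have : IsFiniteMeasure (areaOn Ω) := ⟨by simpa using hb.measure_lt_top⟩
  exact (integrable_indicator_iff hΩ.measurableSet).2 ((Lp.memLp w).integrable one_le_two)

theorem integral_indicator_mul (hΩ : IsOpen Ω) (w : Plane → ℝ) (θ : Plane → ℝ) :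
    ∫ x, Ω.indicator w x * θ x = ∫ x in Ω, w x * θ x := by
  rw [← integral_indicator hΩ.measurableSet]
  refine integral_congr_ae (Eventually.of_forall fun x => ?_)
  by_cases hx : x ∈ Ω <;> simp [hx]

theorem lintegral_translate_sub_sq_le_of_isWeakPartial (hΩ : IsOpen Ω)
    (hb : Bornology.IsBounded Ω) {w : Lp ℝ 2 (areaOn Ω)} {W : Fin 2 → Lp ℝ 2 (areaOn Ω)}
    (h : ∀ j, IsWeakPartial Ω j w (W j)) {K : Set Plane} (hK : IsOpen K) {y : Plane}
    (hKy : ∀ x ∈ K, ∀ t ∈ Set.Icc (0 : ℝ) 1, x + t • y ∈ Ω) :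
    ∫⁻ x in K, ‖Ω.indicator w (x + y) - Ω.indicator w x‖ₑ ^ 2 ≤
      (‖y‖ₑ * ∑ j, ‖W j‖ₑ) ^ 2 := by
  obtain ⟨S, hS⟩ : ∃ S : Plane → ℝ, S = fun x => ∑ j, y j * Ω.indicator (W j) x := ⟨_, rfl⟩
  have hWm := fun j => measurable_indicator_Lp hΩ (W j)
  have hWi := fun j => integrable_indicator_Lp hΩ hb (W j)
  have hSm : Measurable S := by
    rw [hS]; exact Finset.measurable_sum _ fun j _ => (hWm j).const_mul _
  have hSi : Integrable S := by
    rw [hS]; exact integrable_finsetSum _ fun j _ => (hWi j).const_mul _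
  have hle : ∫⁻ x, ‖S x‖ₑ ^ 2 ≤ (‖y‖ₑ * ∑ j, ‖W j‖ₑ) ^ 2 := by
    rw [← eLpNorm_two_sq, sq_le_sq_iff_ennreal]
    have e1 : S = ∑ j, y j • Ω.indicator (W j) := by
      rw [hS]; funext x; simp
    rw [e1, Finset.mul_sum]
    refine (eLpNorm_sum_le (fun j _ => ((hWm j).const_smul _).aestronglyMeasurable)
      one_le_two).trans (Finset.sum_le_sum fun j _ => ?_)
    rw [eLpNorm_const_smul]
    refine mul_le_mul' ?_ ?_
    · rw [← ofReal_norm, ← ofReal_norm]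
      exact ENNReal.ofReal_le_ofReal (PiLp.norm_apply_le y j)
    · rw [← sq_le_sq_iff_ennreal, eLpNorm_two_sq, lintegral_indicator_sq hΩ]
  refine (lintegral_translate_sub_sq_le (S := S) hSm hK.measurableSet ?_).trans hle
  refine ae_translate_sub_eq (integrable_indicator_Lp hΩ hb w) hSi hSm hK
    fun ψ h1 h2 h3 t ht => ?_
  have s1 : IsSmooth fun x => ψ (x - t • y) := h1.comp (contDiff_id.sub contDiff_const)
  have s2 : HasCompactSupport fun x => ψ (x - t • y) :=
    h2.comp_homeomorph (Homeomorph.subRight (t • y))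
  -- The segments issued from `K` stay in `Ω`, so the translated function is still admissible in the
  -- definition of the weak derivative.
  have s3 : tsupport (fun x => ψ (x - t • y)) ⊆ Ω := by
    have : tsupport (fun x => ψ (x - t • y)) ⊆ (fun x => x - t • y) ⁻¹' tsupport ψ :=
      closure_minimal (fun x hx => subset_tsupport ψ hx)
        ((isClosed_tsupport ψ).preimage (by fun_prop))
    intro x hx
    have := hKy _ (h3 (this hx)) t ht
    simpa using this
  have hp : ∀ j x, partialDeriv j (fun x => ψ (x - t • y)) x =
      partialDeriv j ψ (x - t • y) := fun j x => by
    rw [partialDeriv, fderiv_comp_sub]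
    rfl
  have hj : ∀ j, ∫ x, Ω.indicator w x * partialDeriv j ψ (x - t • y) =
      -∫ x, Ω.indicator (W j) x * ψ (x - t • y) := fun j => by
    have := h j _ s1 s2 s3
    simp only [hp] at this
    rw [integral_indicator_mul hΩ, integral_indicator_mul hΩ, this]
  have bdd : ∀ {u θ : Plane → ℝ}, Integrable u → Continuous θ → HasCompactSupport θ →
      Integrable fun x => u x * θ x := fun hu hθ hc => by
    obtain ⟨C, hC⟩ := hθ.bounded_above_of_compact_support hc
    exact hu.mul_bdd (c := C) hθ.aestronglyMeasurable (Eventually.of_forall hC)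
  have e1 : ∫ x, Ω.indicator w x * fderiv ℝ ψ (x - t • y) y =
      ∑ j, y j * ∫ x, Ω.indicator w x * partialDeriv j ψ (x - t • y) := by
    simp only [← integral_const_mul]
    rw [← integral_finsetSum]
    · refine integral_congr_ae (Eventually.of_forall fun x => ?_)
      simp only [fderiv_eq_sum, Finset.mul_sum]
      exact Finset.sum_congr rfl fun j _ => by ring
    · intro j _
      have := bdd (integrable_indicator_Lp hΩ hb w) (s1.partialDeriv j).continuous
        (hasCompactSupport_partialDeriv s2 j)
      simp only [hp] at this
      exact this.const_mul _
  have e2 : ∫ x, S x * ψ (x - t • y) = ∑ j, y j * ∫ x, Ω.indicator (W j) x * ψ (x - t • y) := by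
    simp only [← integral_const_mul]
    rw [← integral_finsetSum]
    · refine integral_congr_ae (Eventually.of_forall fun x => ?_)
      simp only [hS, Finset.sum_mul]
      exact Finset.sum_congr rfl fun j _ => by ring
    · intro j _
      exact (bdd (hWi j) s1.continuous s2).const_mul _
  rw [e1, e2, ← Finset.sum_neg_distrib]
  exact Finset.sum_congr rfl fun j _ => by rw [hj, mul_neg]

/-- The points of `Ω` at distance more than `r` from the complement. -/
def innerPart (Ω : Set Plane) (r : ℝ) : Set Plane := {x | r < Metric.infDist x Ωᶜ}

theorem isOpen_innerPart (r : ℝ) : IsOpen (innerPart Ω r) :=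
  isOpen_lt continuous_const (Metric.continuous_infDist_pt _)

theorem mem_of_mem_innerPart {x z : Plane} {r : ℝ} (hx : x ∈ innerPart Ω r) (hz : dist x z ≤ r) :
    z ∈ Ω := by
  by_contra h
  exact (((Metric.infDist_le_dist_of_mem h).trans hz).trans_lt hx).false

theorem exists_volume_diff_innerPart_lt (hΩ : IsOpen Ω) (hb : Bornology.IsBounded Ω)
    {ε : ℝ≥0∞} (hε : 0 < ε) : ∀ᶠ n : ℕ in atTop, volume (Ω \ innerPart Ω (1 / (n + 1))) < ε := by
  -- The distance to the empty set is 0 by convention, so the complement must contain a point; it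
  -- does because `Ω` is bounded.
  have hne : (Ωᶜ).Nonempty := by
    rw [Set.nonempty_compl]
    rintro rfl
    exact NormedSpace.unbounded_univ ℝ Plane hb
  have hanti : Antitone fun n : ℕ => Ω \ innerPart Ω (1 / ((n : ℝ) + 1)) := fun m n hmn =>
    Set.sdiff_subset_sdiff_right fun x (hx : 1 / ((m : ℝ) + 1) < _) => by
      have h1 : 1 / ((n : ℝ) + 1) ≤ 1 / ((m : ℝ) + 1) :=
        one_div_le_one_div_of_le (by positivity) (by gcongr)
      exact h1.trans_lt hx
  have ht := tendsto_measure_iInter_atTop (μ := volume)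
    (fun n => (hΩ.measurableSet.diff (isOpen_innerPart _).measurableSet).nullMeasurableSet)
    hanti ⟨0, (measure_mono Set.sdiff_subset).trans_lt hb.measure_lt_top |>.ne⟩
  have hempty : ⋂ n : ℕ, Ω \ innerPart Ω (1 / ((n : ℝ) + 1)) = ∅ := by
    rw [Set.eq_empty_iff_forall_notMem]
    intro x hx
    rw [Set.mem_iInter] at hx
    have hxΩ : x ∉ Ωᶜ := fun h => h (hx 0).1
    have hpos := (hΩ.isClosed_compl.notMem_iff_infDist_pos hne).1 hxΩ
    obtain ⟨n, hn⟩ := exists_nat_one_div_lt hpos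
    exact (hx n).2 hn
  rw [hempty, measure_empty] at ht
  exact ht.eventually_lt_const hε

/-- The average of a function over the ball of radius `r` about a point. -/
def ballAverage (r : ℝ) (v : Plane → ℝ) (x : Plane) : ℝ :=
  ∫ y, v (x + y) ∂((volume (Metric.ball (0 : Plane) r))⁻¹ • volume.restrict (Metric.ball 0 r))

theorem isProbabilityMeasure_ball {r : ℝ} (hr : 0 < r) : IsProbabilityMeasure
    ((volume (Metric.ball (0 : Plane) r))⁻¹ • volume.restrict (Metric.ball (0 : Plane) r)) :=
  ⟨by
    rw [Measure.smul_apply, Measure.restrict_apply_univ, smul_eq_mul]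
    exact ENNReal.inv_mul_cancel (Metric.measure_ball_pos _ _ hr).ne' measure_ball_lt_top.ne⟩

theorem measurable_ballAverage (r : ℝ) {v : Plane → ℝ} (hv : Measurable v) :
    Measurable (ballAverage r v) := by
  have h : StronglyMeasurable fun z : Plane × Plane => v (z.1 + z.2) :=
    (hv.comp measurable_add).stronglyMeasurable
  exact (StronglyMeasurable.integral_prod_right h).measurable

theorem enorm_ballAverage_sq_le {r : ℝ} (hr : 0 < r) {v : Plane → ℝ} (hv : Measurable v)
    (x : Plane) : ‖ballAverage r v x‖ₑ ^ 2 ≤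
      (volume (Metric.ball (0 : Plane) r))⁻¹ * ∫⁻ y, ‖v y‖ₑ ^ 2 := by
  have := isProbabilityMeasure_ball hr
  refine (pow_le_pow_left₀ zero_le (enorm_integral_le_lintegral_enorm _) 2).trans ?_
  refine (sq_lintegral_le _ (hv.comp (measurable_const_add x)).enorm.aemeasurable).trans ?_
  rw [measure_univ, one_mul, lintegral_smul_measure, smul_eq_mul]
  refine mul_le_mul' le_rfl ((setLIntegral_le_lintegral _ _).trans (le_of_eq ?_))
  exact lintegral_add_left_eq_self (fun y => ‖v y‖ₑ ^ 2) x

/-- By Jensen's inequality and Tonelli, the error of averaging is at most the mean of the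
translation errors. -/
theorem lintegral_sub_ballAverage_sq_le {r : ℝ} (hr : 0 < r) {v : Plane → ℝ} (hv : Measurable v)
    (hvi : Integrable v) {K : Set Plane} {A : ℝ≥0∞}
    (h : ∀ y ∈ Metric.ball (0 : Plane) r, ∫⁻ x in K, ‖v (x + y) - v x‖ₑ ^ 2 ≤ A) :
    ∫⁻ x in K, ‖v x - ballAverage r v x‖ₑ ^ 2 ≤ A := by
  have := isProbabilityMeasure_ball hr
  obtain ⟨ν, hν⟩ : ∃ ν : Measure Plane, ν =
    (volume (Metric.ball (0 : Plane) r))⁻¹ • volume.restrict (Metric.ball (0 : Plane) r) :=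
    ⟨_, rfl⟩
  rw [← hν] at this
  have hm : Measurable fun z : Plane × Plane => ‖v (z.1 + z.2) - v z.1‖ₑ ^ 2 :=
    ((hv.comp measurable_add).sub (hv.comp measurable_fst)).enorm.pow_const 2
  have hpt : ∀ x, ‖v x - ballAverage r v x‖ₑ ^ 2 ≤ ∫⁻ y, ‖v (x + y) - v x‖ₑ ^ 2 ∂ν := fun x => by
    have hi : Integrable (fun y => v (x + y)) ν := by
      rw [hν]
      exact ((hvi.comp_add_left x).integrableOn).smul_measure
        (ENNReal.inv_ne_top.2 (Metric.measure_ball_pos _ _ hr).ne')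
    have e1 : ballAverage r v x - v x = ∫ y, (v (x + y) - v x) ∂ν := by
      rw [integral_sub hi (integrable_const _), integral_const, probReal_univ, one_smul,
        ballAverage, hν]
    rw [← enorm_neg, neg_sub, e1]
    refine (pow_le_pow_left₀ zero_le (enorm_integral_le_lintegral_enorm _) 2).trans ?_
    refine (sq_lintegral_le _ ((hv.comp (measurable_const_add x)).sub
      measurable_const).enorm.aemeasurable).trans ?_
    rw [measure_univ, one_mul]
    exact le_rfl
  calc _ ≤ ∫⁻ x in K, ∫⁻ y, ‖v (x + y) - v x‖ₑ ^ 2 ∂ν := lintegral_mono hpt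
    _ = ∫⁻ y, (∫⁻ x in K, ‖v (x + y) - v x‖ₑ ^ 2) ∂ν :=
        lintegral_lintegral_swap hm.aemeasurable
    _ ≤ ∫⁻ _, A ∂ν := by
        refine lintegral_mono_ae ?_
        rw [hν]
        exact Measure.ae_smul_measure (ae_restrict_of_forall_mem measurableSet_ball h) _
    _ = A := by rw [lintegral_const, measure_univ, mul_one]

/-- An average at a fixed point is an inner product with a fixed indicator function, so weak
convergence gives pointwise convergence. -/
theorem tendsto_ballAverage (hΩ : IsOpen Ω) (hb : Bornology.IsBounded Ω)
    {w : ℕ → Lp ℝ 2 (areaOn Ω)}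
    (hw : ∀ θ : Lp ℝ 2 (areaOn Ω), Tendsto (fun n => inner ℝ (w n) θ) atTop (𝓝 0))
    (r : ℝ) (x : Plane) :
    Tendsto (fun n => ballAverage r (Ω.indicator (w n)) x) atTop (𝓝 0) := by
  have : IsFiniteMeasure (areaOn Ω) := ⟨by simpa using hb.measure_lt_top⟩
  obtain ⟨χ, hχ⟩ : ∃ χ : Plane → ℝ, χ = (Metric.ball x r).indicator fun _ => 1 := ⟨_, rfl⟩
  have hL : MemLp χ 2 (areaOn Ω) := by
    rw [hχ]; exact (memLp_const (1 : ℝ)).indicator measurableSet_ball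
  have e : ∀ n, ballAverage r (Ω.indicator (w n)) x =
      (volume (Metric.ball (0 : Plane) r))⁻¹.toReal * inner ℝ (w n) (hL.toLp χ) := fun n => by
    rw [ballAverage, integral_smul_measure, smul_eq_mul]
    congr 1
    have e2 := integral_mul_eq_inner (Lp.memLp (w n)) hL
    rw [Lp.toLp_coeFn] at e2
    rw [← e2, ← integral_indicator_mul hΩ, ← integral_indicator measurableSet_ball,
      ← integral_add_left_eq_self (fun z => Ω.indicator (w n) z * χ z) x]
    refine integral_congr_ae (Eventually.of_forall fun y => ?_)
    by_cases hy : y ∈ Metric.ball (0 : Plane) r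
    · have : x + y ∈ Metric.ball x r := by simpa using hy
      simp [hχ, hy, this]
    · have : x + y ∉ Metric.ball x r := by simpa using hy
      simp [hχ, hy, this]
  simp only [e]
  have := (hw (hL.toLp χ)).const_mul (volume (Metric.ball (0 : Plane) r))⁻¹.toReal
  rwa [mul_zero] at this

theorem tendsto_lintegral_ballAverage (hΩ : IsOpen Ω) (hb : Bornology.IsBounded Ω)
    {w : ℕ → Lp ℝ 2 (areaOn Ω)}
    (hw : ∀ θ : Lp ℝ 2 (areaOn Ω), Tendsto (fun n => inner ℝ (w n) θ) atTop (𝓝 0))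
    {M : ℝ≥0∞} (hM : M ≠ ⊤) (hwM : ∀ n, ‖w n‖ₑ ^ 2 ≤ M) {r : ℝ} (hr : 0 < r) :
    Tendsto (fun n => ∫⁻ x in Ω, ‖ballAverage r (Ω.indicator (w n)) x‖ₑ ^ 2) atTop (𝓝 0) := by
  have hm := fun n => measurable_indicator_Lp hΩ (w n)
  have h := tendsto_lintegral_of_dominated_convergence (μ := areaOn Ω)
    (F := fun n x => ‖ballAverage r (Ω.indicator (w n)) x‖ₑ ^ 2) (f := fun _ => 0)
    (fun _ => (volume (Metric.ball (0 : Plane) r))⁻¹ * M)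
    (fun n => (measurable_ballAverage r (hm n)).enorm.pow_const 2)
    (fun n => Eventually.of_forall fun x => (enorm_ballAverage_sq_le hr (hm n) x).trans (by
      rw [lintegral_indicator_sq hΩ]
      exact mul_le_mul' le_rfl (hwM n)))
    (by
      rw [lintegral_const, Measure.restrict_apply_univ]
      exact ENNReal.mul_ne_top (ENNReal.mul_ne_top
        (ENNReal.inv_ne_top.2 (Metric.measure_ball_pos _ _ hr).ne') hM) hb.measure_lt_top.ne)
    (Eventually.of_forall fun x => by
      have h1 := (tendsto_ballAverage hΩ hb hw r x).enorm
      have h2 := ENNReal.Tendsto.pow (n := 2) h1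
      simpa using h2)
  rwa [lintegral_zero] at h

/-- A bounded sequence with bounded gradients that converges weakly to zero converges strongly. -/
theorem tendsto_norm_of_tendsto_inner (hΩ : IsOpen Ω) (hb : Bornology.IsBounded Ω)
    {w : ℕ → Lp ℝ 2 (areaOn Ω)} {W : ℕ → Fin 2 → Lp ℝ 2 (areaOn Ω)}
    (hW : ∀ n j, IsWeakPartial Ω j (w n) (W n j)) {M : ℝ≥0} (hM : ∀ n j, ‖W n j‖ₑ ≤ M)
    (h1 : ∀ n, ∀ᵐ x ∂(areaOn Ω), ‖w n x‖ₑ ≤ 1)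
    (hw : ∀ θ : Lp ℝ 2 (areaOn Ω), Tendsto (fun n => inner ℝ (w n) θ) atTop (𝓝 0)) :
    Tendsto (fun n => ‖w n‖ₑ ^ 2) atTop (𝓝 0) := by
  -- The uniform bound makes the contribution of a thin boundary strip small without any regularity
  -- of the boundary.
  have hbd : ∀ A ⊆ Ω, ∀ n, ∫⁻ x in A, ‖w n x‖ₑ ^ 2 ≤ volume A := fun A hA n => by
    calc _ ≤ ∫⁻ _ in A, 1 := by
          refine lintegral_mono_ae ?_
          filter_upwards [ae_mono (Measure.restrict_mono hA le_rfl) (h1 n)] with x hx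
          exact pow_le_one₀ zero_le hx
      _ = _ := by simp
  have hwM : ∀ n, ‖w n‖ₑ ^ 2 ≤ volume Ω := fun n => by
    rw [Lp.enorm_def, eLpNorm_two_sq]
    exact hbd Ω le_rfl n
  rw [ENNReal.tendsto_nhds_zero]
  intro ε hε
  have hε4 : 0 < ε / 4 := ENNReal.div_pos hε.ne' (by norm_num)
  have hr0 : Tendsto (fun n : ℕ => 2 * (ENNReal.ofReal (1 / ((n : ℝ) + 1)) * (2 * M)) ^ 2) atTop
      (𝓝 0) := by
    have t1 : Tendsto (fun n : ℕ => ENNReal.ofReal (1 / ((n : ℝ) + 1))) atTop (𝓝 0) := by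
      have := ENNReal.tendsto_ofReal (tendsto_one_div_add_atTop_nhds_zero_nat (𝕜 := ℝ))
      rwa [ENNReal.ofReal_zero] at this
    have t2 := ENNReal.Tendsto.mul_const t1 (b := 2 * (M : ℝ≥0∞))
      (Or.inr (ENNReal.mul_ne_top (by norm_num) ENNReal.coe_ne_top))
    have t3 := ENNReal.Tendsto.const_mul (ENNReal.Tendsto.pow (n := 2) t2) (a := 2)
      (Or.inr (by norm_num))
    simpa using t3
  -- The radius `1 / (k + 1)` is fixed before `n`: it makes both the boundary strip and the
  -- averaging error smaller than `ε / 4`, uniformly in `n`. The averages then tend to zero for this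
  -- radius.
  obtain ⟨k, hk1, hk2⟩ := ((exists_volume_diff_innerPart_lt hΩ hb hε4).and
    (hr0.eventually_lt_const hε4)).exists
  obtain ⟨r, hr⟩ : ∃ r : ℝ, r = 1 / ((k : ℝ) + 1) := ⟨_, rfl⟩
  have hrpos : 0 < r := by rw [hr]; positivity
  rw [← hr] at hk1 hk2
  have hA := tendsto_lintegral_ballAverage hΩ hb hw hb.measure_lt_top.ne hwM hrpos
  filter_upwards [hA.eventually_lt_const hε4] with n hn
  have hKΩ : innerPart Ω r ⊆ Ω := fun x hx =>
    mem_of_mem_innerPart hx (by rw [dist_self]; exact hrpos.le)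
  have hm := measurable_indicator_Lp hΩ (w n)
  have hKm := (isOpen_innerPart (Ω := Ω) r).measurableSet
  have htr : ∫⁻ x in innerPart Ω r, ‖Ω.indicator (w n) x -
      ballAverage r (Ω.indicator (w n)) x‖ₑ ^ 2 ≤ (ENNReal.ofReal r * (2 * M)) ^ 2 := by
    refine lintegral_sub_ballAverage_sq_le hrpos hm (integrable_indicator_Lp hΩ hb _)
      fun y hy => ?_
    have hy' : ‖y‖ ≤ r := by simpa using (Metric.mem_ball.1 hy).le
    refine (lintegral_translate_sub_sq_le_of_isWeakPartial hΩ hb (hW n)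
      (isOpen_innerPart r) fun x hx t ht => mem_of_mem_innerPart hx ?_).trans ?_
    · rw [dist_self_add_right, norm_smul, Real.norm_of_nonneg ht.1]
      exact (mul_le_of_le_one_left (norm_nonneg y) ht.2).trans hy'
    · have h2 : ∑ j, ‖W n j‖ₑ ≤ 2 * M := by
        rw [Fin.sum_univ_two, two_mul]
        exact add_le_add (hM n 0) (hM n 1)
      gcongr
      rw [← ofReal_norm]
      exact ENNReal.ofReal_le_ofReal hy'
  have hK : ∫⁻ x in innerPart Ω r, ‖w n x‖ₑ ^ 2 ≤ 2 * (ε / 4) + ε / 4 := by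
    calc ∫⁻ x in innerPart Ω r, ‖w n x‖ₑ ^ 2
        ≤ ∫⁻ x in innerPart Ω r, (2 * ‖ballAverage r (Ω.indicator (w n)) x‖ₑ ^ 2 +
          2 * ‖Ω.indicator (w n) x - ballAverage r (Ω.indicator (w n)) x‖ₑ ^ 2) := by
          refine setLIntegral_mono_ae' hKm (Eventually.of_forall fun x hx => ?_)
          have h3 := enorm_sub_sq_le (ballAverage r (Ω.indicator (w n)) x)
            (ballAverage r (Ω.indicator (w n)) x - Ω.indicator (w n) x)
          rw [sub_sub_cancel, Set.indicator_of_mem (hKΩ hx), mul_add] at h3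
          refine h3.trans (le_of_eq ?_)
          rw [Set.indicator_of_mem (hKΩ hx), ← enorm_neg (w n x - _), neg_sub]
      _ = 2 * (∫⁻ x in innerPart Ω r, ‖ballAverage r (Ω.indicator (w n)) x‖ₑ ^ 2) +
          2 * ∫⁻ x in innerPart Ω r,
            ‖Ω.indicator (w n) x - ballAverage r (Ω.indicator (w n)) x‖ₑ ^ 2 := by
          have m1 := (measurable_ballAverage r hm).enorm.pow_const 2
          have m2 : Measurable fun x => ‖Ω.indicator (w n) x -
              ballAverage r (Ω.indicator (w n)) x‖ₑ ^ 2 := (hm.sub (measurable_ballAverage r hm)).enorm.pow_const 2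
          rw [lintegral_add_left (m1.const_mul 2), lintegral_const_mul _ m1,
            lintegral_const_mul 2 m2]
      _ ≤ 2 * (ε / 4) + 2 * (ENNReal.ofReal r * (2 * M)) ^ 2 := by
          gcongr
          exact (lintegral_mono_set hKΩ).trans hn.le
      _ ≤ _ := by gcongr
  rw [Lp.enorm_def, eLpNorm_two_sq]
  have hun : Ω ⊆ (Ω \ innerPart Ω r) ∪ innerPart Ω r := by rw [Set.sdiff_union_self]; exact
    Set.subset_union_left
  calc ∫⁻ x in Ω, ‖w n x‖ₑ ^ 2 ≤ ∫⁻ x in (Ω \ innerPart Ω r) ∪ innerPart Ω r, ‖w n x‖ₑ ^ 2 :=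
        lintegral_mono_set hun
    _ ≤ (∫⁻ x in Ω \ innerPart Ω r, ‖w n x‖ₑ ^ 2) + ∫⁻ x in innerPart Ω r, ‖w n x‖ₑ ^ 2 :=
        lintegral_union_le _ _ _
    _ ≤ ε / 4 + (2 * (ε / 4) + ε / 4) := by
        gcongr
        exact (hbd _ Set.sdiff_subset n).trans hk1.le
    _ = 4 * (ε / 4) := by ring
    _ = ε := ENNReal.mul_div_cancel (by norm_num) (by norm_num)

end

section

variable {Ω : Set Plane}

/-! ### Weak compactness of the admissible densities -/

/-- Sequential Banach–Alaoglu, carried to `H` by the Riesz isomorphism. -/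
theorem exists_subseq_tendsto_inner {H : Type*} [NormedAddCommGroup H] [InnerProductSpace ℝ H]
    [CompleteSpace H] [TopologicalSpace.SeparableSpace H] {x : ℕ → H} {M : ℝ}
    (hM : ∀ n, ‖x n‖ ≤ M) : ∃ (y : H) (φ : ℕ → ℕ), StrictMono φ ∧
      ∀ θ, Tendsto (fun n => inner ℝ (x (φ n)) θ) atTop (𝓝 (inner ℝ y θ)) := by
  obtain ⟨ξ, -, φ, hφ, hlim⟩ := WeakDual.isSeqCompact_closedBall ℝ H 0 M
    (x := fun n => StrongDual.toWeakDual (InnerProductSpace.toDual ℝ H (x n))) fun n => by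
      rw [Set.mem_preimage, mem_closedBall_zero_iff]
      exact ((InnerProductSpace.toDual ℝ H).norm_map (x n)).trans_le (hM n)
  refine ⟨(InnerProductSpace.toDual ℝ H).symm (WeakDual.toStrongDual ξ), φ, hφ, fun θ => ?_⟩
  rw [InnerProductSpace.toDual_symm_apply]
  exact ((WeakDual.eval_continuous θ).tendsto ξ).comp hlim

theorem tendsto_setIntegral_of_tendsto_inner [IsFiniteMeasure (areaOn Ω)]
    {v : ℕ → Lp ℝ 2 (areaOn Ω)} {r : Lp ℝ 2 (areaOn Ω)}
    (h : ∀ θ, Tendsto (fun n => inner ℝ (v n) θ) atTop (𝓝 (inner ℝ r θ))) {s : Set Plane}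
    (hs : MeasurableSet s) : Tendsto (fun n => ∫ x in s, v n x ∂(areaOn Ω)) atTop
      (𝓝 (∫ x in s, r x ∂(areaOn Ω))) := by
  have e : ∀ u : Lp ℝ 2 (areaOn Ω), inner ℝ u (indicatorConstLp 2 hs
      (measure_ne_top (areaOn Ω) s) 1) = ∫ x in s, u x ∂(areaOn Ω) := fun u => by
    rw [real_inner_comm]
    exact L2.inner_indicatorConstLp_one hs _ u
  simpa only [e] using h (indicatorConstLp 2 hs (measure_ne_top (areaOn Ω) s) 1)

/-- Weak limits preserve integrals over measurable sets, and inequalities between these integrals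
give the inequality almost everywhere. -/
theorem ae_le_of_tendsto_inner [IsFiniteMeasure (areaOn Ω)]
    {v : ℕ → Lp ℝ 2 (areaOn Ω)} {r : Lp ℝ 2 (areaOn Ω)}
    (h : ∀ θ, Tendsto (fun n => inner ℝ (v n) θ) atTop (𝓝 (inner ℝ r θ))) {c : ℝ}
    (hv : ∀ n, ∀ᵐ x ∂(areaOn Ω), v n x ≤ c) : ∀ᵐ x ∂(areaOn Ω), r x ≤ c := by
  refine ae_le_of_forall_setIntegral_le ((Lp.memLp r).integrable one_le_two)
    (integrable_const c) fun s hs _ => ?_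
  refine le_of_tendsto (tendsto_setIntegral_of_tendsto_inner h hs) (Eventually.of_forall fun n => ?_)
  refine setIntegral_mono_ae ((Lp.memLp (v n)).integrable one_le_two).integrableOn
    (integrable_const c).integrableOn (hv n)

theorem ae_ge_of_tendsto_inner [IsFiniteMeasure (areaOn Ω)]
    {v : ℕ → Lp ℝ 2 (areaOn Ω)} {r : Lp ℝ 2 (areaOn Ω)}
    (h : ∀ θ, Tendsto (fun n => inner ℝ (v n) θ) atTop (𝓝 (inner ℝ r θ))) {c : ℝ}
    (hv : ∀ n, ∀ᵐ x ∂(areaOn Ω), c ≤ v n x) : ∀ᵐ x ∂(areaOn Ω), c ≤ r x := by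
  refine ae_le_of_forall_setIntegral_le (integrable_const c)
    ((Lp.memLp r).integrable one_le_two) fun s hs _ => ?_
  refine ge_of_tendsto (tendsto_setIntegral_of_tendsto_inner h hs) (Eventually.of_forall fun n => ?_)
  refine setIntegral_mono_ae (integrable_const c).integrableOn
    ((Lp.memLp (v n)).integrable one_le_two).integrableOn (hv n)

theorem IsWeakPartial.sub {v v' w w' : Lp ℝ 2 (areaOn Ω)} {i : Fin 2}
    (h : IsWeakPartial Ω i v w) (h' : IsWeakPartial Ω i v' w') :
    IsWeakPartial Ω i ((v - v' : Lp ℝ 2 (areaOn Ω))) ((w - w' : Lp ℝ 2 (areaOn Ω))) := by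
  refine IsWeakPartial.congr (v := fun x => v x - v' x) (w := fun x => w x - w' x) ?_
    (Lp.coeFn_sub v v').symm (Lp.coeFn_sub w w').symm
  intro φ h1 h2 h3
  have hφ := memLp_of_hasCompactSupport h1.continuous h2 Ω
  have hφ' := memLp_of_hasCompactSupport (IsSmooth.partialDeriv h1 i).continuous
    (hasCompactSupport_partialDeriv h2 i) Ω
  have hi : ∀ (u : Lp ℝ 2 (areaOn Ω)) {θ : Plane → ℝ}, MemLp θ 2 (areaOn Ω) →
      Integrable (fun x => u x * θ x) (areaOn Ω) := fun u _ hθ => (Lp.memLp u).integrable_mul hθ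
  simp only [sub_mul]
  rw [integral_sub (hi v hφ') (hi v' hφ'), integral_sub (hi w hφ) (hi w' hφ), h φ h1 h2 h3,
    h' φ h1 h2 h3]
  ring

/-- Successive subsequences make the densities and their two derivatives converge weakly. The
bounds, the volume and the weak derivatives pass to the weak limit. The compactness theorem applied
to the differences gives strong convergence, and a last subsequence converges almost everywhere. -/
theorem exists_subseq_admissible (hΩ : IsBoundedLipschitzDomain Ω) {rhoMin V₀ : ℝ}
    (hrho0 : 0 < rhoMin) {ρ : ℕ → Plane → ℝ} (hρ : ∀ n, ρ n ∈ admissible Ω rhoMin V₀)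
    {G : ℕ → Fin 2 → Lp ℝ 2 (areaOn Ω)}
    (hG : ∀ n j, G n j =ᵐ[areaOn Ω] weakPartial Ω j (ρ n)) {M : ℝ} (hM : ∀ n j, ‖G n j‖ ≤ M) :
    ∃ ρs ∈ admissible Ω rhoMin V₀, ∃ φ : ℕ → ℕ, StrictMono φ ∧
      (∀ᵐ x ∂(areaOn Ω), Tendsto (fun n => ρ (φ n) x) atTop (𝓝 (ρs x))) ∧
      ∃ g : Fin 2 → Lp ℝ 2 (areaOn Ω), ∀ j, g j =ᵐ[areaOn Ω] weakPartial Ω j ρs ∧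
        ∀ θ, Tendsto (fun n => inner ℝ (G (φ n) j) θ) atTop (𝓝 (inner ℝ (g j) θ)) := by
  have : Fact ((2 : ℝ≥0∞) ≠ ⊤) := ⟨by norm_num⟩
  have : IsFiniteMeasure (areaOn Ω) := ⟨by simpa using hΩ.isBounded.measure_lt_top⟩
  obtain ⟨R, hR⟩ : ∃ R : ℕ → Lp ℝ 2 (areaOn Ω), ∀ n, R n =ᵐ[areaOn Ω] ρ n :=
    ⟨fun n => (hρ n).1.1.toLp _, fun n => (hρ n).1.1.coeFn_toLp⟩
  have hRI : ∀ n, ∀ᵐ x ∂(areaOn Ω), R n x ∈ Set.Icc rhoMin 1 := fun n => by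
    filter_upwards [hR n, (hρ n).2.1] with x h1 h2
    rwa [h1]
  have hRb : ∀ n, ‖R n‖ ≤ measureUnivNNReal (areaOn Ω) ^ (2 : ℝ≥0∞).toReal⁻¹ * 1 := fun n => by
    refine Lp.norm_le_of_ae_bound zero_le_one ?_
    filter_upwards [hRI n] with x hx
    rw [Real.norm_of_nonneg (hrho0.le.trans hx.1)]
    exact hx.2
  have hRG : ∀ n j, IsWeakPartial Ω j (R n) (G n j) := fun n j =>
    ((hρ n).1.isWeakPartial j).congr (hR n).symm (hG n j).symm
  obtain ⟨r, φ₀, hφ₀, hr⟩ := exists_subseq_tendsto_inner hRb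
  obtain ⟨g₀, φ₁, hφ₁, hg₀⟩ := exists_subseq_tendsto_inner fun n => hM (φ₀ n) 0
  obtain ⟨g₁, φ₂, hφ₂, hg₁⟩ := exists_subseq_tendsto_inner fun n => hM (φ₀ (φ₁ n)) 1
  obtain ⟨φ, hφ⟩ : ∃ φ : ℕ → ℕ, φ = fun n => φ₀ (φ₁ (φ₂ n)) := ⟨_, rfl⟩
  have hφm : StrictMono φ := by rw [hφ]; exact hφ₀.comp (hφ₁.comp hφ₂)
  obtain ⟨g, hg⟩ : ∃ g : Fin 2 → Lp ℝ 2 (areaOn Ω), g = ![g₀, g₁] := ⟨_, rfl⟩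
  have hwr : ∀ θ, Tendsto (fun n => inner ℝ (R (φ n)) θ) atTop (𝓝 (inner ℝ r θ)) := fun θ => by
    rw [hφ]
    exact (hr θ).comp (hφ₁.comp hφ₂).tendsto_atTop
  have hwg : ∀ j θ, Tendsto (fun n => inner ℝ (G (φ n) j) θ) atTop (𝓝 (inner ℝ (g j) θ)) := by
    rw [hφ, hg, Fin.forall_fin_two]
    exact ⟨fun θ => (hg₀ θ).comp hφ₂.tendsto_atTop, fun θ => hg₁ θ⟩
  have hrg : ∀ j, IsWeakPartial Ω j r (g j) := fun j =>
    isWeakPartial_of_tendsto hwr (hwg j) fun n => hRG (φ n) j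
  have hrI : ∀ᵐ x ∂(areaOn Ω), r x ∈ Set.Icc rhoMin 1 := by
    filter_upwards [ae_ge_of_tendsto_inner hwr fun n => (hRI (φ n)).mono fun x hx => hx.1,
      ae_le_of_tendsto_inner hwr fun n => (hRI (φ n)).mono fun x hx => hx.2] with x h1 h2
    exact ⟨h1, h2⟩
  have hwk : ∀ j, weakPartial Ω j r =ᵐ[areaOn Ω] g j := fun j =>
    weakPartial_ae_eq hΩ.isOpen (Lp.memLp _) (hrg j)
  have hint : ∫ x in Ω, r x = V₀ := by
    have h1 := tendsto_setIntegral_of_tendsto_inner hwr MeasurableSet.univ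
    rw [Measure.restrict_univ] at h1
    refine tendsto_nhds_unique h1 ?_
    have h2 : ∀ n, ∫ x in Ω, R (φ n) x = V₀ := fun n => by
      rw [integral_congr_ae (hR (φ n)), (hρ (φ n)).2.2]
    simp only [h2]
    exact tendsto_const_nhds
  have hMg : ∀ n j, ‖G (φ n) j - g j‖ₑ ≤ ((M + ‖g 0‖ + ‖g 1‖).toNNReal : ℝ≥0∞) := fun n j => by
    rw [← ofReal_norm]
    refine ENNReal.ofReal_le_ofReal ((norm_sub_le _ _).trans ?_)
    have h1 := hM (φ n) j
    have h2 : ‖g j‖ ≤ ‖g 0‖ + ‖g 1‖ := by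
      fin_cases j
      · exact le_add_of_nonneg_right (norm_nonneg _)
      · exact le_add_of_nonneg_left (norm_nonneg _)
    linarith
  have hstrong := tendsto_norm_of_tendsto_inner hΩ.isOpen hΩ.isBounded
    (w := fun n => R (φ n) - r) (fun n j => (hRG (φ n) j).sub (hrg j)) hMg
    -- Two numbers of `[rhoMin, 1]` differ by at most 1, which is the uniform bound that the
    -- compactness theorem requires.
    (fun n => by
      filter_upwards [Lp.coeFn_sub (R (φ n)) r, hRI (φ n), hrI] with x h1 h2 h3
      rw [h1, Pi.sub_apply, ← ofReal_norm, ENNReal.ofReal_le_one, Real.norm_eq_abs, abs_le]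
      constructor <;> linarith [h2.1, h2.2, h3.1, h3.2])
    (fun θ => by
      have := (hwr θ).sub_const (inner ℝ r θ)
      simpa only [inner_sub_left, sub_self] using this)
  have hLp : Tendsto (fun n => R (φ n)) atTop (𝓝 r) := by
    rw [tendsto_iff_edist_tendsto_0]
    have := (ENNReal.continuous_rpow_const (y := 1 / 2)).tendsto 0 |>.comp hstrong
    rw [ENNReal.zero_rpow_of_pos (by norm_num)] at this
    refine this.congr fun n => ?_
    rw [Function.comp_apply, ← ENNReal.rpow_natCast, ← ENNReal.rpow_mul, edist_eq_enorm_sub]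
    norm_num
  obtain ⟨ns, hns, hae⟩ := (tendstoInMeasure_of_tendsto_Lp hLp).exists_seq_tendsto_ae
  refine ⟨r, ⟨⟨Lp.memLp r, fun j => ⟨g j, Lp.memLp _, hrg j⟩⟩, hrI, hint⟩, fun n => φ (ns n),
    hφm.comp hns, ?_, g, fun j => ⟨(hwk j).symm, fun θ => (hwg j θ).comp hns.tendsto_atTop⟩⟩
  filter_upwards [hae, ae_all_iff.2 hR] with x h1 h2
  simpa only [h2] using h1

end

/-! ### The direct method. -/

section

variable {Ω ΓD ΓN : Set Plane} {f g : Plane → Plane} {mu lam p rhoMin V₀ β γ : ℝ}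

/-! ### Existence of a minimizer -/

theorem doubleWell_nonneg (rhoMin s : ℝ) : 0 ≤ doubleWell rhoMin s := by
  unfold doubleWell
  positivity

theorem continuous_doubleWell (rhoMin : ℝ) : Continuous (doubleWell rhoMin) := by
  unfold doubleWell
  fun_prop

theorem doubleWell_le_one {s : ℝ} (hrho0 : 0 < rhoMin) (hs : s ∈ Set.Icc rhoMin 1) :
    doubleWell rhoMin s ≤ 1 := by
  unfold doubleWell
  have h1 : (s - rhoMin) ^ 2 ≤ 1 := by
    rw [sq_le_one_iff_abs_le_one, abs_le]
    constructor <;> linarith [hs.1, hs.2]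
  have h2 : (s - 1) ^ 2 ≤ 1 := by
    rw [sq_le_one_iff_abs_le_one, abs_le]
    constructor <;> linarith [hs.1, hs.2]
  have := mul_le_one₀ h1 (sq_nonneg _) h2
  linarith

theorem wellConstant_pos (hrho1 : rhoMin < 1) : 0 < wellConstant rhoMin := by
  refine intervalIntegral.intervalIntegral_pos_of_pos_on ?_ (fun s hs => ?_) hrho1
  · exact ((continuous_doubleWell rhoMin).const_mul 2).sqrt.intervalIntegrable _ _
  · have h1 := sub_pos.2 hs.1
    have h2 : s - 1 ≠ 0 := (sub_neg.2 hs.2).ne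
    unfold doubleWell
    positivity

theorem admissible_nonempty (hΩ : IsBoundedLipschitzDomain Ω)
    (hVlower : rhoMin * (volume Ω).toReal ≤ V₀) (hVupper : V₀ ≤ (volume Ω).toReal) :
    (admissible Ω rhoMin V₀).Nonempty := by
  have : IsFiniteMeasure (areaOn Ω) := ⟨by simpa using hΩ.isBounded.measure_lt_top⟩
  have hpos : 0 < (volume Ω).toReal := ENNReal.toReal_pos
    (hΩ.isOpen.measure_pos volume hΩ.isConnected.nonempty).ne' hΩ.isBounded.measure_lt_top.ne
  -- The constant density of the prescribed volume; the two bounds on `V₀` place it in `[rhoMin,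
  -- 1]`.
  refine ⟨fun _ => V₀ / (volume Ω).toReal, ⟨memLp_const _, fun i => ⟨fun _ => 0, MemLp.zero', ?_⟩⟩,
    Eventually.of_forall fun _ => ⟨(le_div_iff₀ hpos).2 hVlower, (div_le_one hpos).2 hVupper⟩, ?_⟩
  · have h := isWeakPartial_of_isSmooth
      (contDiff_const : IsSmooth fun _ : Plane => V₀ / (volume Ω).toReal) Ω i
    have e : partialDeriv i (fun _ : Plane => V₀ / (volume Ω).toReal) = fun _ => 0 := by
      funext x
      simp [partialDeriv]
    rwa [e] at h
  · rw [integral_const, smul_eq_mul, measureReal_restrict_apply_univ, measureReal_def,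
      mul_div_cancel₀ _ hpos.ne']

theorem integral_sum_weakPartial_sq {ρ : Plane → ℝ} {G : Fin 2 → Lp ℝ 2 (areaOn Ω)}
    (hG : ∀ j, G j =ᵐ[areaOn Ω] weakPartial Ω j ρ) :
    ∫ x in Ω, ∑ i, weakPartial Ω i ρ x ^ 2 = ∑ j, ‖G j‖ ^ 2 := by
  simp only [← real_inner_self_eq_norm_sq, L2.inner_def]
  rw [← integral_finsetSum _ fun i _ => L2.integrable_inner _ _]
  refine integral_congr_ae ?_
  filter_upwards [ae_all_iff.2 hG] with x h
  simp only [h, RCLike.inner_apply, conj_trivial, sq]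

theorem modicaMortola_eq {ρ : Plane → ℝ} {G : Fin 2 → Lp ℝ 2 (areaOn Ω)}
    (hG : ∀ j, G j =ᵐ[areaOn Ω] weakPartial Ω j ρ) : modicaMortola Ω rhoMin γ ρ =
      γ / 2 * ∑ j, ‖G j‖ ^ 2 + 1 / γ * ∫ x in Ω, doubleWell rhoMin (ρ x) := by
  rw [modicaMortola, integral_sum_weakPartial_sq hG]

theorem frobenius_elasticTensor_nonneg (hmu : 0 ≤ mu) (hlam : 0 ≤ lam)
    (A : Matrix (Fin 2) (Fin 2) ℝ) : 0 ≤ frobenius (elasticTensor mu lam A) A := by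
  rw [frobenius_elasticTensor]
  have h1 : 0 ≤ ∑ i, ∑ j, A i j * A i j :=
    Finset.sum_nonneg fun i _ => Finset.sum_nonneg fun j _ => mul_self_nonneg _
  have h2 := mul_self_nonneg (∑ i, A i i)
  exact add_nonneg (mul_nonneg (by positivity) h1) (mul_nonneg hlam h2)

theorem elasticForm_nonneg (hmu : 0 ≤ mu) (hlam : 0 ≤ lam) (hrho0 : 0 < rhoMin) {ρ : Plane → ℝ}
    (hρ : ρ ∈ admissible Ω rhoMin V₀) (u : Plane → Plane) : 0 ≤ elasticForm Ω mu lam p ρ u u := by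
  refine integral_nonneg_of_ae ?_
  filter_upwards [hρ.2.1] with x hx
  exact mul_nonneg (Real.rpow_nonneg (hrho0.le.trans hx.1) p)
    (frobenius_elasticTensor_nonneg hmu hlam _)

theorem MemVD.integrable_energy {u : Plane → Plane} (hu : MemVD Ω ΓD u) (mu lam : ℝ) :
    Integrable (fun x => frobenius (elasticTensor mu lam (strain Ω u x)) (strain Ω u x))
      (areaOn Ω) := by
  obtain ⟨T, hT, -⟩ := hu
  have hs : ∀ i j, MemLp (fun x => strain Ω u x i j) 2 (areaOn Ω) := fun i j =>
    (((hT i).1.memLp_weakPartial j).add ((hT j).1.memLp_weakPartial i)).const_mul (1 / 2)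
  have ht : MemLp (fun x => ∑ i, strain Ω u x i i) 2 (areaOn Ω) :=
    memLp_finsetSum _ fun i _ => hs i i
  have h2 : ∀ i j, Integrable (fun x => strain Ω u x i j * strain Ω u x i j) (areaOn Ω) :=
    fun i j => (hs i j).integrable_mul (hs i j)
  simp only [frobenius_elasticTensor]
  exact ((integrable_finsetSum _ fun i _ => integrable_finsetSum _ fun j _ => h2 i j).const_mul
    (2 * mu)).add ((ht.integrable_mul ht).const_mul lam)

/-- The field is fixed and only the density varies, so the unweighted energy of `u` is an integrable
majorant. -/
theorem tendsto_elasticForm {u : Plane → Plane} (hu : MemVD Ω ΓD u) (hrho0 : 0 < rhoMin)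
    (hp : 0 ≤ p) {ρ : ℕ → Plane → ℝ} {ρs : Plane → ℝ} (hρ : ∀ n, ρ n ∈ admissible Ω rhoMin V₀)
    (h : ∀ᵐ x ∂(areaOn Ω), Tendsto (fun n => ρ n x) atTop (𝓝 (ρs x))) :
    Tendsto (fun n => elasticForm Ω mu lam p (ρ n) u u) atTop
      (𝓝 (elasticForm Ω mu lam p ρs u u)) := by
  have hE := hu.integrable_energy mu lam
  refine tendsto_integral_of_dominated_convergence _ (fun n => ?_) hE.norm (fun n => ?_) ?_
  · exact (((hρ n).1.1.aestronglyMeasurable.aemeasurable.pow_const p).aestronglyMeasurable).mul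
      hE.aestronglyMeasurable
  · filter_upwards [(hρ n).2.1] with x hx
    have h0 := hrho0.le.trans hx.1
    rw [norm_mul, Real.norm_of_nonneg (Real.rpow_nonneg h0 p)]
    exact mul_le_of_le_one_left (norm_nonneg _) (Real.rpow_le_one h0 hx.2 hp)
  · filter_upwards [h] with x hx
    exact (hx.rpow_const (Or.inr hp)).mul_const _

theorem tendsto_integral_doubleWell [IsFiniteMeasure (areaOn Ω)] (hrho0 : 0 < rhoMin)
    {ρ : ℕ → Plane → ℝ} {ρs : Plane → ℝ} (hρ : ∀ n, ρ n ∈ admissible Ω rhoMin V₀)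
    (h : ∀ᵐ x ∂(areaOn Ω), Tendsto (fun n => ρ n x) atTop (𝓝 (ρs x))) :
    Tendsto (fun n => ∫ x in Ω, doubleWell rhoMin (ρ n x)) atTop
      (𝓝 (∫ x in Ω, doubleWell rhoMin (ρs x))) := by
  refine tendsto_integral_of_dominated_convergence (fun _ => 1) (fun n => ?_)
    (integrable_const 1) (fun n => ?_) ?_
  · exact (continuous_doubleWell rhoMin).comp_aestronglyMeasurable (hρ n).1.1.aestronglyMeasurable
  · filter_upwards [(hρ n).2.1] with x hx
    rw [Real.norm_of_nonneg (doubleWell_nonneg _ _)]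
    exact doubleWell_le_one hrho0 hx
  · filter_upwards [h] with x hx
    exact ((continuous_doubleWell rhoMin).tendsto _).comp hx

theorem exists_isState_unique (hΩ : IsBoundedLipschitzDomain Ω)
    (hΓ : IsBoundarySplitting Ω ΓD ΓN) (hne : ΓD.Nonempty) (hf : MemLp f 2 (areaOn Ω))
    (hg : MemLp g 2 (lengthOn ΓN)) (hmu : 0 < mu) (hlam : 0 ≤ lam) (hp : 0 ≤ p)
    (hrho0 : 0 < rhoMin) {ρ : Plane → ℝ} (hρ : ρ ∈ admissible Ω rhoMin V₀) :
    ∃ u, IsState Ω ΓD ΓN f g mu lam p ρ u ∧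
      ∀ u', IsState Ω ΓD ΓN f g mu lam p ρ u' → u' =ᵐ[areaOn Ω] u := by
  obtain ⟨F, hF⟩ := exists_load hΓ hf hg
  obtain ⟨q, hq, hqb⟩ := exists_weight hrho0 hp hρ
  have hq₀ := hqb.mono fun x hx => hx.1
  have hpos : 0 < rhoMin ^ p := Real.rpow_pos_of_pos hrho0 p
  obtain ⟨U, hU⟩ := exists_isJetState hΩ hΓ hne hmu hlam hpos hq₀ F
  obtain ⟨u, T, hu, hUu⟩ := hU.exists_isState hΩ hΓ hF hq
  refine ⟨u, hu, fun u' hu' => ?_⟩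
  obtain ⟨U', T', hU', hUu'⟩ := hu'.exists_isJetState hΩ hΓ hF hq
  obtain rfl := hU.unique hΩ hΓ hne hmu hlam hpos hq₀ hU'
  exact hUu'.ae_eq hUu

/-- The compliance is bounded below by a functional that is affine in `ρ ^ p` and touches it
at `ρs`. -/
theorem IsState.two_mul_sub_le (hΩ : IsBoundedLipschitzDomain Ω)
    (hΓ : IsBoundarySplitting Ω ΓD ΓN) (hf : MemLp f 2 (areaOn Ω))
    (hg : MemLp g 2 (lengthOn ΓN)) (hmu : 0 ≤ mu) (hlam : 0 ≤ lam) (hp : 0 ≤ p)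
    (hrho0 : 0 < rhoMin) {ρ ρs : Plane → ℝ} (hρ : ρ ∈ admissible Ω rhoMin V₀)
    (hρs : ρs ∈ admissible Ω rhoMin V₀) {u us : Plane → Plane}
    (hu : IsState Ω ΓD ΓN f g mu lam p ρ u) (hus : IsState Ω ΓD ΓN f g mu lam p ρs us) :
    2 * elasticForm Ω mu lam p ρs us us - elasticForm Ω mu lam p ρ us us ≤
      elasticForm Ω mu lam p ρ u u := by
  obtain ⟨F, hF⟩ := exists_load hΓ hf hg
  obtain ⟨q, hq, hqb⟩ := exists_weight hrho0 hp hρ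
  obtain ⟨qs, hqs, -⟩ := exists_weight hrho0 hp hρs
  obtain ⟨U, T, hU, hUu⟩ := hu.exists_isJetState hΩ hΓ hF hq
  obtain ⟨V, S, hV, hVv⟩ := hus.exists_isJetState hΩ hΓ hF hqs
  -- The state equation for `ρs`, tested with its own solution, identifies the compliance at `ρs`
  -- with `F V`.
  rw [elasticForm_eq_weightForm hqs hVv hVv, hV.2 V hV.1, elasticForm_eq_weightForm hq hVv hVv,
    elasticForm_eq_weightForm hq hUu hUu]
  exact hU.two_mul_sub_le hmu hlam
    (hqb.mono fun x hx => (Real.rpow_nonneg hrho0.le p).trans hx.1) hV.1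

theorem objective_eq {ρ : Plane → ℝ} {G : Fin 2 → Lp ℝ 2 (areaOn Ω)} {u : Plane → Plane}
    (hG : ∀ j, G j =ᵐ[areaOn Ω] weakPartial Ω j ρ) : objective Ω mu lam p rhoMin β γ ρ u =
      elasticForm Ω mu lam p ρ u u + β / wellConstant rhoMin *
        (γ / 2 * ∑ j, ‖G j‖ ^ 2 + 1 / γ * ∫ x in Ω, doubleWell rhoMin (ρ x)) := by
  rw [objective, modicaMortola_eq hG]

theorem mul_sq_norm_le_objective (hmu : 0 ≤ mu) (hlam : 0 ≤ lam) (hrho0 : 0 < rhoMin)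
    (hrho1 : rhoMin < 1) (hβ : 0 < β) (hγ : 0 < γ) {ρ : Plane → ℝ}
    (hρ : ρ ∈ admissible Ω rhoMin V₀) (u : Plane → Plane) {G : Fin 2 → Lp ℝ 2 (areaOn Ω)}
    (hG : ∀ j, G j =ᵐ[areaOn Ω] weakPartial Ω j ρ) (j : Fin 2) :
    β / wellConstant rhoMin * (γ / 2) * ‖G j‖ ^ 2 ≤ objective Ω mu lam p rhoMin β γ ρ u := by
  rw [objective_eq hG]
  have h1 := elasticForm_nonneg (p := p) hmu hlam hrho0 hρ u
  have h2 : 0 < β / wellConstant rhoMin := div_pos hβ (wellConstant_pos hrho1)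
  have h3 : 0 ≤ 1 / γ * ∫ x in Ω, doubleWell rhoMin (ρ x) :=
    mul_nonneg (by positivity) (integral_nonneg fun x => doubleWell_nonneg _ _)
  have h4 : ‖G j‖ ^ 2 ≤ ∑ j, ‖G j‖ ^ 2 :=
    Finset.single_le_sum (f := fun j => ‖G j‖ ^ 2) (fun _ _ => sq_nonneg _) (Finset.mem_univ j)
  have h5 := mul_le_mul_of_nonneg_left h4 (half_pos hγ).le
  rw [mul_assoc]
  have h6 := mul_le_mul_of_nonneg_left (h5.trans (le_add_of_nonneg_right h3)) h2.le
  linarith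

/-- The tangent to the squared norm at `y`. Being affine in `x` and exact at `x = y`, it yields weak
lower semicontinuity of the gradient term. -/
theorem two_inner_sub_le {H : Type*} [NormedAddCommGroup H] [InnerProductSpace ℝ H] (x y : H) :
    2 * inner ℝ x y - ‖y‖ ^ 2 ≤ ‖x‖ ^ 2 := by
  have := norm_sub_sq_real x y
  linarith [sq_nonneg ‖x - y‖]

/-- Lower semicontinuity of the objective along a minimizing sequence. -/
theorem objective_le_of_tendsto (hΩ : IsBoundedLipschitzDomain Ω)
    (hΓ : IsBoundarySplitting Ω ΓD ΓN) (hf : MemLp f 2 (areaOn Ω))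
    (hg : MemLp g 2 (lengthOn ΓN)) (hmu : 0 ≤ mu) (hlam : 0 ≤ lam) (hp : 0 ≤ p)
    (hrho0 : 0 < rhoMin) (hrho1 : rhoMin < 1) (hβ : 0 < β) (hγ : 0 < γ)
    {ρ : ℕ → Plane → ℝ} {ρs : Plane → ℝ} (hρ : ∀ n, ρ n ∈ admissible Ω rhoMin V₀)
    (hρs : ρs ∈ admissible Ω rhoMin V₀)
    (hlim : ∀ᵐ x ∂(areaOn Ω), Tendsto (fun n => ρ n x) atTop (𝓝 (ρs x)))
    {G : ℕ → Fin 2 → Lp ℝ 2 (areaOn Ω)} {Gs : Fin 2 → Lp ℝ 2 (areaOn Ω)}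
    (hG : ∀ n j, G n j =ᵐ[areaOn Ω] weakPartial Ω j (ρ n))
    (hGs : ∀ j, Gs j =ᵐ[areaOn Ω] weakPartial Ω j ρs)
    (hweak : ∀ j θ, Tendsto (fun n => inner ℝ (G n j) θ) atTop (𝓝 (inner ℝ (Gs j) θ)))
    {u : ℕ → Plane → Plane} {us : Plane → Plane}
    (hu : ∀ n, IsState Ω ΓD ΓN f g mu lam p (ρ n) (u n))
    (hus : IsState Ω ΓD ΓN f g mu lam p ρs us) {m : ℝ}
    (hm : Tendsto (fun n => objective Ω mu lam p rhoMin β γ (ρ n) (u n)) atTop (𝓝 m)) :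
    objective Ω mu lam p rhoMin β γ ρs us ≤ m := by
  have : IsFiniteMeasure (areaOn Ω) := ⟨by simpa using hΩ.isBounded.measure_lt_top⟩
  have hb : 0 < β / wellConstant rhoMin := div_pos hβ (wellConstant_pos hrho1)
  have h1 := (tendsto_elasticForm (mu := mu) (lam := lam) hus.1 hrho0 hp hρ hlim).const_sub
    (2 * elasticForm Ω mu lam p ρs us us)
  have h2 := (tendsto_integral_doubleWell hrho0 hρ hlim).const_mul (1 / γ)
  have h3 : Tendsto (fun n => ∑ j, (2 * inner ℝ (G n j) (Gs j) - ‖Gs j‖ ^ 2)) atTop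
      (𝓝 (∑ j, ‖Gs j‖ ^ 2)) := by
    refine tendsto_finsetSum _ fun j _ => ?_
    have := ((hweak j (Gs j)).const_mul 2).sub_const (‖Gs j‖ ^ 2)
    rwa [real_inner_self_eq_norm_sq, two_mul, add_sub_cancel_right] at this
  -- The sum of the three lower bounds converges, and its limit is exactly the objective at `ρs`.
  have h4 := h1.add (((h3.const_mul (γ / 2)).add h2).const_mul (β / wellConstant rhoMin))
  rw [two_mul, add_sub_cancel_right, ← objective_eq hGs] at h4
  refine le_of_tendsto_of_tendsto' h4 hm fun n => ?_
  rw [objective_eq (hG n)]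
  refine add_le_add ?_ (mul_le_mul_of_nonneg_left (add_le_add (mul_le_mul_of_nonneg_left
    (Finset.sum_le_sum fun j _ => two_inner_sub_le _ _) (half_pos hγ).le) le_rfl) hb.le)
  exact two_mul (elasticForm Ω mu lam p ρs us us) ▸
    (hu n).two_mul_sub_le hΩ hΓ hf hg hmu hlam hp hrho0 (hρ n) hρs hus

theorem exists_minimizer (hΩ : IsBoundedLipschitzDomain Ω)
    (hΓ : IsBoundarySplitting Ω ΓD ΓN) (hne : ΓD.Nonempty) (hf : MemLp f 2 (areaOn Ω))
    (hg : MemLp g 2 (lengthOn ΓN)) (hmu : 0 < mu) (hlam : 0 ≤ lam) (hp : 0 ≤ p)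
    (hrho0 : 0 < rhoMin) (hrho1 : rhoMin < 1)
    (hVlower : rhoMin * (volume Ω).toReal ≤ V₀) (hVupper : V₀ ≤ (volume Ω).toReal)
    (hβ : 0 < β) (hγ : 0 < γ) :
    ∃ ρs ∈ admissible Ω rhoMin V₀, ∃ us, IsState Ω ΓD ΓN f g mu lam p ρs us ∧
      ∀ ρ ∈ admissible Ω rhoMin V₀, ∀ u, IsState Ω ΓD ΓN f g mu lam p ρ u →
        objective Ω mu lam p rhoMin β γ ρs us ≤ objective Ω mu lam p rhoMin β γ ρ u := by
  have hgrad : ∀ ρ ∈ admissible Ω rhoMin V₀, ∃ G : Fin 2 → Lp ℝ 2 (areaOn Ω),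
      ∀ j, G j =ᵐ[areaOn Ω] weakPartial Ω j ρ := fun ρ hρ =>
    ⟨fun j => (hρ.1.memLp_weakPartial j).toLp _, fun j => (hρ.1.memLp_weakPartial j).coeFn_toLp⟩
  have hκ : 0 < β / wellConstant rhoMin * (γ / 2) :=
    mul_pos (div_pos hβ (wellConstant_pos hrho1)) (half_pos hγ)
  -- The values are taken over all pairs of a density and one of its states, so no selection of
  -- states is required.
  obtain ⟨S, hS⟩ : ∃ S : Set ℝ, S = {t | ∃ ρ ∈ admissible Ω rhoMin V₀, ∃ u,
      IsState Ω ΓD ΓN f g mu lam p ρ u ∧ objective Ω mu lam p rhoMin β γ ρ u = t} := ⟨_, rfl⟩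
  have hSne : S.Nonempty := by
    obtain ⟨ρ, hρ⟩ := admissible_nonempty hΩ hVlower hVupper
    obtain ⟨u, hu, -⟩ := exists_isState_unique hΩ hΓ hne hf hg hmu hlam hp hrho0 hρ
    rw [hS]
    exact ⟨_, ρ, hρ, u, hu, rfl⟩
  have hSb : BddBelow S := by
    refine ⟨0, fun t ht => ?_⟩
    rw [hS] at ht
    obtain ⟨ρ, hρ, u, -, rfl⟩ := ht
    obtain ⟨G, hG⟩ := hgrad ρ hρ
    exact (mul_nonneg hκ.le (sq_nonneg _)).trans
      (mul_sq_norm_le_objective hmu.le hlam hrho0 hrho1 hβ hγ hρ u hG 0)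
  obtain ⟨t, hanti, htend, ht⟩ := exists_seq_tendsto_sInf hSne hSb
  have ht' : ∀ n, t n ∈ {t | ∃ ρ ∈ admissible Ω rhoMin V₀, ∃ u,
      IsState Ω ΓD ΓN f g mu lam p ρ u ∧ objective Ω mu lam p rhoMin β γ ρ u = t} := hS ▸ ht
  choose ρ hρ u hu hobj using ht'
  choose G hG using fun n => hgrad (ρ n) (hρ n)
  -- The minimizing sequence of values is nonincreasing, so its first term bounds every gradient
  -- term.
  have hM : ∀ n j, ‖G n j‖ ≤ √(t 0 / (β / wellConstant rhoMin * (γ / 2))) := fun n j => by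
    refine Real.le_sqrt_of_sq_le ((le_div_iff₀' hκ).2 ?_)
    have h1 := mul_sq_norm_le_objective (p := p) hmu.le hlam hrho0 hrho1 hβ hγ (hρ n) (u n) (hG n) j
    rw [hobj n] at h1
    exact h1.trans (hanti (Nat.zero_le n))
  obtain ⟨ρs, hρs, φ, hφ, hlim, Gs, hGs⟩ := exists_subseq_admissible hΩ hrho0 hρ hG hM
  obtain ⟨us, hus, -⟩ := exists_isState_unique hΩ hΓ hne hf hg hmu hlam hp hrho0 hρs
  refine ⟨ρs, hρs, us, hus, fun ρ' hρ' u' hu' => ?_⟩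
  refine le_trans ?_ (csInf_le hSb (hS ▸ ⟨ρ', hρ', u', hu', rfl⟩))
  refine objective_le_of_tendsto hΩ hΓ hf hg hmu.le hlam hp hrho0 hrho1 hβ hγ
    (fun n => hρ (φ n)) hρs hlim (fun n => hG (φ n)) (fun j => (hGs j).1) (fun j => (hGs j).2)
    (fun n => hu (φ n)) hus ?_
  simp only [hobj]
  exact htend.comp hφ.tendsto_atTop

end

end

end MinCompliance

theorem mainTheorem5
    (Ω ΓD ΓN : Set MinCompliance.Plane)
    (hΩ : MinCompliance.IsBoundedLipschitzDomain Ω)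
    (hΓ : MinCompliance.IsBoundarySplitting Ω ΓD ΓN)
    (hΓD : ΓD.Nonempty)
    (f g : MinCompliance.Plane → MinCompliance.Plane)
    (hf : MemLp f 2 (MinCompliance.areaOn Ω))
    (hg : MemLp g 2 (MinCompliance.lengthOn ΓN))
    (mu lam : ℝ) (hmu : 0 < mu) (hlam : 0 < lam)
    (p : ℝ) (hp : 1 < p)
    (rhoMin : ℝ) (hrho0 : 0 < rhoMin) (hrho1 : rhoMin < 1)
    (V₀ : ℝ) (hVlower : rhoMin * (volume Ω).toReal ≤ V₀) (hVupper : V₀ ≤ (volume Ω).toReal)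
    (β : ℝ) (hβ : 0 < β)
    (γ : ℝ) (hγ : 0 < γ) :
    (∀ ρ ∈ MinCompliance.admissible Ω rhoMin V₀,
      ∃ u, MinCompliance.IsState Ω ΓD ΓN f g mu lam p ρ u ∧
        ∀ u', MinCompliance.IsState Ω ΓD ΓN f g mu lam p ρ u' →
          u' =ᵐ[MinCompliance.areaOn Ω] u) ∧
    ∃ ρs ∈ MinCompliance.admissible Ω rhoMin V₀,
      ∃ us, MinCompliance.IsState Ω ΓD ΓN f g mu lam p ρs us ∧
        ∀ ρ ∈ MinCompliance.admissible Ω rhoMin V₀,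
          ∀ u, MinCompliance.IsState Ω ΓD ΓN f g mu lam p ρ u →
            MinCompliance.objective Ω mu lam p rhoMin β γ ρs us ≤
              MinCompliance.objective Ω mu lam p rhoMin β γ ρ u := by
  exact ⟨fun ρ hρ => MinCompliance.exists_isState_unique hΩ hΓ hΓD hf hg hmu hlam.le
      (zero_le_one.trans hp.le) hrho0 hρ,
    MinCompliance.exists_minimizer hΩ hΓ hΓD hf hg hmu hlam.le (zero_le_one.trans hp.le) hrho0 hrho1
      hVlower hVupper hβ hγ⟩
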